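/- **Localization game.** Let $G$ be a finite graph and $k\ge 1$ an integer. In each round the cops place sensors on a set of exactly $k$ vertices of $G$, chosen from all information obtained in earlier rounds; then the robber, whose position is hidden, moves to a neighbouring vertex or stays put (in the first round she chooses any starting vertex); then the cops learn the graph distance from each sensor to the robber. The cops win as soon as the information from all rounds so far determines the current position of the robber. The localization number $\zeta(G)$ is the least $k\ge 1$ for which the cops have a strategy that wins eventually against every behaviour of the robber. **Random geometric graph on the torus.** For $n\in\mathbb N$ and $r>0$, $\mathcal T(n,r)$ is the random graph on $n$ vertices $v_1,\dots,v_n$ obtained from independent uniform points $x_1,\dots,x_n\in[0,\sqrt n]^2$ by joining $v_i$ and $v_j$ ($i\ne j$) whenever $d_T(x_i,x_j)\le r$, where $d_T$ is the metric of the flat torus $(\mathbb R/\sqrt n\,\mathbb Z)^2$ inherited from the Euclidean metric. **Theorem.** There are absolute constants $c,C>0$ such that the following holds. Let $r=r(n)$ satisfy $70\sqrt{\log n}\le r<\sqrt n/4$ for all sufficiently large $n$, and let $G\in\mathcal T(n,r)$. Then, with probability tending to $1$ as $n\to\infty$, all of the following hold: 1. if $\log^{3/2} n\le r<\sqrt n/4$,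 then $c\,\dfrac{r^{4/3}}{(\log n)^{1/3}}\le\zeta(G)\le C\,r^{4/3}$; 2. if $\log n\le r<\log^{3/2} n$, then $c\,\dfrac{r^{4/3}}{(\log n)^{1/3}}\le\zeta(G)\le C\log^2 n$; 3. if $\dfrac{\log n}{(\log\log n)^{1/2}\log\log\log n}\le r<\log n$, then $c\,\dfrac{r^2}{\log n}\le\zeta(G)\le C\,r^2$; 4. if $70\sqrt{\log n}\le r<\dfrac{\log n}{(\log\log n)^{1/2}\log\log\log n}$, then $c\,\dfrac{\log n}{\log(r^2/\log n)}\le\zeta(G)\le C\,r^2$. Here $\log$ is the natural logarithm. -/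

import Mathlib

open MeasureTheory ProbabilityTheory Filter Topology

noncomputable section

namespace LocalizationGame

variable {V : Type*} (G : SimpleGraph V)

/-- What the cops learn in one round from sensors on `S` when the robber is at `v`: for each
sensor, its graph distance to `v` (infinite if `v` is not reachable from the sensor). -/
def signature (S : Finset V) (v : V) : Set (V × ℕ∞) :=
  {p | p.1 ∈ S ∧ p.2 = G.edist p.1 v}

/-- A strategy of the cops: the next set of sensors as a function of the list of all past
signatures (the latest one first). -/
abbrev CopStrategy (V : Type*) : Type _ := List (Set (V × ℕ∞)) → Finset V

/-- A trajectory of the robber; `w t` is her position in round `t` (rounds are numbered from `0`).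
In each round after the first she moves to a neighbour or stays put. -/
def IsTrajectory (w : ℕ → V) : Prop :=
  ∀ t, w (t + 1) = w t ∨ G.Adj (w t) (w (t + 1))

/-- The information the cops have gathered in the first `t` rounds when they play `σ` and the
robber follows `w`. -/
def history (σ : CopStrategy V) (w : ℕ → V) : ℕ → List (Set (V × ℕ∞))
  | 0 => []
  | t + 1 => signature G (σ (history σ w t)) (w t) :: history σ w t

/-- After round `t` the information gathered determines the position of the robber: every
trajectory giving the same information is at the same vertex in round `t`. -/
def LocatedAt (σ : CopStrategy V) (w : ℕ → V) (t : ℕ) : Prop :=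
  ∀ w' : ℕ → V, IsTrajectory G w' →
    history G σ w' (t + 1) = history G σ w (t + 1) → w' t = w t

/-- With exactly `k` sensors per round, the cops have a strategy that eventually locates the
robber, whatever she does. -/
def CopsWin (k : ℕ) : Prop :=
  ∃ σ : CopStrategy V, (∀ h, (σ h).card = k) ∧
    ∀ w : ℕ → V, IsTrajectory G w → ∃ t, LocatedAt G σ w t

/-- The localization number `ζ(G)`: the least `k ≥ 1` such that the cops win with `k` sensors. -/
def localizationNumber : ℕ := sInf {k | 1 ≤ k ∧ CopsWin G k}

/-- On a nonempty finite graph the minimum in the definition of `ζ(G)` is over a nonempty set. -/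
theorem copsWin_card [Fintype V] [Nonempty V] :
    Fintype.card V ∈ {k | 1 ≤ k ∧ CopsWin G k} := by
  refine ⟨Fintype.card_pos, fun _ => Finset.univ, fun _ => Finset.card_univ, fun w _ => ⟨0, ?_⟩⟩
  intro w' _ h
  simp only [history, List.cons.injEq, and_true] at h
  have hm : (w 0, (0 : ℕ∞)) ∈ signature G Finset.univ (w' 0) := by
    rw [h]; simp [signature]
  have h0 : G.edist (w 0) (w' 0) = 0 := by simpa [signature, eq_comm] using hm
  exact (SimpleGraph.edist_eq_zero_iff.1 h0).symm

end LocalizationGame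

namespace RandomGeometric

/-- The distance on the flat torus `(ℝ / L ℤ)²` inherited from the Euclidean distance, between
the classes of two points of the plane. -/
def torusDist (L : ℝ) (x y : ℝ × ℝ) : ℝ :=
  √(‖((x.1 - y.1 : ℝ) : AddCircle L)‖ ^ 2 + ‖((x.2 - y.2 : ℝ) : AddCircle L)‖ ^ 2)

theorem torusDist_comm (L : ℝ) (x y : ℝ × ℝ) : torusDist L x y = torusDist L y x := by
  unfold torusDist
  rw [← neg_sub y.1 x.1, ← neg_sub y.2 x.2, AddCircle.coe_neg, AddCircle.coe_neg, norm_neg,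
    norm_neg]

/-- The geometric graph on the torus of side `√n` with vertices at `x 0, …, x (n - 1)` and
threshold `r`. -/
def torusGraph {n : ℕ} (r : ℝ) (x : Fin n → ℝ × ℝ) : SimpleGraph (Fin n) where
  Adj i j := i ≠ j ∧ torusDist (√n) (x i) (x j) ≤ r
  symm := ⟨fun _ _ h => ⟨h.1.symm, torusDist_comm (√n) _ _ ▸ h.2⟩⟩
  loopless := ⟨fun _ h => h.1 rfl⟩

/-- The law of `n` independent points, each uniform in the square `[0, √n]²`. -/
def pointsLaw (n : ℕ) : Measure (Fin n → ℝ × ℝ) :=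
  Measure.pi fun _ =>
    ProbabilityTheory.cond volume (Set.Icc (0 : ℝ) (√n) ×ˢ Set.Icc (0 : ℝ) (√n))

end RandomGeometric

end

/-! ### The game on a finite graph: an escape criterion and a halving strategy -/

namespace LocalizationGame

variable {V : Type*} {G : SimpleGraph V}

/-! Upper bounds. The cops halve their uncertainty in every round: if the robber is within `2R` of a
known vertex and that ball is covered by `k` balls of radius `R`, sensors at the centres reveal one
within `R` of her, and her next move adds one step (`copsWin_of_doubling`). When the vertices are
dense in the torus, graph distance is comparable to torus distance divided by `r`, so 441 centres
suffice at every scale, and it remains to resolve sets of diameter `O(r)`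
(`localizationNumber_le_of_dense`). Sensors on all `O(r²)` vertices of such a set do this. A better
choice for large `r` is `k` random sensors nearby: two vertices at distance `δ` are told apart by
every sensor in the difference of their discs of radius `r`, whose relative area is of order `δ/r`,
so a pair is missed with probability about `exp(-ckδ/r)`. About `r² (r/k)²` pairs are missed, and
one extra sensor for each costs no more than `k` once `k` is of order `r^(4/3)`
(`exists_separating_finset`). Below distance of order `log n / r` the number of separators does not
concentrate; such pairs cost `O(log² n)` sensors.

Lower bounds. The robber stays in a clique that no `k` sensors resolve (`not_copsWin_of_clique`).
The vertices in a square of side `r/5` form a clique. A sensor outside the square sees at most two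
distances in it, and the nearer vertices are those in a union of discs of radius `r` centred at
vertices outside the square (`exists_level_of_clique`). Such a union cuts only `O(m)` of the `m²`
cells of a subdivision (`card_cutCells_le`). With cells of side of order `θ = min(1, (log n /
r)^(1/3))`, about `r²θ²` cells contain exactly two vertices, while each sensor splits only `O(log
n)` of these pairs. Hence `ζ` is at least of order `r²θ² / log n`.

For `r < log n` there is a second obstruction. If a tiny square holds several vertices and the thin
annulus at distance about `r` from it holds no others, these vertices are twins, and almost all of
them must carry sensors. A second moment argument over many disjoint positions finds a cluster of
order `log n / log(r² / log n)` (`negligible_not_hasTwins`). -/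

theorem signature_eq_iff {S : Finset V} {u v : V} :
    signature G S u = signature G S v ↔ ∀ s ∈ S, G.edist s u = G.edist s v := by
  constructor
  · intro h s hs
    have : (s, G.edist s u) ∈ signature G S u := ⟨hs, rfl⟩
    rw [h] at this
    exact this.2
  · intro h
    ext ⟨s, d⟩
    simp only [signature, Set.mem_ofPred_eq]
    exact and_congr_right fun hs => by rw [h s hs]

/-- The robber escapes `k` sensors if she can stay in a clique in which no `k` sensors have
pairwise distinct signatures. -/
theorem not_copsWin_of_clique {K : Set V} (hK : ∀ u ∈ K, ∀ v ∈ K, u ≠ v → G.Adj u v) {k : ℕ}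
    (h : ∀ S : Finset V, S.card = k → ∃ u ∈ K, ∃ v ∈ K, u ≠ v ∧
      ∀ s ∈ S, G.edist s u = G.edist s v) : ¬ CopsWin G k := by
  classical
  rintro ⟨σ, hσ, hwin⟩
  choose a ha b hb hab hsig using fun l => h (σ l) (hσ l)
  -- The history when the robber always answers with `a`. It is well defined because the sensors of
  -- a round depend only on earlier signatures.
  let H : ℕ → List (Set (V × ℕ∞)) := fun t =>
    Nat.rec [] (fun _ l => signature G (σ l) (a l) :: l) t
  have hH : ∀ t, H (t + 1) = signature G (σ (H t)) (a (H t)) :: H t := fun t => rfl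
  have traj : ∀ w : ℕ → V, (∀ t, w t ∈ K) → IsTrajectory G w := by
    intro w hw t
    by_cases he : w (t + 1) = w t
    · exact Or.inl he
    · exact Or.inr (hK _ (hw _) _ (hw _) (Ne.symm he))
  have hist : ∀ (w : ℕ → V) (t : ℕ), (∀ s < t, w s = a (H s)) → history G σ w t = H t := by
    intro w t
    induction t with
    | zero => intro _; rfl
    | succ t ih =>
      intro hs
      rw [hH, history, ih fun s h => hs s (by omega), hs t (by omega)]
  obtain ⟨t, ht⟩ := hwin (fun t => a (H t)) (traj _ fun t => ha _)
  -- This trajectory deviates only in round `t`, to a vertex that the sensors of that round cannot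
  -- tell from `a`; both stay in the clique, so every move is legal.
  let w' : ℕ → V := fun s => if s = t then b (H t) else a (H s)
  have h1 : ∀ s < t, w' s = a (H s) := fun s hs => by simp [w', hs.ne]
  have h2 : w' t = b (H t) := by simp [w']
  have := ht w' (traj _ fun s => by by_cases hs : s = t <;> simp [w', hs, ha, hb]) (by
    rw [history, history, hist w' t h1, hist _ t fun _ _ => rfl, h2,
      signature_eq_iff.2 fun s hs => (hsig (H t) s hs).symm])
  rw [h2] at this
  exact hab _ this.symm

theorem le_localizationNumber [Finite V] [Nonempty V] {b : ℝ}
    (h : ∀ k : ℕ, 1 ≤ k → (k : ℝ) < b → ¬ CopsWin G k) : b ≤ localizationNumber G := by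
  have := Fintype.ofFinite V
  have hm := Nat.sInf_mem ⟨_, copsWin_card G⟩
  by_contra! hlt
  exact h _ hm.1 hlt hm.2

/-- The cops win with `k` sensors if every ball of radius `2 * R` is covered by `k` balls of
radius `R` and every ball of radius `3` is resolved by `k` vertices: they locate the robber
up to a distance that decreases geometrically, and finish when it is bounded. -/
theorem copsWin_of_doubling [Finite V] [Nonempty V] {k R₀ : ℕ}
    (hdiam : ∀ v w, G.edist v w ≤ R₀) (hkV : k ≤ Nat.card V)
    (hdoub : ∀ (v : V) (R : ℕ), 1 ≤ R → ∃ T : Finset V, T.card ≤ k ∧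
      ∀ w, G.edist v w ≤ (2 * R : ℕ) → ∃ c ∈ T, G.edist c w ≤ R)
    (hres : ∀ v : V, ∃ S : Finset V, S.card ≤ k ∧ ∀ u w, G.edist v u ≤ (3 : ℕ) →
      G.edist v w ≤ (3 : ℕ) → (∀ s ∈ S, G.edist s u = G.edist s w) → u = w) :
    CopsWin G k := by
  classical
  have := Fintype.ofFinite V
  rw [Nat.card_eq_fintype_card] at hkV
  -- The game demands exactly `k` sensors; superfluous ones do no harm.
  have ext : ∀ T : Finset V, T.card ≤ k → ∃ S : Finset V, T ⊆ S ∧ S.card = k := fun T hT => by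
    obtain ⟨S, hS, -, hc⟩ := Finset.exists_subsuperset_card_eq (Finset.subset_univ T) hT
      (by simpa using hkV)
    exact ⟨S, hS, hc⟩
  have hdoub' : ∀ (v : V) (R : ℕ), ∃ T : Finset V, T.card = k ∧ (1 ≤ R →
      ∀ w, G.edist v w ≤ (2 * R : ℕ) → ∃ c ∈ T, G.edist c w ≤ R) := by
    intro v R
    by_cases hR : 1 ≤ R
    · obtain ⟨T, hT, h⟩ := hdoub v R hR
      obtain ⟨S, hTS, hS⟩ := ext T hT
      exact ⟨S, hS, fun _ w hw => by obtain ⟨c, hc, h'⟩ := h w hw; exact ⟨c, hTS hc, h'⟩⟩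
    · obtain ⟨S, -, hS⟩ := ext ∅ (by simp)
      exact ⟨S, hS, fun h => absurd h hR⟩
  have hres' : ∀ v : V, ∃ S : Finset V, S.card = k ∧ ∀ u w, G.edist v u ≤ (3 : ℕ) →
      G.edist v w ≤ (3 : ℕ) → (∀ s ∈ S, G.edist s u = G.edist s w) → u = w := by
    intro v
    obtain ⟨T, hT, h⟩ := hres v
    obtain ⟨S, hTS, hS⟩ := ext T hT
    exact ⟨S, hS, fun u w hu hw hs => h u w hu hw fun s hs' => hs s (hTS hs')⟩
  choose T hTk hT using hdoub'
  choose S hSk hS using hres'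
  obtain ⟨v₀⟩ := ‹Nonempty V›
  -- A state is a centre and a radius around the robber. The new centre is a sensor reporting at
  -- most half the radius, rounded up, and `+ 1` pays for her move. The fallback `st.1` never occurs
  -- on a true history while the radius exceeds 3.
  let upd : V × ℕ → Set (V × ℕ∞) → V × ℕ := fun st sig =>
    (if h : ∃ c, ∃ d : ℕ∞, (c, d) ∈ sig ∧ d ≤ ((st.2 + 1) / 2 : ℕ) then h.choose else st.1,
      (st.2 + 1) / 2 + 1)
  let state : List (Set (V × ℕ∞)) → V × ℕ := fun l => l.foldr (fun sig st => upd st sig) (v₀, R₀)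
  let σ : CopStrategy V := fun l =>
    if (state l).2 ≤ 3 then S (state l).1 else T (state l).1 (((state l).2 + 1) / 2)
  have inv : ∀ (w : ℕ → V), IsTrajectory G w → ∀ t,
      (∀ s < t, 3 < (state (history G σ w s)).2) →
      G.edist (state (history G σ w t)).1 (w t) ≤ (state (history G σ w t)).2 := by
    intro w hw t
    induction t with
    | zero => intro _; exact hdiam _ _
    | succ t ih =>
      intro hs
      have h1 := ih fun s hst => hs s (by omega)
      have h2 := hs t (by omega)
      set st := state (history G σ w t) with hst
      have hσ : σ (history G σ w t) = T st.1 ((st.2 + 1) / 2) := by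
        simp only [σ, ← hst]; rw [if_neg (by omega)]
      have hstep : state (history G σ w (t + 1)) =
          upd st (signature G (T st.1 ((st.2 + 1) / 2)) (w t)) := by
        rw [← hσ]; rfl
      obtain ⟨c, hcT, hc⟩ := hT st.1 ((st.2 + 1) / 2) (by omega) (w t)
        (h1.trans (by exact_mod_cast (by omega : st.2 ≤ 2 * ((st.2 + 1) / 2))))
      have hex : ∃ c, ∃ d : ℕ∞, (c, d) ∈ signature G (T st.1 ((st.2 + 1) / 2)) (w t) ∧
          d ≤ ((st.2 + 1) / 2 : ℕ) := ⟨c, _, ⟨hcT, rfl⟩, hc⟩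
      have hc' : G.edist hex.choose (w t) ≤ ((st.2 + 1) / 2 : ℕ) := by
        obtain ⟨d, hd, hd'⟩ := hex.choose_spec
        rw [← hd.2]; exact hd'
      have hmove : G.edist (w t) (w (t + 1)) ≤ 1 := by
        rw [SimpleGraph.edist_le_one_iff_adj_or_eq]
        exact (hw t).elim (fun h => Or.inr h.symm) Or.inl
      rw [hstep]
      simp only [upd, dif_pos hex]
      push_cast at hc' ⊢
      exact (SimpleGraph.edist_triangle (v := w t)).trans (add_le_add hc' hmove)
  -- The map `R ↦ ⌈R/2⌉ + 1` decreases strictly while `R > 3` and fixes 3, which is why balls of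
  -- radius 3 have to be resolved at the end.
  have small : ∀ w : ℕ → V, ∃ t, (state (history G σ w t)).2 ≤ 3 := by
    intro w
    by_contra! hcon
    have hdec : ∀ t, (state (history G σ w t)).2 + t ≤ R₀ := by
      intro t
      induction t with
      | zero => simp [history, state]
      | succ t ih =>
        have h1 := hcon t
        have : (state (history G σ w (t + 1))).2 = ((state (history G σ w t)).2 + 1) / 2 + 1 := rfl
        omega
    have := hdec (R₀ + 1)
    omega
  refine ⟨σ, fun l => ?_, fun w hw => ?_⟩
  · simp only [σ]; split_ifs <;> simp [hSk, hTk]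
  -- In the first such round only covering sensors have been used so far, as `inv` requires. Any
  -- trajectory with the same history passes through the same states.
  · let t := Nat.find (small w)
    have ht : (state (history G σ w t)).2 ≤ 3 := Nat.find_spec (small w)
    have hmin : ∀ s < t, 3 < (state (history G σ w s)).2 := fun s hs => by
      have := Nat.find_min (small w) hs
      omega
    have hpre : ∀ w' : ℕ → V, ∀ s, history G σ w' t = history G σ w t → s ≤ t →
        history G σ w' s = history G σ w s := by
      intro w' s h hst
      obtain ⟨j, hj⟩ := Nat.exists_eq_add_of_le hst
      rw [hj] at h
      clear hj
      induction j with
      | zero => exact h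
      | succ j ih => exact ih (List.cons.inj h).2
    refine ⟨t, fun w' hw' hh => ?_⟩
    have hh' := List.cons.inj hh
    have ha := inv w hw t hmin
    have hb := inv w' hw' t fun s hs => by rw [hpre w' s hh'.2 hs.le]; exact hmin s hs
    rw [hh'.2] at hb
    have hσ : σ (history G σ w t) = S (state (history G σ w t)).1 := by
      simp only [σ]; rw [if_pos ht]
    refine hS (state (history G σ w t)).1 _ _ (hb.trans (by exact_mod_cast ht))
      (ha.trans (by exact_mod_cast ht)) ?_
    rw [← signature_eq_iff, ← hσ]
    have := hh'.1
    rwa [hh'.2] at this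

/-- Only `k ≤ |V|` distinct sensors can be placed; for larger `k` one sensor on every vertex gives
the bound. -/
theorem localizationNumber_le_of_doubling [Finite V] [Nonempty V] {k R₀ : ℕ} (hk : 1 ≤ k)
    (hdiam : ∀ v w, G.edist v w ≤ R₀)
    (hdoub : ∀ (v : V) (R : ℕ), 1 ≤ R → ∃ T : Finset V, T.card ≤ k ∧
      ∀ w, G.edist v w ≤ (2 * R : ℕ) → ∃ c ∈ T, G.edist c w ≤ R)
    (hres : ∀ v : V, ∃ S : Finset V, S.card ≤ k ∧ ∀ u w, G.edist v u ≤ (3 : ℕ) →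
      G.edist v w ≤ (3 : ℕ) → (∀ s ∈ S, G.edist s u = G.edist s w) → u = w) :
    localizationNumber G ≤ k := by
  by_cases hkV : k ≤ Nat.card V
  · exact Nat.sInf_le ⟨hk, copsWin_of_doubling hdiam hkV hdoub hres⟩
  · have := Fintype.ofFinite V
    rw [Nat.card_eq_fintype_card] at hkV
    exact (Nat.sInf_le (copsWin_card G)).trans (by omega)

end LocalizationGame

/-! ### Shortest walks and twins -/

namespace SimpleGraph

variable {V : Type*} {G : SimpleGraph V}

theorem exists_adj_of_edist_eq_succ {s v : V} {j : ℕ} (h : G.edist s v = (j + 1 : ℕ)) :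
    ∃ w, G.edist s w = j ∧ G.Adj w v := by
  obtain ⟨p, hp⟩ := exists_walk_of_edist_eq_coe h
  have hnil : ¬ p.Nil := fun hn => by
    have := SimpleGraph.Walk.length_eq_zero_iff.2 hn; omega
  have hadj := p.adj_penultimate hnil
  refine ⟨p.penultimate, le_antisymm ?_ ?_, hadj⟩
  · refine (edist_le p.dropLast).trans ?_
    simp [hp]
  · have h1 : G.edist p.penultimate v ≤ 1 := edist_le_one_iff_adj_or_eq.2 (Or.inl hadj)
    have h2 : G.edist s v ≤ G.edist s p.penultimate + G.edist p.penultimate v := G.edist_triangle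
    have h3 : ((j : ℕ∞) + 1) ≤ G.edist s p.penultimate + 1 := by
      rw [h] at h2
      push_cast at h2
      exact h2.trans (by gcongr)
    exact (ENat.add_le_add_iff_right (by simp)).1 h3

/-- The last edge of a shortest walk to `v` can be redirected to `u`. If the vertex before `v` is
`u` itself, the walk reaches `u` even earlier. -/
theorem edist_le_of_adj_imp {s u v : V} (hs : s ≠ v)
    (h : ∀ w, w ≠ u → G.Adj w v → G.Adj w u) : G.edist s u ≤ G.edist s v := by
  rcases eq_or_ne (G.edist s v) ⊤ with ht | ht
  · rw [ht]; exact le_top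
  obtain ⟨d, hd⟩ := ENat.ne_top_iff_exists.1 ht
  cases d with
  | zero => exact absurd (edist_eq_zero_iff.1 hd.symm) hs
  | succ j =>
    obtain ⟨w, hw, hadj⟩ := exists_adj_of_edist_eq_succ hd.symm
    rw [← hd]
    by_cases hwu : w = u
    · subst hwu; rw [hw]; exact_mod_cast Nat.le_succ j
    · have h1 : G.edist w u ≤ 1 := edist_le_one_iff_adj_or_eq.2 (Or.inl (h w hwu hadj))
      refine (SimpleGraph.edist_triangle (v := w)).trans ?_
      rw [hw]; push_cast; gcongr

/-- Twins are at the same distance from every other vertex. -/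
theorem edist_eq_of_twins {s u v : V} (hu : s ≠ u) (hv : s ≠ v)
    (h : ∀ w, w ≠ u → w ≠ v → (G.Adj w u ↔ G.Adj w v)) : G.edist s u = G.edist s v :=
  le_antisymm
    (edist_le_of_adj_imp hv fun w hw hadj => (h w hw hadj.ne).2 hadj)
    (edist_le_of_adj_imp hu fun w hw hadj => (h w hadj.ne hw).1 hadj)

end SimpleGraph

/-! ### The metric of the flat torus -/

namespace RandomGeometric

theorem norm_coe_le_abs (L t : ℝ) : ‖(t : AddCircle L)‖ ≤ |t| :=
  QuotientAddGroup.norm_mk_le_norm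

theorem norm_coe_eq_min {L t : ℝ} (ht : |t| ≤ L) : ‖(t : AddCircle L)‖ = min |t| (L - |t|) := by
  rcases eq_or_lt_of_le ((abs_nonneg t).trans ht) with h0 | hL
  · have : t = 0 := abs_nonpos_iff.1 (h0 ▸ ht)
    simp [this, ← h0]
  have key : ∀ s : ℝ, 0 ≤ s → s ≤ L → ‖(s : AddCircle L)‖ = min s (L - s) := by
    intro s h0 hs
    rcases le_total s (L / 2) with h | h
    · rw [(AddCircle.norm_coe_eq_abs_iff L hL.ne').2 (by rwa [abs_of_nonneg h0, abs_of_pos hL]),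
        abs_of_nonneg h0, min_eq_left (by linarith)]
    · have : (s : AddCircle L) = ((s - L : ℝ) : AddCircle L) := by
        rw [AddCircle.coe_sub, AddCircle.coe_period, sub_zero]
      rw [this, (AddCircle.norm_coe_eq_abs_iff L hL.ne').2
        (by rw [abs_of_nonpos (by linarith), abs_of_pos hL]; linarith),
        abs_of_nonpos (by linarith), min_eq_right (by linarith)]
      ring
  rcases le_total 0 t with h | h
  · rw [abs_of_nonneg h] at ht ⊢; exact key t h ht
  · rw [abs_of_nonpos h] at ht ⊢
    rw [← key (-t) (by linarith) ht, AddCircle.coe_neg, norm_neg]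

theorem abs_eq_norm_coe_of_lt {L r t : ℝ} (ht : |t| + r ≤ L) (h : ‖(t : AddCircle L)‖ < r) :
    ‖(t : AddCircle L)‖ = |t| := by
  have h0 := norm_nonneg (t : AddCircle L)
  have h2 := norm_coe_eq_min (L := L) (t := t) (by linarith)
  rcases min_choice |t| (L - |t|) with hm | hm
  · rw [h2, hm]
  · rw [h2, hm] at h; linarith

theorem exists_lift {L : ℝ} (hL : 0 < L) (t : ℝ) :
    ∃ a : ℝ, |a| ≤ L / 2 ∧ (a : AddCircle L) = t ∧ ‖(t : AddCircle L)‖ = |a| := by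
  have h := AddCircle.norm_eq (p := L) (x := t)
  have h2 := AddCircle.norm_le_half_period (p := L) (x := (t : AddCircle L)) hL.ne'
  refine ⟨t - round (L⁻¹ * t) * L, ?_, ?_, h⟩
  · rw [← h]; rwa [abs_of_pos hL] at h2
  · rw [AddCircle.coe_sub, sub_eq_self, ← zsmul_eq_mul, AddCircle.coe_zsmul,
      AddCircle.coe_period, smul_zero]

theorem torusDist_nonneg (L : ℝ) (x y : ℝ × ℝ) : 0 ≤ torusDist L x y := Real.sqrt_nonneg _

/-- As the norm of an `L²` product of two circles, the torus distance inherits the triangle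
inequality. -/
theorem torusDist_eq_norm (L : ℝ) (x y : ℝ × ℝ) : torusDist L x y =
    ‖WithLp.toLp 2 (((x.1 - y.1 : ℝ) : AddCircle L), ((x.2 - y.2 : ℝ) : AddCircle L))‖ := by
  rw [WithLp.prod_norm_eq_of_L2]; rfl

theorem torusDist_triangle (L : ℝ) (x y z : ℝ × ℝ) :
    torusDist L x z ≤ torusDist L x y + torusDist L y z := by
  simp only [torusDist_eq_norm]
  refine le_trans (le_of_eq ?_) (norm_add_le _ _)
  congr 1
  rw [← WithLp.toLp_add, Prod.mk_add_mk, ← AddCircle.coe_add, ← AddCircle.coe_add]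
  simp

theorem torusDist_self (L : ℝ) (x : ℝ × ℝ) : torusDist L x x = 0 := by simp [torusDist]

theorem norm_fst_le_torusDist (L : ℝ) (x y : ℝ × ℝ) :
    ‖((x.1 - y.1 : ℝ) : AddCircle L)‖ ≤ torusDist L x y :=
  Real.le_sqrt_of_sq_le (by nlinarith [sq_nonneg ‖((x.2 - y.2 : ℝ) : AddCircle L)‖])

theorem norm_snd_le_torusDist (L : ℝ) (x y : ℝ × ℝ) :
    ‖((x.2 - y.2 : ℝ) : AddCircle L)‖ ≤ torusDist L x y :=
  Real.le_sqrt_of_sq_le (by nlinarith [sq_nonneg ‖((x.1 - y.1 : ℝ) : AddCircle L)‖])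

theorem torusDist_le_of_abs_le {L s a b : ℝ} {x y : ℝ × ℝ} (h : a ^ 2 + b ^ 2 ≤ s ^ 2)
    (hs : 0 ≤ s) (ha : (a : AddCircle L) = ((x.1 - y.1 : ℝ) : AddCircle L))
    (hb : (b : AddCircle L) = ((x.2 - y.2 : ℝ) : AddCircle L)) : torusDist L x y ≤ s := by
  refine Real.sqrt_le_iff.2 ⟨hs, ?_⟩
  rw [← ha, ← hb]
  refine le_trans (add_le_add (pow_le_pow_left₀ (norm_nonneg _) (norm_coe_le_abs L a) 2)
    (pow_le_pow_left₀ (norm_nonneg _) (norm_coe_le_abs L b) 2)) ?_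
  simpa using h

theorem torusDist_le_of_sq {L s : ℝ} {x y : ℝ × ℝ}
    (h : (x.1 - y.1) ^ 2 + (x.2 - y.2) ^ 2 ≤ s ^ 2) (hs : 0 ≤ s) : torusDist L x y ≤ s :=
  torusDist_le_of_abs_le h hs rfl rfl

/-- Choosing the representative nearest to 0 in each coordinate turns a torus distance into the
length of a plane vector. -/
theorem exists_lift_torusDist {L : ℝ} (hL : 0 < L) (x y : ℝ × ℝ) :
    ∃ a b : ℝ, |a| ≤ L / 2 ∧ |b| ≤ L / 2 ∧
      (a : AddCircle L) = ((x.1 - y.1 : ℝ) : AddCircle L) ∧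
      (b : AddCircle L) = ((x.2 - y.2 : ℝ) : AddCircle L) ∧
      torusDist L x y ^ 2 = a ^ 2 + b ^ 2 ∧ |a| ≤ torusDist L x y ∧ |b| ≤ torusDist L x y := by
  obtain ⟨a, ha, ha', ha''⟩ := exists_lift hL (x.1 - y.1)
  obtain ⟨b, hb, hb', hb''⟩ := exists_lift hL (x.2 - y.2)
  refine ⟨a, b, ha, hb, ha', hb', ?_, ha'' ▸ norm_fst_le_torusDist L x y,
    hb'' ▸ norm_snd_le_torusDist L x y⟩
  unfold torusDist
  rw [Real.sq_sqrt (by positivity), ha'', hb'', sq_abs, sq_abs]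

/-- In the relevant range the torus distance is at most `r` only if the Euclidean one is. -/
theorem sq_le_of_torusDist_le {L r : ℝ} {x y : ℝ × ℝ} (h1 : |x.1 - y.1| + r < L)
    (h2 : |x.2 - y.2| + r < L) (h : torusDist L x y ≤ r) :
    (x.1 - y.1) ^ 2 + (x.2 - y.2) ^ 2 ≤ r ^ 2 := by
  have e1 := (norm_fst_le_torusDist L x y).trans h
  have e2 := (norm_snd_le_torusDist L x y).trans h
  have f1 := abs_eq_norm_coe_of_lt (r := L - |x.1 - y.1|) (by linarith) (e1.trans_lt (by linarith))
  have f2 := abs_eq_norm_coe_of_lt (r := L - |x.2 - y.2|) (by linarith) (e2.trans_lt (by linarith))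
  have := (Real.sqrt_le_iff.1 h).2
  rwa [f1, f2, sq_abs, sq_abs] at this

/-! ### Graph distance against torus distance -/

section Graph

variable {n : ℕ} {r : ℝ} {x : Fin n → ℝ × ℝ}

theorem edist_le_one_iff (hr : 0 ≤ r) (u v : Fin n) :
    (torusGraph r x).edist u v ≤ 1 ↔ torusDist (√n) (x u) (x v) ≤ r := by
  rw [SimpleGraph.edist_le_one_iff_adj_or_eq]
  constructor
  · rintro (h | rfl)
    · exact h.2
    · rwa [torusDist_self]
  · intro h
    by_cases huv : u = v
    · exact Or.inr huv
    · exact Or.inl ⟨huv, h⟩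

theorem torusDist_le_of_edist_le {u v : Fin n} {m : ℕ}
    (h : (torusGraph r x).edist u v ≤ m) : torusDist (√n) (x u) (x v) ≤ m * max r 0 := by
  obtain ⟨d, hd⟩ := ENat.ne_top_iff_exists.1 (ne_top_of_le_ne_top (ENat.natCast_ne_top m) h)
  obtain ⟨p, hp⟩ := SimpleGraph.exists_walk_of_edist_eq_coe hd.symm
  have key : ∀ {u v : Fin n} (p : (torusGraph r x).Walk u v),
      torusDist (√n) (x u) (x v) ≤ p.length * max r 0 := by
    intro u v p
    induction p with
    | nil => simp [torusDist_self]
    | cons hadj p ih =>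
      refine (torusDist_triangle _ _ (x _) _).trans ((add_le_add hadj.2 ih).trans ?_)
      rw [SimpleGraph.Walk.length_cons]; push_cast
      linarith [le_max_left r 0]
  refine (key p).trans ?_
  have : p.length ≤ m := by rw [hp]; rw [← hd] at h; exact_mod_cast h
  have : (p.length : ℝ) ≤ m := by exact_mod_cast this
  exact mul_le_mul_of_nonneg_right this (le_max_right _ _)

/-- The segment from `u` to `v` is cut into `R` steps of length at most `r/3`, and each division
point is rounded to a vertex within `r/3`; consecutive vertices are then within `r`. -/
theorem edist_le_of_torusDist_le (hn : 0 < n) (hr : 0 < r)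
    (hdense : ∀ p : ℝ × ℝ, ∃ w, torusDist (√n) p (x w) ≤ r / 3) {R : ℕ} (hR : 1 ≤ R)
    {u v : Fin n} (h : torusDist (√n) (x u) (x v) ≤ R * (r / 3)) :
    (torusGraph r x).edist u v ≤ R := by
  classical
  have hL : (0 : ℝ) < √n := Real.sqrt_pos.2 (by exact_mod_cast hn)
  have hR' : (0 : ℝ) < R := by exact_mod_cast hR
  obtain ⟨a, b, -, -, ha, hb, hab, -, -⟩ := exists_lift_torusDist hL (x v) (x u)
  rw [torusDist_comm] at hab
  let p : ℕ → ℝ × ℝ := fun i => ((x u).1 + i / R * a, (x u).2 + i / R * b)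
  choose q hq using fun i => hdense (p i)
  -- The endpoints are kept exact so that the walk joins `u` to `v`; `p R` agrees with `x v` only
  -- modulo the periods.
  let q' : ℕ → Fin n := fun i => if i = 0 then u else if i = R then v else q i
  have hq' : ∀ i, torusDist (√n) (p i) (x (q' i)) ≤ r / 3 := by
    intro i
    by_cases h0 : i = 0
    · simp only [q', h0, if_true, p]
      simp [torusDist]; positivity
    by_cases h1 : i = R
    · have : q' i = v := by simp only [q', h1, if_true]; rw [if_neg (by omega)]
      rw [this]
      refine torusDist_le_of_abs_le (a := 0) (b := 0) ?_ (by positivity) ?_ ?_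
      · simp only [ne_eq, OfNat.ofNat_ne_zero, not_false_eq_true, zero_pow, add_zero]; positivity
      · simp only [p, h1]
        rw [div_self hR'.ne', one_mul, add_sub_right_comm, AddCircle.coe_add, ha,
          ← AddCircle.coe_add]
        simp
      · simp only [p, h1]
        rw [div_self hR'.ne', one_mul, add_sub_right_comm, AddCircle.coe_add, hb,
          ← AddCircle.coe_add]
        simp
    · have : q' i = q i := by simp [q', h0, h1]
      rw [this]; exact hq i
  have hp : ∀ i, torusDist (√n) (p i) (p (i + 1)) ≤ r / 3 := by
    intro i
    refine torusDist_le_of_sq ?_ (by positivity)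
    have e1 : (p i).1 - (p (i + 1)).1 = - (a / R) := by simp only [p]; push_cast; field_simp; ring
    have e2 : (p i).2 - (p (i + 1)).2 = - (b / R) := by simp only [p]; push_cast; field_simp; ring
    rw [e1, e2, neg_sq, neg_sq, div_pow, div_pow, ← add_div, div_le_iff₀ (by positivity), ← hab,
      ← mul_pow, mul_comm]
    exact pow_le_pow_left₀ (torusDist_nonneg _ _ _) h 2
  have hstep : ∀ i, (torusGraph r x).edist (q' i) (q' (i + 1)) ≤ 1 := by
    intro i
    rw [edist_le_one_iff hr.le]
    have h1 := torusDist_triangle (√n) (x (q' i)) (p i) (x (q' (i + 1)))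
    have h2 := torusDist_triangle (√n) (p i) (p (i + 1)) (x (q' (i + 1)))
    have h3 := hq' i
    rw [torusDist_comm] at h3
    linarith [hp i, hq' (i + 1)]
  have hall : ∀ i : ℕ, (torusGraph r x).edist u (q' i) ≤ i := by
    intro i
    induction i with
    | zero => simp [q']
    | succ i ih =>
      push_cast
      exact (SimpleGraph.edist_triangle (v := q' i)).trans (add_le_add ih (hstep i))
  have := hall R
  rwa [show q' R = v by simp only [q', if_true]; rw [if_neg (by omega)]] at this

/-- Displacements from `v` are at most `2Rr` in each coordinate, so boxes of side `Rr/5` number `21²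
= 441`. Two points of one box are within `√2 Rr/5 < Rr/3`, so any vertex of the box can serve as its
centre. -/
theorem exists_cover_of_dense (hn : 0 < n) (hr : 0 < r)
    (hdense : ∀ p : ℝ × ℝ, ∃ w, torusDist (√n) p (x w) ≤ r / 3) (v : Fin n) {R : ℕ}
    (hR : 1 ≤ R) : ∃ T : Finset (Fin n), T.card ≤ 441 ∧
      ∀ w, (torusGraph r x).edist v w ≤ (2 * R : ℕ) → ∃ c ∈ T, (torusGraph r x).edist c w ≤ R := by
  classical
  have hL : (0 : ℝ) < √n := Real.sqrt_pos.2 (by exact_mod_cast hn)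
  have hR' : (0 : ℝ) < R := by exact_mod_cast hR
  choose a b _ _ ha hb _ ha' hb' using fun w => exists_lift_torusDist hL (x w) (x v)
  set σ : ℝ := R * r / 5 with hσ
  have hσ0 : 0 < σ := by positivity
  let key : Fin n → ℤ × ℤ := fun w => (⌊a w / σ⌋, ⌊b w / σ⌋)
  let box : Finset (ℤ × ℤ) := Finset.Icc (-10) 10 ×ˢ Finset.Icc (-10) 10
  let rep : ℤ × ℤ → Fin n := fun κ => if h : ∃ w, key w = κ then h.choose else v
  refine ⟨box.image rep, Finset.card_image_le.trans (by simp [box]), fun w hw => ?_⟩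
  have hd := torusDist_le_of_edist_le hw
  rw [torusDist_comm, max_eq_left hr.le] at hd
  push_cast at hd
  have hfl : ∀ t : ℝ, |t| ≤ 2 * R * r → ⌊t / σ⌋ ∈ Finset.Icc (-10 : ℤ) 10 := by
    intro t ht
    rw [abs_le] at ht
    rw [Finset.mem_Icc]
    constructor
    · rw [Int.le_floor, le_div_iff₀ hσ0, hσ]; push_cast; nlinarith
    · have : t / σ ≤ 10 := by rw [div_le_iff₀ hσ0, hσ]; nlinarith
      exact_mod_cast (Int.floor_le (t / σ)).trans this
  have hmem : key w ∈ box := Finset.mem_product.2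
    ⟨hfl _ ((ha' w).trans hd), hfl _ ((hb' w).trans hd)⟩
  refine ⟨rep (key w), Finset.mem_image_of_mem _ hmem, ?_⟩
  have hex : ∃ w', key w' = key w := ⟨w, rfl⟩
  have hrep : key (rep (key w)) = key w := by
    simp only [rep, dif_pos hex]; exact hex.choose_spec
  have hclose : ∀ s t : ℝ, ⌊s / σ⌋ = ⌊t / σ⌋ → |s - t| ≤ σ := by
    intro s t h
    have := Int.abs_sub_lt_one_of_floor_eq_floor h
    rw [← sub_div, abs_div, abs_of_pos hσ0, div_lt_one hσ0] at this
    exact this.le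
  have h1 := hclose _ _ (congrArg Prod.fst hrep)
  have h2 := hclose _ _ (congrArg Prod.snd hrep)
  refine edist_le_of_torusDist_le hn hr hdense hR
    (torusDist_le_of_abs_le (a := a (rep (key w)) - a w) (b := b (rep (key w)) - b w)
      ?_ (by positivity) ?_ ?_)
  · rw [← sq_abs (a _ - a w), ← sq_abs (b _ - b w)]
    have := pow_le_pow_left₀ (abs_nonneg _) h1 2
    have := pow_le_pow_left₀ (abs_nonneg _) h2 2
    have e1 : σ ^ 2 = (R * r) ^ 2 / 25 := by rw [hσ]; ring
    have e2 : (R * (r / 3)) ^ 2 = (R * r) ^ 2 / 9 := by ring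
    rw [e2]
    nlinarith [sq_nonneg (R * r)]
  · rw [AddCircle.coe_sub, ha, ha, ← AddCircle.coe_sub]; simp
  · rw [AddCircle.coe_sub, hb, hb, ← AddCircle.coe_sub]; simp

theorem edist_le_natCast_of_dense (hn : 0 < n) (hr : 0 < r)
    (hdense : ∀ p : ℝ × ℝ, ∃ w, torusDist (√n) p (x w) ≤ r / 3) :
    ∃ R₀ : ℕ, ∀ u v, (torusGraph r x).edist u v ≤ R₀ := by
  have hL : (0 : ℝ) < √n := Real.sqrt_pos.2 (by exact_mod_cast hn)
  obtain ⟨N, hN⟩ := exists_nat_ge (√n / (r / 3))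
  refine ⟨N + 1, fun u v => edist_le_of_torusDist_le hn hr hdense (by omega) ?_⟩
  obtain ⟨a, b, h1, h2, -, -, hab, -, -⟩ := exists_lift_torusDist hL (x u) (x v)
  have : torusDist (√n) (x u) (x v) ≤ √n := by
    refine abs_le_of_sq_le_sq' ?_ hL.le |>.2
    rw [hab, ← sq_abs a, ← sq_abs b]
    nlinarith [abs_nonneg a, abs_nonneg b]
  rw [div_le_iff₀ (by positivity)] at hN
  push_cast
  nlinarith

/-- The localization number is at most the number of vertices needed to resolve a set of
diameter `6 * r`. -/
theorem localizationNumber_le_of_dense (hn : 0 < n) (hr : 0 < r)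
    (hdense : ∀ p : ℝ × ℝ, ∃ w, torusDist (√n) p (x w) ≤ r / 3) {k : ℕ} (hk : 441 ≤ k)
    (hres : ∀ v : Fin n, ∃ S : Finset (Fin n), S.card ≤ k ∧ ∀ u w,
      torusDist (√n) (x v) (x u) ≤ 3 * r → torusDist (√n) (x v) (x w) ≤ 3 * r →
      (∀ s ∈ S, (torusGraph r x).edist s u = (torusGraph r x).edist s w) → u = w) :
    LocalizationGame.localizationNumber (torusGraph r x) ≤ k := by
  have : Nonempty (Fin n) := ⟨⟨0, hn⟩⟩
  obtain ⟨R₀, hR₀⟩ := edist_le_natCast_of_dense hn hr hdense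
  refine LocalizationGame.localizationNumber_le_of_doubling (by omega) hR₀ (fun v R hR => ?_)
    fun v => ?_
  · obtain ⟨T, hT, h⟩ := exists_cover_of_dense hn hr hdense v hR
    exact ⟨T, hT.trans hk, h⟩
  · obtain ⟨S, hS, h⟩ := hres v
    refine ⟨S, hS, fun u w hu hw => h u w ?_ ?_⟩
    · simpa [max_eq_left hr.le] using torusDist_le_of_edist_le hu
    · simpa [max_eq_left hr.le] using torusDist_le_of_edist_le hw

end Graph

end RandomGeometric

/-! ### Independent points: tail bounds, conditioning, second moments -/

namespace IIDPoints

open Finset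

variable {Ω ι : Type*} [MeasurableSpace Ω] [Fintype ι] (μ : Measure Ω) [IsProbabilityMeasure μ]

theorem lintegral_prod_eval {f : Ω → ENNReal} (hf : Measurable f) :
    ∫⁻ x, ∏ i : ι, f (x i) ∂(Measure.pi fun _ : ι => μ) = (∫⁻ y, f y ∂μ) ^ Fintype.card ι := by
  have h := lintegral_prod_eq_prod_lintegral_of_indepFun (μ := Measure.pi fun _ : ι => μ) univ
    (fun i x => f (x i)) (iIndepFun_pi (X := fun _ => f) fun _ => hf.aemeasurable)
    fun i => hf.comp (measurable_pi_apply i)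
  rw [h]
  have : ∀ i : ι, ∫⁻ x, f (x i) ∂(Measure.pi fun _ : ι => μ) = ∫⁻ y, f y ∂μ := fun i =>
    (measurePreserving_eval (fun _ : ι => μ) i).lintegral_comp hf
  simp [this]

/-- Markov's inequality for the exponential moment of the count. The sign of `a` is free, so both
tails follow: `a = 1` uses `e - 1 ≤ 2`, and `a = -1` uses `1 - 1/e ≥ 1/2`. -/
theorem measure_le_of_exp_le {s : Set (ι → Ω)} {D : Set Ω} (hD : MeasurableSet D) (a t : ℝ)
    (hs : ∀ x ∈ s, t ≤ a * (Nat.card {i // x i ∈ D} : ℝ)) :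
    Measure.pi (fun _ : ι => μ) s ≤
      ENNReal.ofReal (Real.exp (Fintype.card ι * ((Real.exp a - 1) * μ.real D) - t)) := by
  classical
  let f : Ω → ENNReal := fun y => ENNReal.ofReal (Real.exp (a * D.indicator 1 y))
  have hf : Measurable f := by
    refine ENNReal.measurable_ofReal.comp (Real.measurable_exp.comp ?_)
    exact (measurable_one.indicator hD).const_mul a
  have hmeans : ∫⁻ y, f y ∂μ ≤ ENNReal.ofReal (Real.exp ((Real.exp a - 1) * μ.real D)) := by
    have h1 : ∀ y, Real.exp (a * D.indicator 1 y) = 1 + (Real.exp a - 1) * D.indicator 1 y := by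
      intro y
      by_cases h : y ∈ D <;> simp [h]
    have hi0 : Integrable (fun y => (Real.exp a - 1) * D.indicator (1 : Ω → ℝ) y) μ :=
      ((integrable_const (1 : ℝ)).indicator hD).const_mul _
    have hi : Integrable (fun y => 1 + (Real.exp a - 1) * D.indicator (1 : Ω → ℝ) y) μ :=
      (integrable_const _).add hi0
    rw [← ofReal_integral_eq_lintegral_ofReal]
    · refine ENNReal.ofReal_le_ofReal ?_
      simp_rw [h1]
      rw [integral_add (integrable_const _) hi0, integral_const_mul,
        integral_indicator_one hD]
      simp only [integral_const, probReal_univ, smul_eq_mul, mul_one]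
      linarith [Real.add_one_le_exp ((Real.exp a - 1) * μ.real D)]
    · simpa only [h1] using hi
    · exact Eventually.of_forall fun y => (Real.exp_pos _).le
  have hprod : ∀ x : ι → Ω, ∏ i, f (x i) =
      ENNReal.ofReal (Real.exp (a * (Nat.card {i // x i ∈ D} : ℝ))) := by
    intro x
    rw [← ENNReal.ofReal_prod_of_nonneg fun i _ => (Real.exp_pos _).le, ← Real.exp_sum,
      ← mul_sum]
    congr 3
    rw [Nat.card_eq_fintype_card, Fintype.card_subtype, card_filter]
    push_cast
    exact sum_congr rfl fun i _ => by by_cases h : x i ∈ D <;> simp [h]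
  have hmeas : Measurable fun x : ι → Ω => ∏ i, f (x i) :=
    Finset.measurable_fun_prod _ fun i _ => hf.comp (measurable_pi_apply i)
  have hmarkov := meas_ge_le_lintegral_div (μ := Measure.pi fun _ : ι => μ) hmeas.aemeasurable
    (ε := ENNReal.ofReal (Real.exp t)) (by simp [Real.exp_pos]) ENNReal.ofReal_ne_top
  refine (measure_mono fun x hx => ?_).trans (hmarkov.trans ?_)
  · simp only [Set.mem_ofPred_eq, hprod]
    exact ENNReal.ofReal_le_ofReal (Real.exp_le_exp.2 (hs x hx))
  · rw [lintegral_prod_eval μ hf, sub_eq_add_neg, Real.exp_add, Real.exp_nat_mul,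
      ENNReal.ofReal_mul (by positivity), Real.exp_neg, ENNReal.ofReal_inv_of_pos (Real.exp_pos _),
      ENNReal.ofReal_pow (Real.exp_pos _).le, div_eq_mul_inv]
    gcongr

theorem measure_card_ge_le {D : Set Ω} (hD : MeasurableSet D) (t : ℝ) {p : ℝ}
    (hp : μ.real D ≤ p) :
    Measure.pi (fun _ : ι => μ) {x | t ≤ (Nat.card {i // x i ∈ D} : ℝ)} ≤
      ENNReal.ofReal (Real.exp (2 * Fintype.card ι * p - t)) := by
  refine (measure_le_of_exp_le μ hD 1 t fun x hx => by rwa [one_mul]).trans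
    (ENNReal.ofReal_le_ofReal (Real.exp_le_exp.2 ?_))
  have h1 : (Real.exp 1 - 1) * μ.real D ≤ 2 * p := by
    have := Real.exp_one_lt_d9
    nlinarith [measureReal_nonneg (μ := μ) (s := D)]
  nlinarith [(Nat.cast_nonneg (Fintype.card ι) : (0 : ℝ) ≤ _)]

theorem measure_card_le_le {D : Set Ω} (hD : MeasurableSet D) (t : ℝ) {p : ℝ}
    (hp : p ≤ μ.real D) :
    Measure.pi (fun _ : ι => μ) {x | (Nat.card {i // x i ∈ D} : ℝ) ≤ t} ≤
      ENNReal.ofReal (Real.exp (t - Fintype.card ι * p / 2)) := by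
  refine (measure_le_of_exp_le μ hD (-1) (-t) fun x hx => ?_).trans
    (ENNReal.ofReal_le_ofReal (Real.exp_le_exp.2 ?_))
  · have : (Nat.card {i // x i ∈ D} : ℝ) ≤ t := hx
    linarith
  have h1 : (Real.exp (-1) - 1) * μ.real D ≤ - p / 2 := by
    have := Real.exp_neg_one_lt_d9
    nlinarith [measureReal_nonneg (μ := μ) (s := D)]
  nlinarith [(Nat.cast_nonneg (Fintype.card ι) : (0 : ℝ) ≤ _)]

/-- A set is small if all its sections in the coordinates satisfying `p` are. -/
theorem measure_pi_le_of_section (p : ι → Prop) [DecidablePred p] {E : Set (ι → Ω)}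
    (hE : MeasurableSet E) {c : ENNReal}
    (h : ∀ y : {i // ¬ p i} → Ω, Measure.pi (fun _ : {i // p i} => μ)
      {z | (fun i => if hi : p i then z ⟨i, hi⟩ else y ⟨i, hi⟩) ∈ E} ≤ c) :
    Measure.pi (fun _ : ι => μ) E ≤ c := by
  have e := measurePreserving_piEquivPiSubtypeProd (fun _ : ι => μ) p
  have e' := e.symm
  rw [← e'.measure_preimage hE.nullMeasurableSet,
    Measure.prod_apply_symm (e'.measurable hE)]
  calc _ ≤ ∫⁻ y, c ∂(Measure.pi fun _ : {i // ¬ p i} => μ) := lintegral_mono fun y => h y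
    _ = c := by simp

/-- If each factor depends only on the coordinates up to its index and has conditional
expectation at most `C`, then the expectation of the product is at most `C ^ n`. -/
theorem lintegral_prod_le_pow {n : ℕ} {f : Fin n → (Fin n → Ω) → ENNReal} {C : ENNReal}
    (hf : ∀ v, Measurable (f v))
    (hdep : ∀ v w, v < w → ∀ x y, f v (Function.update x w y) = f v x)
    (hmeans : ∀ v x, ∫⁻ y, f v (Function.update x v y) ∂μ ≤ C) :
    ∫⁻ x, ∏ v, f v x ∂(Measure.pi fun _ : Fin n => μ) ≤ C ^ n := by
  -- Coordinates are integrated out from the last one down: of the factors present, only the one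
  -- with index `m` depends on coordinate `m`.
  have key : ∀ m ≤ n, ∫⁻ x, ∏ v with v.val < m, f v x ∂(Measure.pi fun _ : Fin n => μ) ≤ C ^ m := by
    intro m
    induction m with
    | zero => intro _; simp
    | succ m ih =>
      intro hm
      let w : Fin n := ⟨m, hm⟩
      have hsplit : ∀ x, ∏ v with v.val < m + 1, f v x = (∏ v with v.val < m, f v x) * f w x := by
        intro x
        have : univ.filter (fun v : Fin n => v.val < m + 1) =
            insert w (univ.filter fun v : Fin n => v.val < m) := by
          ext v; simp [w, Fin.ext_iff]; omega
        rw [this, prod_insert (by simp [w]), mul_comm]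
      have hF : Measurable fun x => ∏ v with v.val < m, f v x :=
        Finset.measurable_fun_prod _ fun v _ => hf v
      have hupd : ∀ x y, ∏ v with v.val < m, f v (Function.update x w y) =
          ∏ v with v.val < m, f v x := fun x y =>
        prod_congr rfl fun v hv => hdep v w (by simpa [w, Fin.lt_def] using hv) x y
      simp_rw [hsplit]
      calc ∫⁻ x, (∏ v with v.val < m, f v x) * f w x ∂(Measure.pi fun _ : Fin n => μ)
          ≤ ∫⁻ x, (∏ v with v.val < m, f v x) * C ∂(Measure.pi fun _ : Fin n => μ) := by
            refine lintegral_le_of_lmarginal_le (μ := fun _ : Fin n => μ) {w}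
              (hF.mul (hf w)) (hF.mul_const C) ?_
            rw [lmarginal_singleton, lmarginal_singleton]
            intro x
            simp only [hupd]
            rw [lintegral_const_mul (f := fun y => f w (Function.update x w y)) _
              ((hf w).comp (measurable_update x)), lintegral_const,
              measure_univ, mul_one]
            gcongr
            exact hmeans w x
        _ ≤ C ^ (m + 1) := by
            rw [lintegral_mul_const _ hF, pow_succ]
            gcongr
            exact ih (by omega)
  have := key n le_rfl
  simpa using this

/-- Second moment method for events of equal probability that are almost independent. -/
theorem measureReal_card_lt_le {Ω' γ : Type*} [MeasurableSpace Ω'] (P : Measure Ω')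
    [IsProbabilityMeasure P] [DecidableEq γ] (A : Finset γ) (E : γ → Set Ω')
    (hE : ∀ c, MeasurableSet (E c))
    {q ρ : ℝ} (hq : 0 < q) (hρ : 1 ≤ ρ) (hA : A.Nonempty) (h1 : ∀ c ∈ A, P.real (E c) = q)
    (h2 : ∀ c ∈ A, ∀ c' ∈ A, c ≠ c' → P.real (E c ∩ E c') ≤ q ^ 2 * ρ) :
    P.real {x | (Nat.card {c // c ∈ A ∧ x ∈ E c} : ℝ) ≤ A.card * q / 2} ≤
      4 * (1 / (A.card * q) + (ρ - 1)) := by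
  classical
  set N : ℝ := (A.card : ℝ) with hN
  have hN0 : 0 < N := by rw [hN]; exact_mod_cast hA.card_pos
  let Z : Ω' → ℝ := fun x => ∑ c ∈ A, (E c).indicator 1 x
  have hZ : ∀ x, (Nat.card {c // c ∈ A ∧ x ∈ E c} : ℝ) = Z x := by
    intro x
    have : Nat.card {c // c ∈ A ∧ x ∈ E c} = (A.filter fun c => x ∈ E c).card :=
      Nat.subtype_card _ fun c => by simp
    rw [this, card_filter]
    push_cast
    exact sum_congr rfl fun c _ => by by_cases h : x ∈ E c <;> simp [h]
  have hmeans : ∀ c, Integrable ((E c).indicator (1 : Ω' → ℝ)) P := fun c =>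
    (integrable_const (1 : ℝ)).indicator (hE c)
  have hmul : ∀ c c' x, (E c).indicator (1 : Ω' → ℝ) x * (E c').indicator 1 x =
      (E c ∩ E c').indicator 1 x := by
    intro c c' x
    by_cases h : x ∈ E c <;> by_cases h' : x ∈ E c' <;> simp [h, h']
  have hmeans2 : ∀ c c', Integrable ((E c ∩ E c').indicator (1 : Ω' → ℝ)) P := fun c c' =>
    (integrable_const (1 : ℝ)).indicator ((hE c).inter (hE c'))
  have hZi : Integrable Z P := integrable_finsetSum _ fun c _ => hmeans c
  have hZm : ∫ x, Z x ∂P = N * q := by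
    rw [integral_finsetSum _ fun c _ => hmeans c]
    rw [sum_congr rfl fun c hc => (integral_indicator_one (hE c)).trans (h1 c hc)]
    simp [hN]
  have hZsq : ∀ x, Z x ^ 2 = ∑ c ∈ A, ∑ c' ∈ A, (E c ∩ E c').indicator 1 x := by
    intro x
    simp only [Z]
    rw [sq, sum_mul_sum]
    exact sum_congr rfl fun c _ => sum_congr rfl fun c' _ => hmul c c' x
  have hZ2i : Integrable (fun x => Z x ^ 2) P := by
    simp_rw [hZsq]
    exact integrable_finsetSum _ fun c _ => integrable_finsetSum _ fun c' _ => hmeans2 c c'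
  have hZ2 : ∫ x, Z x ^ 2 ∂P ≤ N * q + N ^ 2 * (q ^ 2 * ρ) := by
    simp_rw [hZsq]
    rw [integral_finsetSum _ fun c _ => integrable_finsetSum _ fun c' _ => hmeans2 c c']
    have : ∀ c ∈ A, ∫ x, ∑ c' ∈ A, (E c ∩ E c').indicator (1 : Ω' → ℝ) x ∂P ≤
        q + N * (q ^ 2 * ρ) := by
      intro c hc
      rw [integral_finsetSum _ fun c' _ => hmeans2 c c', ← add_sum_erase _ _ hc]
      refine add_le_add ?_ ?_
      · rw [integral_indicator_one ((hE c).inter (hE c)), Set.inter_self, h1 c hc]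
      · calc _ ≤ ∑ c' ∈ A.erase c, q ^ 2 * ρ := by
              refine sum_le_sum fun c' hc' => ?_
              rw [integral_indicator_one ((hE c).inter (hE c'))]
              exact h2 c hc c' (mem_of_mem_erase hc') (ne_of_mem_erase hc').symm
          _ ≤ N * (q ^ 2 * ρ) := by
              rw [sum_const, nsmul_eq_mul, hN]
              have : ((A.erase c).card : ℝ) ≤ A.card := by
                exact_mod_cast card_le_card (erase_subset _ _)
              gcongr
    refine (sum_le_sum this).trans ?_
    rw [sum_const, nsmul_eq_mul, ← hN]
    linarith
  -- The diagonal contributes `N q` to the variance, and every other pair exceeds `q²` by at most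
  -- `q² (ρ - 1)`. Chebyshev's inequality at deviation `N q / 2` then concludes.
  have hvar : ∫ x, (Z x - N * q) ^ 2 ∂P ≤ N * q + N ^ 2 * q ^ 2 * (ρ - 1) := by
    have : ∀ x, (Z x - N * q) ^ 2 = Z x ^ 2 - 2 * (N * q) * Z x + (N * q) ^ 2 := fun x => by ring
    simp_rw [this]
    have hsub : Integrable (fun x => Z x ^ 2 - 2 * (N * q) * Z x) P := hZ2i.sub (hZi.const_mul _)
    rw [integral_add hsub (integrable_const _), integral_sub hZ2i (hZi.const_mul _),
      integral_const_mul, hZm]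
    simp only [integral_const, probReal_univ, smul_eq_mul, one_mul]
    linarith
  have hvi : Integrable (fun x => (Z x - N * q) ^ 2) P := by
    have : ∀ x, (Z x - N * q) ^ 2 = Z x ^ 2 - 2 * (N * q) * Z x + (N * q) ^ 2 := fun x => by ring
    simp_rw [this]
    exact (hZ2i.sub (hZi.const_mul _)).add (integrable_const _)
  have hmk := mul_meas_ge_le_integral_of_nonneg (μ := P)
    (Eventually.of_forall fun x => sq_nonneg (Z x - N * q)) hvi ((N * q / 2) ^ 2)
  have hsub : P.real {x | (Nat.card {c // c ∈ A ∧ x ∈ E c} : ℝ) ≤ N * q / 2} ≤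
      P.real {x | (N * q / 2) ^ 2 ≤ (Z x - N * q) ^ 2} := by
    refine measureReal_mono fun x hx => ?_
    simp only [Set.mem_ofPred_eq, hZ] at hx ⊢
    nlinarith [mul_pos hN0 hq]
  refine hsub.trans ?_
  have hpos : 0 < (N * q / 2) ^ 2 := by positivity
  rw [← mul_le_mul_iff_right₀ hpos]
  refine (hmk.trans hvar).trans (le_of_eq ?_)
  field_simp
  ring

end IIDPoints

/-! ### Probability of isolated clusters -/

namespace IIDPoints

open Finset

variable {Ω ι : Type*} [Fintype ι]

/-- Exactly `m` points lie in `D`, and all points of `B` lie in `D`. -/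
def isolatedCluster (ι : Type*) (D B : Set Ω) (m : ℕ) : Set (ι → Ω) :=
  {x | Nat.card {i // x i ∈ D} = m ∧ ∀ i, x i ∈ B → x i ∈ D}

open Classical in
-- Splitting by the set `I` of indices landing in `D` writes the event as a union of product boxes.
-- The boxes are disjoint because the configuration determines `I`.
theorem isolatedCluster_eq {D B : Set Ω} (hDB : D ⊆ B) (m : ℕ) :
    isolatedCluster ι D B m = ⋃ I ∈ (univ : Finset ι).powersetCard m,
      Set.pi Set.univ fun i => if i ∈ I then D else Bᶜ := by
  ext x
  simp only [isolatedCluster, Set.mem_ofPred_eq, Set.mem_iUnion, mem_powersetCard_univ, exists_prop,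
    Set.mem_univ_pi]
  constructor
  · rintro ⟨h1, h2⟩
    refine ⟨univ.filter fun i => x i ∈ D, ?_, fun i => ?_⟩
    · rw [← h1]; exact (Nat.subtype_card _ fun i => by simp).symm
    · by_cases h : x i ∈ D
      · simp [h]
      · simpa [h] using fun hB => h (h2 i hB)
  · rintro ⟨I, hI, hx⟩
    have hiff : ∀ i, i ∈ I ↔ x i ∈ D := by
      intro i
      have := hx i
      by_cases h : i ∈ I
      · simpa [h] using this
      · rw [if_neg h] at this
        exact ⟨fun h' => absurd h' h, fun hD => absurd (hDB hD) this⟩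
    refine ⟨?_, fun i hB => ?_⟩
    · rw [← hI]; exact Nat.subtype_card _ hiff
    · by_contra hD
      have := hx i
      rw [if_neg fun h => hD ((hiff i).1 h)] at this
      exact this hB

variable [MeasurableSpace Ω]

theorem measurableSet_isolatedCluster {D B : Set Ω} (hD : MeasurableSet D) (hB : MeasurableSet B)
    (hDB : D ⊆ B) (m : ℕ) : MeasurableSet (isolatedCluster ι D B m) := by
  classical
  rw [isolatedCluster_eq hDB]
  refine Finset.measurableSet_biUnion _ fun I _ => MeasurableSet.univ_pi fun i => ?_
  split_ifs
  exacts [hD, hB.compl]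

variable (μ : Measure Ω) [IsProbabilityMeasure μ]

theorem measureReal_isolatedCluster {D B : Set Ω} (hD : MeasurableSet D) (hB : MeasurableSet B)
    (hDB : D ⊆ B) (m : ℕ) :
    (Measure.pi fun _ : ι => μ).real (isolatedCluster ι D B m) =
      (Fintype.card ι).choose m * (μ.real D ^ m * (1 - μ.real B) ^ (Fintype.card ι - m)) := by
  classical
  rw [isolatedCluster_eq hDB, measureReal_biUnion_finset]
  · have : ∀ I ∈ (univ : Finset ι).powersetCard m,
        (Measure.pi fun _ : ι => μ).real (Set.pi Set.univ fun i => if i ∈ I then D else Bᶜ) =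
        μ.real D ^ m * (1 - μ.real B) ^ (Fintype.card ι - m) := by
      intro I hI
      rw [mem_powersetCard_univ] at hI
      rw [measureReal_def, Measure.pi_pi, ENNReal.toReal_prod]
      have : ∀ i, (μ (if i ∈ I then D else Bᶜ)).toReal =
          if i ∈ I then μ.real D else 1 - μ.real B := by
        intro i
        split_ifs
        · rfl
        · exact probReal_compl_eq_one_sub hB
      simp_rw [this]
      rw [prod_ite]
      simp only [prod_const]
      congr 2
      · simp [hI]
      · have : univ.filter (fun i => i ∉ I) = Iᶜ := by ext; simp
        rw [this, card_compl, hI]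
    rw [sum_congr rfl this, sum_const, card_powersetCard, card_univ, nsmul_eq_mul]
  · intro I _ J _ hIJ
    rw [Function.onFun, Set.disjoint_left]
    intro x hx hy
    apply hIJ
    rw [Set.mem_univ_pi] at hx hy
    have : ∀ I : Finset ι, (∀ i, x i ∈ if i ∈ I then D else Bᶜ) → ∀ i, i ∈ I ↔ x i ∈ D := by
      intro I hx i
      have := hx i
      by_cases h : i ∈ I
      · simpa [h] using this
      · rw [if_neg h] at this
        exact ⟨fun h' => absurd h' h, fun hD => absurd (hDB hD) this⟩
    ext i
    rw [this I hx, this J hy]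
  · intro I _
    refine MeasurableSet.univ_pi fun i => ?_
    split_ifs
    exacts [hD, hB.compl]

/-- Disjoint zones force disjoint index sets, and all other points avoid both zones. Since `1 - 2z ≤
(1 - z)²`, the joint probability is a product of the two, except that the exponent is `n - 2m`
instead of `n - m`; this costs the factor `(1 - z)^(-2m)`. -/
theorem measureReal_isolatedCluster_inter_le {D B D' B' : Set Ω} (hD : MeasurableSet D)
    (hB : MeasurableSet B) (hB' : MeasurableSet B') (hDB : D ⊆ B)
    (hDB' : D' ⊆ B') (hdisj : Disjoint B B') (hDD : μ.real D' = μ.real D)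
    (hBB : μ.real B' = μ.real B) (hz : μ.real B < 1) {m : ℕ} (hm : 2 * m ≤ Fintype.card ι) :
    (Measure.pi fun _ : ι => μ).real (isolatedCluster ι D B m ∩ isolatedCluster ι D' B' m) ≤
      (Measure.pi fun _ : ι => μ).real (isolatedCluster ι D B m) ^ 2 *
        ((1 - μ.real B) ^ (2 * m))⁻¹ := by
  classical
  set n := Fintype.card ι
  set z := μ.real B
  have h2z : μ.real (B ∪ B') = 2 * z := by
    rw [measureReal_union hdisj hB', hBB]; ring
  have h2z1 : 0 ≤ 1 - 2 * z := by
    rw [← h2z]; linarith [measureReal_le_one (μ := μ) (s := B ∪ B')]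
  have hsub : isolatedCluster ι D B m ∩ isolatedCluster ι D' B' m ⊆
      ⋃ p ∈ ((univ : Finset ι).powersetCard m ×ˢ (univ : Finset ι).powersetCard m).filter
        (fun p => Disjoint p.1 p.2),
      Set.pi Set.univ fun i => if i ∈ p.1 then D else if i ∈ p.2 then D' else (B ∪ B')ᶜ := by
    rw [isolatedCluster_eq hDB, isolatedCluster_eq hDB']
    rintro x ⟨hx, hy⟩
    simp only [Set.mem_iUnion, exists_prop, Set.mem_univ_pi] at hx hy
    obtain ⟨I, hI, hx⟩ := hx
    obtain ⟨J, hJ, hy⟩ := hy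
    have hd : Disjoint I J := by
      rw [Finset.disjoint_left]
      intro i hi hj
      have h1 := hx i
      have h2 := hy i
      rw [if_pos hi] at h1
      rw [if_pos hj] at h2
      exact Set.disjoint_left.1 hdisj (hDB h1) (hDB' h2)
    simp only [Set.mem_iUnion, exists_prop, Set.mem_univ_pi]
    refine ⟨(I, J), by simp [mem_filter, mem_product, hd, mem_powersetCard_univ.1 hI,
      mem_powersetCard_univ.1 hJ], fun i => ?_⟩
    have h1 := hx i
    have h2 := hy i
    by_cases hi : i ∈ I
    · simpa [hi] using h1
    · by_cases hj : i ∈ J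
      · simpa [hi, hj] using h2
      · simp only [hi, hj, if_false] at h1 h2 ⊢
        exact fun h => h.elim h1 h2
  refine (measureReal_mono hsub (measure_ne_top _ _)).trans
    ((measureReal_biUnion_finset_le _ _).trans ?_)
  have hbox : ∀ p ∈ ((univ : Finset ι).powersetCard m ×ˢ (univ : Finset ι).powersetCard m).filter
        (fun p => Disjoint p.1 p.2),
      (Measure.pi fun _ : ι => μ).real
        (Set.pi Set.univ fun i => if i ∈ p.1 then D else if i ∈ p.2 then D' else (B ∪ B')ᶜ) =
      μ.real D ^ (2 * m) * (1 - 2 * z) ^ (n - 2 * m) := by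
    rintro ⟨I, J⟩ hp
    simp only [mem_filter, mem_product, mem_powersetCard_univ] at hp
    obtain ⟨⟨hI, hJ⟩, hd⟩ := hp
    rw [measureReal_def, Measure.pi_pi, ENNReal.toReal_prod]
    have : ∀ i, (μ (if i ∈ I then D else if i ∈ J then D' else (B ∪ B')ᶜ)).toReal =
        if i ∈ I ∪ J then μ.real D else 1 - 2 * z := by
      intro i
      by_cases hi : i ∈ I
      · simp [hi, measureReal_def]
      · by_cases hj : i ∈ J
        · simp [hi, hj, ← hDD, measureReal_def]
        · simp only [hi, hj, if_false, mem_union, or_self, ← h2z]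
          exact probReal_compl_eq_one_sub (hB.union hB')
    simp_rw [this]
    rw [prod_ite]
    simp only [prod_const]
    have hc : #(I ∪ J) = 2 * m := by rw [card_union_of_disjoint hd, hI, hJ]; ring
    congr 2
    · rw [← hc]; congr 1; ext; simp
    · have : univ.filter (fun i => i ∉ I ∪ J) = (I ∪ J)ᶜ := by ext; simp
      rw [this, card_compl, hc]
  rw [sum_congr rfl hbox, sum_const, nsmul_eq_mul, measureReal_isolatedCluster μ hD hB hDB]
  have hcard : (#(((univ : Finset ι).powersetCard m ×ˢ (univ : Finset ι).powersetCard m).filter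
        (fun p => Disjoint p.1 p.2)) : ℝ) ≤ (n.choose m : ℝ) ^ 2 := by
    have := card_filter_le ((univ : Finset ι).powersetCard m ×ˢ (univ : Finset ι).powersetCard m)
        (fun p => Disjoint p.1 p.2)
    rw [card_product, card_powersetCard, card_univ, ← sq] at this
    exact_mod_cast this
  have hz1 : 0 < 1 - z := by linarith
  have hpow : (1 - 2 * z) ^ (n - 2 * m) ≤ ((1 - z) ^ 2) ^ (n - 2 * m) :=
    pow_le_pow_left₀ h2z1 (by nlinarith [sq_nonneg z]) _
  have he : (((1 - z) ^ (n - m)) ^ 2) * ((1 - z) ^ (2 * m))⁻¹ = ((1 - z) ^ 2) ^ (n - 2 * m) := by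
    rw [← div_eq_mul_inv, div_eq_iff (by positivity), ← pow_mul, ← pow_mul, ← pow_add]
    congr 1
    omega
  calc _ ≤ (n.choose m : ℝ) ^ 2 * (μ.real D ^ (2 * m) * ((1 - z) ^ 2) ^ (n - 2 * m)) := by
        gcongr
    _ = _ := by rw [← he]; ring

/-- Second moment bound for the number of isolated clusters in a disjoint family. -/
theorem measureReal_card_isolatedCluster_le {γ : Type*} [DecidableEq γ] (A : Finset γ)
    (hA : A.Nonempty)
    (D B : γ → Set Ω) (hD : ∀ c, MeasurableSet (D c)) (hB : ∀ c, MeasurableSet (B c))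
    (hDB : ∀ c, D c ⊆ B c) (hdisj : ∀ c ∈ A, ∀ c' ∈ A, c ≠ c' → Disjoint (B c) (B c'))
    {a z : ℝ} (ha : 0 < a) (hz : z < 1) (hDa : ∀ c ∈ A, μ.real (D c) = a)
    (hBz : ∀ c ∈ A, μ.real (B c) = z) {m : ℕ} (hm : 2 * m ≤ Fintype.card ι) {q : ℝ}
    (hq : q = (Fintype.card ι).choose m * (a ^ m * (1 - z) ^ (Fintype.card ι - m))) :
    (Measure.pi fun _ : ι => μ).real
      {x | (Nat.card {c // c ∈ A ∧ x ∈ isolatedCluster ι (D c) (B c) m} : ℝ) ≤ #A * q / 2} ≤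
      4 * (1 / (#A * q) + (((1 - z) ^ (2 * m))⁻¹ - 1)) := by
  have hz1 : 0 < 1 - z := by linarith
  obtain ⟨c₀, hc₀⟩ := hA
  have hz0 : 0 ≤ z := by rw [← hBz c₀ hc₀]; exact measureReal_nonneg
  have hq0 : 0 < q := by
    rw [hq]
    have := Nat.choose_pos (show m ≤ Fintype.card ι by omega)
    positivity
  have hqc : ∀ c ∈ A, (Measure.pi fun _ : ι => μ).real (isolatedCluster ι (D c) (B c) m) = q :=
    fun c hc => by
      rw [measureReal_isolatedCluster μ (hD c) (hB c) (hDB c), hDa c hc, hBz c hc, hq]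
  refine measureReal_card_lt_le _ A (fun c => isolatedCluster ι (D c) (B c) m)
    (fun c => measurableSet_isolatedCluster (hD c) (hB c) (hDB c) m) hq0
    (one_le_inv_iff₀.2 ⟨by positivity, pow_le_one₀ hz1.le (by linarith)⟩) ⟨c₀, hc₀⟩ hqc
    fun c hc c' hc' hcc => ?_
  have := measureReal_isolatedCluster_inter_le (ι := ι) μ (hD c) (hB c) (hB c') (hDB c) (hDB c')
    (hdisj c hc c' hc' hcc) (by rw [hDa c hc, hDa c' hc']) (by rw [hBz c hc, hBz c' hc'])
    (by rw [hBz c hc]; exact hz) hm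
  rwa [hqc c hc, hBz c hc] at this

end IIDPoints

/-! ### The uniform law on the torus and negligible events -/

namespace RandomGeometric

/-- The uniform law on the square `[0, √n]²`. -/
noncomputable def unifLaw (n : ℕ) : Measure (ℝ × ℝ) :=
  ProbabilityTheory.cond volume (Set.Icc (0 : ℝ) (√n) ×ˢ Set.Icc (0 : ℝ) (√n))

theorem pointsLaw_eq (n : ℕ) : pointsLaw n = Measure.pi fun _ : Fin n => unifLaw n := rfl

theorem volume_square (n : ℕ) :
    volume (Set.Icc (0 : ℝ) (√n) ×ˢ Set.Icc (0 : ℝ) (√n)) = n := by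
  rw [Measure.volume_eq_prod, Measure.prod_prod, Real.volume_Icc, sub_zero,
    ← ENNReal.ofReal_mul (Real.sqrt_nonneg _), Real.mul_self_sqrt (Nat.cast_nonneg n),
    ENNReal.ofReal_natCast]

instance (n : ℕ) [NeZero n] : IsProbabilityMeasure (unifLaw n) :=
  cond_isProbabilityMeasure_of_finite (by rw [volume_square]; exact_mod_cast NeZero.ne n)
    (by rw [volume_square]; exact ENNReal.natCast_ne_top n)

instance (n : ℕ) [NeZero n] : IsProbabilityMeasure (pointsLaw n) := by
  rw [pointsLaw_eq]; infer_instance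

theorem unifLaw_apply (n : ℕ) (s : Set (ℝ × ℝ)) :
    unifLaw n s = (n : ENNReal)⁻¹ *
      volume ((Set.Icc (0 : ℝ) (√n) ×ˢ Set.Icc (0 : ℝ) (√n)) ∩ s) := by
  rw [unifLaw, cond_apply (measurableSet_Icc.prod measurableSet_Icc), volume_square]

theorem unifLaw_eq_smul (n : ℕ) : unifLaw n = (n : ENNReal)⁻¹ •
    ((volume.restrict (Set.Icc (0 : ℝ) √n)).prod (volume.restrict (Set.Icc (0 : ℝ) √n))) := by
  rw [unifLaw, ProbabilityTheory.cond, volume_square, Measure.prod_restrict,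
    ← Measure.volume_eq_prod]

theorem unifLaw_real_of_subset {n : ℕ} {s : Set (ℝ × ℝ)}
    (hs : s ⊆ Set.Icc (0 : ℝ) (√n) ×ˢ Set.Icc (0 : ℝ) (√n)) :
    (unifLaw n).real s = volume.real s / n := by
  rw [measureReal_def, unifLaw_apply, Set.inter_eq_right.2 hs, ENNReal.toReal_mul,
    ENNReal.toReal_inv, ENNReal.toReal_natCast, measureReal_def, div_eq_inv_mul]

theorem unifLaw_square_compl (n : ℕ) :
    unifLaw n (Set.Icc (0 : ℝ) (√n) ×ˢ Set.Icc (0 : ℝ) (√n))ᶜ = 0 := by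
  rw [unifLaw_apply]; simp

theorem ae_mem_square (n : ℕ) [NeZero n] :
    ∀ᵐ x ∂(pointsLaw n), ∀ i, x i ∈ Set.Icc (0 : ℝ) (√n) ×ˢ Set.Icc (0 : ℝ) (√n) := by
  rw [ae_all_iff]
  intro i
  have h : ∀ᵐ y ∂(unifLaw n), y ∈ Set.Icc (0 : ℝ) (√n) ×ˢ Set.Icc (0 : ℝ) (√n) :=
    unifLaw_square_compl n
  exact (measurePreserving_eval (fun _ : Fin n => unifLaw n) i).quasiMeasurePreserving.ae h

theorem sqrt_natCast_pos (n : ℕ) [NeZero n] : 0 < √(n : ℝ) :=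
  Real.sqrt_pos.2 (by exact_mod_cast Nat.pos_of_ne_zero (NeZero.ne n))

/-- The uniform measure of a periodic set can be computed in any fundamental domain. -/
theorem unifLaw_preimage (n : ℕ) [NeZero n] (a b : ℝ) {E : Set (AddCircle (√n) × AddCircle (√n))}
    (hE : MeasurableSet E) :
    unifLaw n {x | ((x.1 : AddCircle (√n)), (x.2 : AddCircle (√n))) ∈ E} = (n : ENNReal)⁻¹ *
      volume ({x : ℝ × ℝ | ((x.1 : AddCircle (√n)), (x.2 : AddCircle (√n))) ∈ E} ∩
        Set.Ioc a (a + √n) ×ˢ Set.Ioc b (b + √n)) := by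
  have : Fact (0 < √(n : ℝ)) := ⟨sqrt_natCast_pos n⟩
  have hpres : ∀ a b : ℝ, MeasurePreserving
      (Prod.map ((↑) : ℝ → AddCircle (√n)) ((↑) : ℝ → AddCircle (√n)))
      ((volume.restrict (Set.Ioc a (a + √n))).prod (volume.restrict (Set.Ioc b (b + √n))))
      (volume.prod volume) := fun a b =>
    (AddCircle.measurePreserving_mk (√n) a).prod (AddCircle.measurePreserving_mk (√n) b)
  have h : ∀ a b : ℝ, volume ({x : ℝ × ℝ | ((x.1 : AddCircle (√n)), (x.2 : AddCircle (√n))) ∈ E} ∩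
      Set.Ioc a (a + √n) ×ˢ Set.Ioc b (b + √n)) = (volume.prod volume) E := by
    intro a b
    rw [← (hpres a b).measure_preimage hE.nullMeasurableSet, Measure.prod_restrict,
      Measure.restrict_apply ((hpres a b).measurable hE)]
    rfl
  have hm : MeasurableSet {x : ℝ × ℝ | ((x.1 : AddCircle (√n)), (x.2 : AddCircle (√n))) ∈ E} :=
    (hpres 0 0).measurable hE
  rw [h a b, ← h 0 0, unifLaw_eq_smul, ← Measure.restrict_congr_set Ioc_ae_eq_Icc,
    Measure.smul_apply, Measure.prod_restrict, Measure.restrict_apply hm, zero_add,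
    ← Measure.volume_eq_prod, smul_eq_mul]

theorem measurable_torusDist (L : ℝ) : Measurable fun p : (ℝ × ℝ) × (ℝ × ℝ) =>
    torusDist L p.1 p.2 := by
  unfold torusDist
  have h : Measurable fun t : ℝ => ‖(t : AddCircle L)‖ :=
    ((AddCircle.continuous_mk' L).norm).measurable
  refine Measurable.sqrt (Measurable.add ((h.comp ?_).pow_const 2) ((h.comp ?_).pow_const 2))
  · fun_prop
  · fun_prop

theorem measurable_torusDist_apply (L : ℝ) {ι : Type*} (i j : ι) :
    Measurable fun x : ι → ℝ × ℝ => torusDist L (x i) (x j) :=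
  Measurable.comp (g := fun p : (ℝ × ℝ) × (ℝ × ℝ) => torusDist L p.1 p.2)
    (f := fun x : ι → ℝ × ℝ => (x i, x j)) (measurable_torusDist L)
    ((measurable_pi_apply i).prodMk (measurable_pi_apply j))

theorem measurable_torusDist_left (L : ℝ) (p : ℝ × ℝ) : Measurable (torusDist L p) :=
  Measurable.comp (g := fun p : (ℝ × ℝ) × (ℝ × ℝ) => torusDist L p.1 p.2)
    (f := fun y : ℝ × ℝ => (p, y)) (measurable_torusDist L) measurable_prodMk_left

theorem lintegral_exp_neg_mul_abs_sub {b : ℝ} (hb : 0 < b) (p : ℝ) :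
    ∫⁻ x, ENNReal.ofReal (Real.exp (-b * |p - x|)) = ENNReal.ofReal (2 / b) := by
  have h1 : ∫⁻ x, ENNReal.ofReal (Real.exp (-b * |p - x|)) =
      ∫⁻ x, ENNReal.ofReal (Real.exp (-b * |x|)) :=
    lintegral_sub_left_eq_self (μ := volume)
      (fun x : ℝ => ENNReal.ofReal (Real.exp (-b * |x|))) p
  have h2 : ∫ x, Real.exp (-b * |x|) = 2 / b := by
    rw [integral_comp_abs (f := fun x => Real.exp (-b * x)),
      integral_exp_mul_Ioi (by linarith : -b < 0)]
    simp; ring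
  -- A non-integrable function would have integral 0 by convention, but the value is `2 / b > 0`.
  have hi : Integrable fun x : ℝ => Real.exp (-b * |x|) := by
    by_contra hn
    rw [integral_undef hn] at h2
    have : 0 < 2 / b := by positivity
    linarith
  rw [h1, ← ofReal_integral_eq_lintegral_ofReal hi
    (Eventually.of_forall fun x => (Real.exp_pos _).le), h2]

/-- In the fundamental domain centred at `p` the circle norm of `p - x` is `|p - x|`, so the
integral is at most the one over the line. -/
theorem setLIntegral_exp_neg_mul_norm_le {L b : ℝ} (hL : 0 < L) (hb : 0 < b) (p : ℝ) :
    ∫⁻ x in Set.Icc 0 L, ENNReal.ofReal (Real.exp (-b * ‖((p - x : ℝ) : AddCircle L)‖)) ≤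
      ENNReal.ofReal (2 / b) := by
  have : Fact (0 < L) := ⟨hL⟩
  let f : AddCircle L → ENNReal := fun y => ENNReal.ofReal (Real.exp (-b * ‖(p : AddCircle L) - y‖))
  have e : ∀ t, ∫⁻ x in Set.Ioc t (t + L),
      ENNReal.ofReal (Real.exp (-b * ‖((p - x : ℝ) : AddCircle L)‖)) = ∫⁻ y, f y := fun t => by
    rw [← AddCircle.lintegral_preimage L t f]; simp only [f, AddCircle.coe_sub]
  rw [← restrict_Ioc_eq_restrict_Icc]
  have h0 := e 0
  rw [zero_add] at h0
  rw [h0, ← e (p - L / 2)]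
  calc _ = ∫⁻ x in Set.Ioc (p - L / 2) (p - L / 2 + L),
        ENNReal.ofReal (Real.exp (-b * |p - x|)) := by
        refine setLIntegral_congr_fun measurableSet_Ioc fun x hx => ?_
        rw [(AddCircle.norm_coe_eq_abs_iff L hL.ne').2]
        rw [abs_of_pos hL, abs_le]
        constructor <;> linarith [hx.1, hx.2]
    _ ≤ ∫⁻ x, ENNReal.ofReal (Real.exp (-b * |p - x|)) := setLIntegral_le_lintegral _ _
    _ = _ := lintegral_exp_neg_mul_abs_sub hb p

/-- The torus distance is at least the average of the two coordinate norms. The bound therefore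
factors into two one-dimensional integrals with rate `b/2`, each at most `4/b`. -/
theorem lintegral_exp_neg_torusDist_le (n : ℕ) [NeZero n] {b : ℝ} (hb : 0 < b) (p : ℝ × ℝ) :
    ∫⁻ x, ENNReal.ofReal (Real.exp (-b * torusDist (√n) p x)) ∂(unifLaw n) ≤
      ENNReal.ofReal (16 / (b ^ 2 * n)) := by
  have hL := sqrt_natCast_pos n
  have hn : (0 : ℝ) < n := by exact_mod_cast Nat.pos_of_ne_zero (NeZero.ne n)
  have hm : Measurable fun t : ℝ => ‖(t : AddCircle √n)‖ :=
    ((AddCircle.continuous_mk' √n).norm).measurable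
  let g : ℝ → ℝ → ENNReal := fun q x =>
    ENNReal.ofReal (Real.exp (-(b / 2) * ‖((q - x : ℝ) : AddCircle √n)‖))
  have hg : ∀ q, Measurable (g q) := fun q => by
    refine ENNReal.measurable_ofReal.comp (Real.measurable_exp.comp ?_)
    exact (hm.comp (measurable_const.sub measurable_id)).const_mul _
  calc _ ≤ ∫⁻ x, g p.1 x.1 * g p.2 x.2 ∂(unifLaw n) := by
        refine lintegral_mono fun x => ?_
        rw [← ENNReal.ofReal_mul (Real.exp_pos _).le, ← Real.exp_add]
        refine ENNReal.ofReal_le_ofReal (Real.exp_le_exp.2 ?_)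
        have h1 := norm_fst_le_torusDist √n p x
        have h2 := norm_snd_le_torusDist √n p x
        nlinarith
    _ ≤ _ := by
        rw [unifLaw_eq_smul, lintegral_smul_measure, smul_eq_mul,
          lintegral_prod_mul (hg _).aemeasurable (hg _).aemeasurable]
        have h1 := setLIntegral_exp_neg_mul_norm_le hL (half_pos hb) p.1
        have h2 := setLIntegral_exp_neg_mul_norm_le hL (half_pos hb) p.2
        calc _ ≤ (n : ENNReal)⁻¹ *
            (ENNReal.ofReal (2 / (b / 2)) * ENNReal.ofReal (2 / (b / 2))) := by
              gcongr
          _ = _ := by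
              rw [← ENNReal.ofReal_mul (by positivity), ← ENNReal.ofReal_natCast n,
                ← ENNReal.ofReal_inv_of_pos hn, ← ENNReal.ofReal_mul (by positivity)]
              congr 1; field_simp; norm_num

/-- The indicator of the ball is at most `3 exp(-dist/s)` because `3/e > 1`; this yields the right
order with a generous constant. -/
theorem unifLaw_torusBall_le (n : ℕ) [NeZero n] {s : ℝ} (hs : 0 < s) (p : ℝ × ℝ) :
    (unifLaw n).real {x | torusDist (√n) p x ≤ s} ≤ 48 * s ^ 2 / n := by
  have hn : (0 : ℝ) < n := by exact_mod_cast Nat.pos_of_ne_zero (NeZero.ne n)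
  have hms : MeasurableSet {x | torusDist (√n) p x ≤ s} :=
    measurableSet_le (measurable_torusDist_left _ p) measurable_const
  refine ENNReal.toReal_le_of_le_ofReal (by positivity) ?_
  calc unifLaw n {x | torusDist (√n) p x ≤ s}
      = ∫⁻ x, {x | torusDist (√n) p x ≤ s}.indicator 1 x ∂(unifLaw n) :=
        (lintegral_indicator_one hms).symm
    _ ≤ ∫⁻ x, ENNReal.ofReal 3 * ENNReal.ofReal (Real.exp (-(1 / s) * torusDist (√n) p x))
          ∂(unifLaw n) := by
        refine lintegral_mono fun x => ?_
        by_cases h : torusDist (√n) p x ≤ s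
        · rw [Set.indicator_of_mem (by exact h), ← ENNReal.ofReal_mul (by norm_num), Pi.one_apply,
            ← ENNReal.ofReal_one]
          refine ENNReal.ofReal_le_ofReal ?_
          have h1 : Real.exp (-1) ≤ Real.exp (-(1 / s) * torusDist (√n) p x) := by
            refine Real.exp_le_exp.2 ?_
            have : 1 / s * torusDist (√n) p x ≤ 1 := by
              rw [one_div, inv_mul_le_iff₀ hs]; linarith
            linarith
          have := Real.exp_neg_one_gt_d9
          linarith
        · rw [Set.indicator_of_notMem (by exact h)]; exact zero_le
    _ ≤ ENNReal.ofReal 3 * ENNReal.ofReal (16 / ((1 / s) ^ 2 * n)) := by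
        rw [lintegral_const_mul' _ _ ENNReal.ofReal_ne_top]
        gcongr
        exact lintegral_exp_neg_torusDist_le n (by positivity) p
    _ = ENNReal.ofReal (48 * s ^ 2 / n) := by
        rw [← ENNReal.ofReal_mul (by norm_num)]
        congr 1; field_simp; norm_num

/-- A family of events whose probability tends to `0`, uniformly over the given radii. -/
def Negligible (A : ℕ → ℝ → Prop) (B : ∀ n : ℕ, ℝ → Set (Fin n → ℝ × ℝ)) : Prop :=
  ∀ ε : ENNReal, 0 < ε → ∀ᶠ n in atTop, ∀ r, A n r → pointsLaw n (B n r) ≤ ε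

theorem Negligible.union {A : ℕ → ℝ → Prop} {B B' : ∀ n : ℕ, ℝ → Set (Fin n → ℝ × ℝ)}
    (h : Negligible A B) (h' : Negligible A B') : Negligible A fun n r => B n r ∪ B' n r := by
  intro ε hε
  filter_upwards [h (ε / 2) (ENNReal.half_pos hε.ne'), h' (ε / 2) (ENNReal.half_pos hε.ne')]
    with n h1 h2 r hr
  calc _ ≤ _ := measure_union_le _ _
    _ ≤ ε / 2 + ε / 2 := add_le_add (h1 r hr) (h2 r hr)
    _ = ε := ENNReal.add_halves ε

theorem negligible_of_le {A : ℕ → ℝ → Prop} {B : ∀ n : ℕ, ℝ → Set (Fin n → ℝ × ℝ)} {b : ℕ → ℝ}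
    (hb : Tendsto b atTop (𝓝 0))
    (h : ∀ᶠ n in atTop, ∀ r, A n r → pointsLaw n (B n r) ≤ ENNReal.ofReal (b n)) :
    Negligible A B := by
  intro ε hε
  have hb' : Tendsto (fun n => ENNReal.ofReal (b n)) atTop (𝓝 0) := by
    simpa using ENNReal.tendsto_ofReal hb
  filter_upwards [h, hb'.eventually_le_const hε] with n h1 h2 r hr
  exact (h1 r hr).trans h2

theorem measurable_card_subtype {Ω ι : Type*} [MeasurableSpace Ω] [Fintype ι] {P : ι → Ω → Prop}
    (h : ∀ i, MeasurableSet {x | P i x}) :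
    Measurable fun x => (Nat.card {i // P i x} : ℝ) := by
  classical
  have : (fun x => (Nat.card {i // P i x} : ℝ)) =
      fun x => ∑ i, {x | P i x}.indicator (1 : Ω → ℝ) x := by
    funext x
    rw [Nat.card_eq_fintype_card, Fintype.card_subtype, Finset.card_filter]
    push_cast
    exact Finset.sum_congr rfl fun i _ => by
      by_cases hi : P i x <;> simp [hi]
  rw [this]
  exact Finset.measurable_fun_sum _ fun i _ => measurable_one.indicator (h i)

end RandomGeometric

/-! ### Density, ball counts, and the upper bound of order `r²` -/

namespace RandomGeometric

/-- The range of radii considered. -/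
def Admissible (n : ℕ) (r : ℝ) : Prop := 70 * √(Real.log n) ≤ r ∧ r < √n / 4

theorem one_le_log {n : ℕ} (hn : 3 ≤ n) : 1 ≤ Real.log n := by
  rw [Real.le_log_iff_exp_le (by positivity)]
  have h : (3 : ℝ) ≤ n := by exact_mod_cast hn
  linarith [Real.exp_one_lt_d9]

theorem Admissible.seventy_le {n : ℕ} {r : ℝ} (h : Admissible n r) (hn : 3 ≤ n) : 70 ≤ r := by
  have : 1 ≤ √(Real.log n) := Real.one_le_sqrt.2 (one_le_log hn)
  linarith [h.1]

theorem Admissible.pos {n : ℕ} {r : ℝ} (h : Admissible n r) (hn : 3 ≤ n) : 0 < r := by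
  linarith [h.seventy_le hn]

theorem Admissible.log_le {n : ℕ} {r : ℝ} (h : Admissible n r) (hn : 3 ≤ n) :
    4900 * Real.log n ≤ r ^ 2 := by
  have h1 : 0 ≤ Real.log n := by linarith [one_le_log hn]
  have := pow_le_pow_left₀ (by positivity) h.1 2
  rw [mul_pow, Real.sq_sqrt h1] at this
  linarith

theorem exp_neg_two_log {n : ℕ} (hn : 3 ≤ n) :
    (n : ℝ) * Real.exp (-2 * Real.log n) = 1 / n := by
  have hn' : (0 : ℝ) < n := by positivity
  rw [show (-2 : ℝ) * Real.log n = -Real.log n + -Real.log n by ring, Real.exp_add, Real.exp_neg,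
    Real.exp_log hn']
  field_simp

theorem tendsto_one_div_natCast : Tendsto (fun n : ℕ => 1 / (n : ℝ)) atTop (𝓝 0) :=
  tendsto_one_div_atTop_nhds_zero_nat

theorem pointsLaw_iUnion_le {κ : Type*} [Fintype κ] {n : ℕ} {B : κ → Set (Fin n → ℝ × ℝ)}
    {β N : ℝ} (hβ : 0 ≤ β) (hN : Fintype.card κ ≤ N)
    (h : ∀ c, pointsLaw n (B c) ≤ ENNReal.ofReal β) :
    pointsLaw n (⋃ c, B c) ≤ ENNReal.ofReal (N * β) := by
  calc pointsLaw n (⋃ c, B c) ≤ ∑ c, pointsLaw n (B c) := measure_iUnion_fintype_le _ _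
    _ ≤ ∑ _c : κ, ENNReal.ofReal β := Finset.sum_le_sum fun c _ => h c
    _ = ENNReal.ofReal (Fintype.card κ * β) := by
        rw [Finset.sum_const, nsmul_eq_mul, Finset.card_univ,
          ENNReal.ofReal_mul (Nat.cast_nonneg _), ENNReal.ofReal_natCast]
    _ ≤ _ := ENNReal.ofReal_le_ofReal (by gcongr)

/-- Number of cells along a side in a subdivision of the torus into squares of side
about `r / 5`. -/
noncomputable def gridSize (n : ℕ) (r : ℝ) : ℕ := ⌈5 * √n / r⌉₊

/-- Side of a grid cell. -/
noncomputable def gridSide (n : ℕ) (r : ℝ) : ℝ := √n / gridSize n r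

theorem grid_bounds {n : ℕ} {r : ℝ} (h : Admissible n r) (hn : 3 ≤ n) :
    0 < gridSize n r ∧ (gridSize n r : ℝ) ^ 2 ≤ n ∧ r / 6 ≤ gridSide n r ∧
      gridSide n r ≤ r / 5 ∧ gridSize n r * gridSide n r = √n := by
  have hr := h.seventy_le hn
  have hr0 := h.pos hn
  have hL : 0 < √(n : ℝ) := by positivity
  have hrL := h.2
  have h5 : 0 < 5 * √(n : ℝ) / r := by positivity
  have hM : 0 < gridSize n r := Nat.ceil_pos.2 h5
  have hM' : (0 : ℝ) < gridSize n r := by exact_mod_cast hM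
  have hlow : 5 * √(n : ℝ) / r ≤ gridSize n r := Nat.le_ceil _
  have hup : (gridSize n r : ℝ) ≤ 6 * √(n : ℝ) / r := by
    refine (Nat.ceil_lt_add_one h5.le).le.trans ?_
    rw [← sub_nonneg]
    have : 6 * √(n : ℝ) / r - (5 * √n / r + 1) = (√n - r) / r := by field_simp; ring
    rw [this]
    exact div_nonneg (by linarith) hr0.le
  refine ⟨hM, ?_, ?_, ?_, ?_⟩
  · have h1 : (gridSize n r : ℝ) ≤ √n := by
      refine hup.trans ?_
      rw [div_le_iff₀ hr0]; nlinarith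
    calc (gridSize n r : ℝ) ^ 2 ≤ √n ^ 2 := pow_le_pow_left₀ hM'.le h1 2
      _ = n := Real.sq_sqrt (Nat.cast_nonneg n)
  · rw [gridSide, le_div_iff₀ hM']
    rw [le_div_iff₀ hr0] at hup
    linarith
  · rw [gridSide, div_le_iff₀ hM']
    rw [div_le_iff₀ hr0] at hlow
    linarith
  · rw [gridSide]; field_simp

theorem exists_mem_cell {L s : ℝ} {M : ℕ} (hL : 0 < L) (hs : 0 < s) (hM : M * s = L) (t : ℝ) :
    ∃ i : Fin M, ∃ a : ℝ, i * s ≤ a ∧ a ≤ (i + 1) * s ∧ (a : AddCircle L) = t := by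
  have ha := toIcoMod_mem_Ico hL 0 t
  rw [zero_add] at ha
  have hlt : ⌊toIcoMod hL 0 t / s⌋₊ < M := by
    rw [Nat.floor_lt (div_nonneg ha.1 hs.le), div_lt_iff₀ hs, hM]
    exact ha.2
  refine ⟨⟨_, hlt⟩, toIcoMod hL 0 t, ?_, ?_, ?_⟩
  · rw [← le_div_iff₀ hs]; exact Nat.floor_le (div_nonneg ha.1 hs.le)
  · rw [← div_le_iff₀ hs]; exact (Nat.lt_floor_add_one _).le
  · rw [toIcoMod, AddCircle.coe_sub, AddCircle.coe_zsmul, AddCircle.coe_period, smul_zero, sub_zero]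

/-- Every point of the torus is close to a vertex. -/
def IsDense {n : ℕ} (r : ℝ) (x : Fin n → ℝ × ℝ) : Prop :=
  ∀ p : ℝ × ℝ, ∃ w, torusDist (√n) p (x w) ≤ r / 3

/-- A grid cell has diameter at most `√2 r/5 < r/3`, so it suffices that no cell is empty. The
expected number of points in a cell is at least `r²/36`, a large multiple of `log n`, and there are
at most `n` cells. -/
theorem negligible_not_isDense :
    Negligible Admissible fun _ r => {x | ¬ IsDense r x} := by
  refine negligible_of_le tendsto_one_div_natCast ?_
  filter_upwards [eventually_ge_atTop 3] with n hn r hr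
  have : NeZero n := ⟨by omega⟩
  obtain ⟨hM, hMn, hs1, hs2, hMs⟩ := grid_bounds hr hn
  set M := gridSize n r
  set s := gridSide n r
  have hr0 := hr.pos hn
  have hs : 0 < s := by linarith
  have hL := sqrt_natCast_pos n
  have hn0 : (0 : ℝ) < n := by positivity
  let cell : Fin M × Fin M → Set (ℝ × ℝ) := fun c =>
    Set.Icc (c.1 * s) ((c.1 + 1) * s) ×ˢ Set.Icc (c.2 * s) ((c.2 + 1) * s)
  have hcellm : ∀ c, MeasurableSet (cell c) := fun c => measurableSet_Icc.prod measurableSet_Icc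
  have hcell : ∀ c, (unifLaw n).real (cell c) = s ^ 2 / n := by
    intro c
    have hb : ∀ i : Fin M, ((i : ℝ) + 1) * s ≤ √n := fun i => by
      rw [← hMs]
      have : ((i : ℕ) : ℝ) + 1 ≤ M := by exact_mod_cast i.2
      gcongr
    rw [unifLaw_real_of_subset, measureReal_def, Measure.volume_eq_prod, Measure.prod_prod,
      Real.volume_Icc, Real.volume_Icc, ENNReal.toReal_mul, ENNReal.toReal_ofReal (by nlinarith),
      ENNReal.toReal_ofReal (by nlinarith)]
    · congr 1; ring
    · exact Set.prod_mono (Set.Icc_subset_Icc (by positivity) (hb _))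
        (Set.Icc_subset_Icc (by positivity) (hb _))
  have hsub : {x : Fin n → ℝ × ℝ | ¬ IsDense r x} ⊆
      ⋃ c, {x | (Nat.card {w // x w ∈ cell c} : ℝ) ≤ 0} := by
    intro x hx
    simp only [Set.mem_ofPred_eq, IsDense, not_forall] at hx
    obtain ⟨p, hp⟩ := hx
    obtain ⟨i, a, hi1, hi2, hia⟩ := exists_mem_cell hL hs hMs p.1
    obtain ⟨j, b, hj1, hj2, hjb⟩ := exists_mem_cell hL hs hMs p.2
    refine Set.mem_iUnion.2 ⟨(i, j), ?_⟩
    simp only [Set.mem_ofPred_eq]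
    by_contra hc
    have hpos : 0 < Nat.card {w // x w ∈ cell (i, j)} := by
      exact_mod_cast not_le.1 hc
    obtain ⟨⟨w, hw⟩⟩ := (Nat.card_pos_iff.1 hpos).1
    refine hp ⟨w, torusDist_le_of_abs_le (a := a - (x w).1) (b := b - (x w).2) ?_
      (by positivity) ?_ ?_⟩
    · obtain ⟨⟨h1, h2⟩, h3, h4⟩ := hw
      simp only at h1 h2 h3 h4
      have e1 : (a - (x w).1) ^ 2 ≤ s ^ 2 := by
        refine sq_le_sq' ?_ ?_ <;> nlinarith
      have e2 : (b - (x w).2) ^ 2 ≤ s ^ 2 := by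
        refine sq_le_sq' ?_ ?_ <;> nlinarith
      nlinarith
    · rw [AddCircle.coe_sub, hia, ← AddCircle.coe_sub]
    · rw [AddCircle.coe_sub, hjb, ← AddCircle.coe_sub]
  refine (measure_mono hsub).trans ?_
  rw [← exp_neg_two_log hn]
  refine pointsLaw_iUnion_le (Real.exp_pos _).le ?_ fun c => ?_
  · simpa [sq] using hMn
  · refine (IIDPoints.measure_card_le_le (unifLaw n) (hcellm c) 0 (hcell c).ge).trans ?_
    refine ENNReal.ofReal_le_ofReal (Real.exp_le_exp.2 ?_)
    rw [Fintype.card_fin, mul_div_cancel₀ _ hn0.ne']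
    have := hr.log_le hn
    nlinarith [one_le_log hn]

/-- The corners of the grid cells. -/
noncomputable def gridPoint (n : ℕ) (r : ℝ) (c : Fin (gridSize n r) × Fin (gridSize n r)) : ℝ × ℝ :=
  (c.1 * gridSide n r, c.2 * gridSide n r)

/-- Union bounds need deterministic centres. A ball of radius `3r` about a vertex lies in the ball
of radius `4r` about one of at most `n` grid points. -/
theorem exists_gridPoint {n : ℕ} {r : ℝ} (hr : Admissible n r) (hn : 3 ≤ n) (p : ℝ × ℝ) :
    ∃ c, torusDist (√n) (gridPoint n r c) p ≤ r := by
  have : NeZero n := ⟨by omega⟩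
  obtain ⟨hM, hMn, hs1, hs2, hMs⟩ := grid_bounds hr hn
  have hr0 := hr.pos hn
  have hs : 0 < gridSide n r := by linarith
  obtain ⟨i, a, hi1, hi2, hia⟩ := exists_mem_cell (sqrt_natCast_pos n) hs hMs p.1
  obtain ⟨j, b, hj1, hj2, hjb⟩ := exists_mem_cell (sqrt_natCast_pos n) hs hMs p.2
  refine ⟨(i, j), torusDist_le_of_abs_le (a := i * gridSide n r - a) (b := j * gridSide n r - b)
    ?_ hr0.le ?_ ?_⟩
  · have e1 : (i * gridSide n r - a) ^ 2 ≤ gridSide n r ^ 2 := by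
      refine sq_le_sq' ?_ ?_ <;> nlinarith
    have e2 : (j * gridSide n r - b) ^ 2 ≤ gridSide n r ^ 2 := by
      refine sq_le_sq' ?_ ?_ <;> nlinarith
    nlinarith
  · rw [AddCircle.coe_sub, hia, ← AddCircle.coe_sub]; rfl
  · rw [AddCircle.coe_sub, hjb, ← AddCircle.coe_sub]; rfl

/-- Each ball of radius `5 * r` around a grid point has at most `2401 * r ^ 2` vertices. -/
def HasBoundedBalls {n : ℕ} (r : ℝ) (x : Fin n → ℝ × ℝ) : Prop :=
  ∀ c, (Nat.card {w // torusDist (√n) (gridPoint n r c) (x w) ≤ 5 * r} : ℝ) ≤ 2401 * r ^ 2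

/-- The upper tail costs twice the mean, at most `2 · 48 · 25 r² = 2400 r²`; the remaining `r²`
exceeds `2 log n` and pays for the union bound. -/
theorem negligible_not_hasBoundedBalls :
    Negligible Admissible fun _ r => {x | ¬ HasBoundedBalls r x} := by
  refine negligible_of_le tendsto_one_div_natCast ?_
  filter_upwards [eventually_ge_atTop 3] with n hn r hr
  have : NeZero n := ⟨by omega⟩
  obtain ⟨hM, hMn, hs1, hs2, hMs⟩ := grid_bounds hr hn
  have hr0 := hr.pos hn
  have hn0 : (0 : ℝ) < n := by positivity
  have hsub : {x : Fin n → ℝ × ℝ | ¬ HasBoundedBalls r x} ⊆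
      ⋃ c, {x | 2401 * r ^ 2 ≤
        (Nat.card {w // x w ∈ {y | torusDist (√n) (gridPoint n r c) y ≤ 5 * r}} : ℝ)} := by
    intro x hx
    simp only [Set.mem_ofPred_eq, HasBoundedBalls, not_forall] at hx
    obtain ⟨c, hc⟩ := hx
    exact Set.mem_iUnion.2 ⟨c, (not_le.1 hc).le⟩
  refine (measure_mono hsub).trans ?_
  rw [← exp_neg_two_log hn]
  refine pointsLaw_iUnion_le (Real.exp_pos _).le (by simpa [sq] using hMn) fun c => ?_
  refine (IIDPoints.measure_card_ge_le (unifLaw n)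
    (measurableSet_le (measurable_torusDist_left _ _) measurable_const) _
    (unifLaw_torusBall_le n (by positivity) _)).trans ?_
  refine ENNReal.ofReal_le_ofReal (Real.exp_le_exp.2 ?_)
  rw [Fintype.card_fin, mul_assoc, mul_div_cancel₀ _ hn0.ne']
  have := hr.log_le hn
  nlinarith [one_le_log hn]

/-- With a sensor on every vertex nearby, the robber is at distance 0 from one of them. -/
theorem localizationNumber_le_sq {n : ℕ} {r : ℝ} {x : Fin n → ℝ × ℝ} (hr : Admissible n r)
    (hn : 3 ≤ n) (hd : IsDense r x) (hb : HasBoundedBalls r x) :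
    (LocalizationGame.localizationNumber (torusGraph r x) : ℝ) ≤ 2402 * r ^ 2 := by
  have hr70 := hr.seventy_le hn
  have hk : LocalizationGame.localizationNumber (torusGraph r x) ≤ ⌊2402 * r ^ 2⌋₊ := by
    refine localizationNumber_le_of_dense (by omega) (hr.pos hn) hd ?_ fun v => ?_
    · refine Nat.le_floor ?_; push_cast; nlinarith
    · classical
      obtain ⟨c, hc⟩ := exists_gridPoint hr hn (x v)
      refine ⟨Finset.univ.filter fun w => torusDist (√n) (gridPoint n r c) (x w) ≤ 5 * r, ?_,
        fun u w hu hw hs => ?_⟩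
      · refine Nat.le_floor ?_
        have h1 := hb c
        rw [Nat.subtype_card (Finset.univ.filter fun w =>
          torusDist (√n) (gridPoint n r c) (x w) ≤ 5 * r) fun w => by simp] at h1
        nlinarith
      · have h1 := hs u (by
          simp only [Finset.mem_filter, Finset.mem_univ, true_and]
          linarith [torusDist_triangle (√n) (gridPoint n r c) (x v) (x u)])
        rw [SimpleGraph.edist_self] at h1
        exact SimpleGraph.edist_eq_zero_iff.1 h1.symm
  exact (Nat.cast_le.2 hk).trans (Nat.floor_le (by positivity))

end RandomGeometric

/-! ### Area of the difference of two discs -/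

namespace RandomGeometric

/-- A strip of width `w` just inside an arc of the circle leaves the disc when translated by `(A,
B)` with `A ≥ w` and `B ≥ 0`. The torus does not bring it back: since `A, B ≤ L/2` and `L > 4r`,
going round the other way is longer than `r`. -/
theorem lt_of_lune {L r A B s t w : ℝ} (hr : 0 < r) (hrL : 4 * r < L) (hA' : A ≤ L / 2)
    (hB : 0 ≤ B) (hB' : B ≤ L / 2) (hwA : w ≤ A) (hwr : w ≤ r / 2) (ht : 0 ≤ t)
    (ht' : t ≤ r / 2) (hs : √(r ^ 2 - t ^ 2) - w < s) (hs' : s < √(r ^ 2 - t ^ 2)) :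
    s ^ 2 + t ^ 2 ≤ r ^ 2 ∧
      r ^ 2 < ‖((s + A : ℝ) : AddCircle L)‖ ^ 2 + ‖((t + B : ℝ) : AddCircle L)‖ ^ 2 := by
  have h0 : 0 ≤ r ^ 2 - t ^ 2 := by nlinarith
  set q := √(r ^ 2 - t ^ 2) with hq
  have hq2 : q ^ 2 = r ^ 2 - t ^ 2 := Real.sq_sqrt h0
  have hq0 : 0 ≤ q := Real.sqrt_nonneg _
  have hqr : q ≤ r := by nlinarith
  have hqr' : r / 2 < q := by nlinarith
  have hs0 : 0 < s := by linarith
  refine ⟨by nlinarith, ?_⟩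
  have hx : 0 < s + A := by linarith
  have hy : 0 ≤ t + B := by linarith
  have e1 := norm_coe_eq_min (L := L) (t := s + A) (by rw [abs_of_pos hx]; linarith)
  have e2 := norm_coe_eq_min (L := L) (t := t + B) (by rw [abs_of_nonneg hy]; linarith)
  rw [abs_of_pos hx] at e1
  rw [abs_of_nonneg hy] at e2
  rcases min_choice (s + A) (L - (s + A)) with h1 | h1
  · rcases min_choice (t + B) (L - (t + B)) with h2 | h2
    · rw [e1, e2, h1, h2]
      have h3 : q ^ 2 < (s + A) ^ 2 := by nlinarith
      have h4 : t ^ 2 ≤ (t + B) ^ 2 := by nlinarith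
      linarith
    · have : r ^ 2 < ‖((t + B : ℝ) : AddCircle L)‖ ^ 2 := by
        rw [e2, h2]
        have : r < L - (t + B) := by linarith
        nlinarith
      nlinarith [sq_nonneg ‖((s + A : ℝ) : AddCircle L)‖]
  · have : r ^ 2 < ‖((s + A : ℝ) : AddCircle L)‖ ^ 2 := by
      rw [e1, h1]
      have : r < L - (s + A) := by linarith
      nlinarith
    nlinarith [sq_nonneg ‖((t + B : ℝ) : AddCircle L)‖]

theorem volume_lune {r w : ℝ} (hr : 0 < r) :
    volume (regionBetween (fun t => √(r ^ 2 - t ^ 2) - w) (fun t => √(r ^ 2 - t ^ 2))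
      (Set.Icc 0 (r / 2))) = ENNReal.ofReal (w * (r / 2)) := by
  have hm : Measurable fun t : ℝ => √(r ^ 2 - t ^ 2) := by fun_prop
  rw [Measure.volume_eq_prod, volume_regionBetween_eq_lintegral (hm.sub_const w).aemeasurable
    hm.aemeasurable measurableSet_Icc]
  simp only [Pi.sub_apply, sub_sub_cancel]
  rw [setLIntegral_const, Real.volume_Icc, sub_zero, ← ENNReal.ofReal_mul' (by positivity)]

theorem measurable_sqrt_norm_sub (L : ℝ) (p : ℝ × ℝ) :
    Measurable fun q : AddCircle L × AddCircle L =>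
      √(‖q.1 - (p.1 : AddCircle L)‖ ^ 2 + ‖q.2 - (p.2 : AddCircle L)‖ ^ 2) :=
  Continuous.measurable (by fun_prop)

/-- All of `Λ` lies within `r` of `u` in each coordinate, hence in the fundamental domain centred at
`u`, where the measure of the periodic set may be computed. -/
theorem volume_le_unifLaw_ball_diff (n : ℕ) [NeZero n] {r : ℝ} (hrL : r < √n / 4)
    (u v : ℝ × ℝ) {Λ : Set (ℝ × ℝ)}
    (h1 : ∀ y ∈ Λ, torusDist (√n) y u ≤ r ∧ r < torusDist (√n) y v)
    (h2 : ∀ y ∈ Λ, |u.1 - y.1| ≤ r ∧ |u.2 - y.2| ≤ r) :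
    (n : ENNReal)⁻¹ * volume Λ ≤
      unifLaw n {y | torusDist (√n) y u ≤ r ∧ r < torusDist (√n) y v} := by
  have hL := sqrt_natCast_pos n
  have hE : MeasurableSet ({q : AddCircle (√n) × AddCircle (√n) |
      √(‖q.1 - (u.1 : AddCircle (√n))‖ ^ 2 + ‖q.2 - (u.2 : AddCircle (√n))‖ ^ 2) ≤ r} ∩
      {q | r < √(‖q.1 - (v.1 : AddCircle (√n))‖ ^ 2 + ‖q.2 - (v.2 : AddCircle (√n))‖ ^ 2)}) :=
    (measurableSet_le (measurable_sqrt_norm_sub (√n) u) measurable_const).inter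
      (measurableSet_lt measurable_const (measurable_sqrt_norm_sub (√n) v))
  have h := unifLaw_preimage n (u.1 - √n / 2) (u.2 - √n / 2) hE
  have hset : ∀ y : ℝ × ℝ, torusDist (√n) y u ≤ r ∧ r < torusDist (√n) y v →
      ((y.1 : AddCircle (√n)), (y.2 : AddCircle (√n))) ∈ {q : AddCircle (√n) × AddCircle (√n) |
      √(‖q.1 - (u.1 : AddCircle (√n))‖ ^ 2 + ‖q.2 - (u.2 : AddCircle (√n))‖ ^ 2) ≤ r} ∩
      {q | r < √(‖q.1 - (v.1 : AddCircle (√n))‖ ^ 2 + ‖q.2 - (v.2 : AddCircle (√n))‖ ^ 2)} :=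
    fun y hy => hy
  have hset' : ∀ y : ℝ × ℝ,
      ((y.1 : AddCircle (√n)), (y.2 : AddCircle (√n))) ∈ {q : AddCircle (√n) × AddCircle (√n) |
      √(‖q.1 - (u.1 : AddCircle (√n))‖ ^ 2 + ‖q.2 - (u.2 : AddCircle (√n))‖ ^ 2) ≤ r} ∩
      {q | r < √(‖q.1 - (v.1 : AddCircle (√n))‖ ^ 2 + ‖q.2 - (v.2 : AddCircle (√n))‖ ^ 2)} →
      torusDist (√n) y u ≤ r ∧ r < torusDist (√n) y v := fun y hy => hy
  refine le_trans ?_ (h.ge.trans (measure_mono hset'))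
  gcongr
  intro y hy
  refine ⟨hset y (h1 y hy), ?_⟩
  have h4 := abs_le.1 (h2 y hy).1
  have h5 := abs_le.1 (h2 y hy).2
  constructor <;> constructor <;> linarith

/-- The difference of two balls of radius `r` contains an isometric copy of a lune. -/
theorem unifLaw_ball_diff_ge (n : ℕ) [NeZero n] {r : ℝ} (hr : 0 < r) (hrL : r < √n / 4)
    (u v : ℝ × ℝ) :
    r * min (torusDist (√n) u v) r / (4 * n) ≤
      (unifLaw n).real {y | torusDist (√n) y u ≤ r ∧ r < torusDist (√n) y v} := by
  have hL := sqrt_natCast_pos n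
  have hn : (0 : ℝ) < n := by exact_mod_cast Nat.pos_of_ne_zero (NeZero.ne n)
  set L := √(n : ℝ) with hLdef
  obtain ⟨a, b, ha, hb, ha', hb', hab, -, -⟩ := exists_lift_torusDist hL v u
  rw [torusDist_comm] at hab
  set δ := torusDist L u v with hδ
  have hδ0 : 0 ≤ δ := torusDist_nonneg _ _ _
  have sgn : ∀ c : ℝ, ∃ e : ℝ, (e = 1 ∨ e = -1) ∧ e * c = |c| := fun c => by
    rcases le_total 0 c with h | h
    · exact ⟨1, Or.inl rfl, by rw [one_mul, abs_of_nonneg h]⟩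
    · exact ⟨-1, Or.inr rfl, by rw [abs_of_nonpos h]; ring⟩
  -- Reflections make both components of the displacement from `u` to `v` nonnegative, so one shape
  -- of lune serves all directions.
  obtain ⟨e₁, he₁, hea⟩ := sgn a
  obtain ⟨e₂, he₂, heb⟩ := sgn b
  have nrm : ∀ e : ℝ, (e = 1 ∨ e = -1) → ∀ c : ℝ, ‖((e * c : ℝ) : AddCircle L)‖ =
      ‖((c : ℝ) : AddCircle L)‖ := by
    rintro e (rfl | rfl) c
    · rw [one_mul]
    · rw [neg_one_mul, AddCircle.coe_neg, norm_neg]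
  have abse : ∀ e : ℝ, (e = 1 ∨ e = -1) → ∀ c : ℝ, |e * c| = |c| := by
    rintro e (rfl | rfl) c <;> simp
  have sqe : ∀ e : ℝ, (e = 1 ∨ e = -1) → ∀ c : ℝ, (e * c) ^ 2 = c ^ 2 := by
    rintro e (rfl | rfl) c <;> ring
  -- membership in the difference of balls, in coordinates adapted to the two points
  have hmem : ∀ y : ℝ × ℝ, (e₁ * (u.1 - y.1)) ^ 2 + (e₂ * (u.2 - y.2)) ^ 2 ≤ r ^ 2 →
      r ^ 2 < ‖((e₁ * (u.1 - y.1) + |a| : ℝ) : AddCircle L)‖ ^ 2 +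
        ‖((e₂ * (u.2 - y.2) + |b| : ℝ) : AddCircle L)‖ ^ 2 →
      torusDist L y u ≤ r ∧ r < torusDist L y v := by
    intro y h1 h2
    rw [sqe e₁ he₁, sqe e₂ he₂] at h1
    refine ⟨torusDist_comm L y u ▸ torusDist_le_of_sq h1 hr.le, ?_⟩
    rw [← hea, ← heb, ← mul_add, ← mul_add, nrm e₁ he₁, nrm e₂ he₂, AddCircle.coe_add,
      AddCircle.coe_add, ha', hb', ← AddCircle.coe_add, ← AddCircle.coe_add,
      show u.1 - y.1 + (v.1 - u.1) = v.1 - y.1 by ring,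
      show u.2 - y.2 + (v.2 - u.2) = v.2 - y.2 by ring] at h2
    rw [torusDist_comm]
    exact Real.lt_sqrt_of_sq_lt h2
  have hpres1 : ∀ (e : ℝ), (e = 1 ∨ e = -1) → ∀ c : ℝ,
      MeasurePreserving (fun y : ℝ => e * (c - y)) volume volume := by
    rintro e (rfl | rfl) c
    · simpa using Measure.measurePreserving_sub_left volume c
    · simpa using measurePreserving_sub_right volume c
  have hpres2 : MeasurePreserving (fun y : ℝ × ℝ => (e₁ * (u.1 - y.1), e₂ * (u.2 - y.2)))
      volume volume := (hpres1 e₁ he₁ u.1).prod (hpres1 e₂ he₂ u.2)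
  have hpres3 : MeasurePreserving (fun y : ℝ × ℝ => (e₂ * (u.2 - y.2), e₁ * (u.1 - y.1)))
      volume volume := Measure.measurePreserving_swap.comp hpres2
  have hregm : ∀ w : ℝ, MeasurableSet (regionBetween (fun t => √(r ^ 2 - t ^ 2) - w)
      (fun t => √(r ^ 2 - t ^ 2)) (Set.Icc 0 (r / 2))) := fun w =>
    measurableSet_regionBetween (by fun_prop) (by fun_prop) measurableSet_Icc
  have main : ∀ Λ : Set (ℝ × ℝ), (∀ y ∈ Λ, torusDist L y u ≤ r ∧ r < torusDist L y v) →
      (∀ y ∈ Λ, |u.1 - y.1| ≤ r ∧ |u.2 - y.2| ≤ r) →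
      volume Λ = ENNReal.ofReal (min (δ / 2) (r / 2) * (r / 2)) →
      r * min δ r / (4 * n) ≤
        (unifLaw n).real {y | torusDist L y u ≤ r ∧ r < torusDist L y v} := by
    intro Λ h1 h2 h3
    refine (ENNReal.ofReal_le_iff_le_toReal (measure_ne_top _ _)).1
      (le_trans (le_of_eq ?_) (volume_le_unifLaw_ball_diff n hrL u v h1 h2))
    rw [h3, ← ENNReal.ofReal_natCast n, ← ENNReal.ofReal_inv_of_pos hn,
      ← ENNReal.ofReal_mul (by positivity), min_div_div_right (by norm_num : (0 : ℝ) ≤ 2)]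
    congr 1
    field_simp
    norm_num
  have hw0 : min (δ / 2) (r / 2) ≤ r / 2 := min_le_right _ _
  have abs_bd : ∀ s t : ℝ, s ^ 2 + t ^ 2 ≤ r ^ 2 → |s| ≤ r ∧ |t| ≤ r := fun s t h =>
    ⟨abs_le_of_sq_le_sq (by nlinarith) hr.le, abs_le_of_sq_le_sq (by nlinarith) hr.le⟩
  -- The longer component of the displacement is at least `δ/2`; the lune of width `min(δ, r)/2` is
  -- displaced along that axis.
  rcases le_total |b| |a| with hcase | hcase
  · have hwa : min (δ / 2) (r / 2) ≤ |a| := by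
      refine (min_le_left _ _).trans ?_
      have : δ ^ 2 ≤ (2 * |a|) ^ 2 := by
        rw [hab, ← sq_abs a, ← sq_abs b]; nlinarith [abs_nonneg a, abs_nonneg b]
      have := abs_le_of_sq_le_sq this (by positivity)
      rw [abs_of_nonneg hδ0] at this
      linarith
    have key : ∀ y ∈ (fun y : ℝ × ℝ => (e₂ * (u.2 - y.2), e₁ * (u.1 - y.1))) ⁻¹'
        (regionBetween (fun t => √(r ^ 2 - t ^ 2) - min (δ / 2) (r / 2))
          (fun t => √(r ^ 2 - t ^ 2)) (Set.Icc 0 (r / 2))),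
        (e₁ * (u.1 - y.1)) ^ 2 + (e₂ * (u.2 - y.2)) ^ 2 ≤ r ^ 2 ∧
        r ^ 2 < ‖((e₁ * (u.1 - y.1) + |a| : ℝ) : AddCircle L)‖ ^ 2 +
          ‖((e₂ * (u.2 - y.2) + |b| : ℝ) : AddCircle L)‖ ^ 2 := by
      rintro y ⟨⟨ht, ht'⟩, hs, hs'⟩
      exact lt_of_lune hr (by linarith) ha (abs_nonneg b) hb hwa hw0 ht ht' hs hs'
    refine main _ (fun y hy => hmem y (key y hy).1 (key y hy).2) (fun y hy => ?_) ?_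
    · have := abs_bd _ _ (key y hy).1
      rwa [abse e₁ he₁, abse e₂ he₂] at this
    · rw [hpres3.measure_preimage (hregm _).nullMeasurableSet, volume_lune hr]
  · have hwb : min (δ / 2) (r / 2) ≤ |b| := by
      refine (min_le_left _ _).trans ?_
      have : δ ^ 2 ≤ (2 * |b|) ^ 2 := by
        rw [hab, ← sq_abs a, ← sq_abs b]; nlinarith [abs_nonneg a, abs_nonneg b]
      have := abs_le_of_sq_le_sq this (by positivity)
      rw [abs_of_nonneg hδ0] at this
      linarith
    have key : ∀ y ∈ (fun y : ℝ × ℝ => (e₁ * (u.1 - y.1), e₂ * (u.2 - y.2))) ⁻¹'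
        (regionBetween (fun t => √(r ^ 2 - t ^ 2) - min (δ / 2) (r / 2))
          (fun t => √(r ^ 2 - t ^ 2)) (Set.Icc 0 (r / 2))),
        (e₂ * (u.2 - y.2)) ^ 2 + (e₁ * (u.1 - y.1)) ^ 2 ≤ r ^ 2 ∧
        r ^ 2 < ‖((e₂ * (u.2 - y.2) + |b| : ℝ) : AddCircle L)‖ ^ 2 +
          ‖((e₁ * (u.1 - y.1) + |a| : ℝ) : AddCircle L)‖ ^ 2 := by
      rintro y ⟨⟨ht, ht'⟩, hs, hs'⟩
      exact lt_of_lune hr (by linarith) hb (abs_nonneg a) ha hwb hw0 ht ht' hs hs'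
    refine main _ (fun y hy => hmem y ((add_comm _ _).trans_le (key y hy).1)
      ((key y hy).2.trans_eq (add_comm _ _))) (fun y hy => ?_) ?_
    · have := abs_bd _ _ (key y hy).1
      rw [abse e₁ he₁, abse e₂ he₂] at this
      exact this.symm
    · rw [hpres2.measure_preimage (hregm _).nullMeasurableSet, volume_lune hr]

end RandomGeometric

theorem MeasurableSet.and {Ω : Type*} [MeasurableSpace Ω] {p q : Ω → Prop}
    (hp : MeasurableSet {x | p x}) (hq : MeasurableSet {x | q x}) :
    MeasurableSet {x | p x ∧ q x} := by
  have : {x | p x ∧ q x} = {x | p x} ∩ {x | q x} := by ext; simp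
  rw [this]
  exact hp.inter hq

/-! ### Many vertices separate every pair that is not too close -/

namespace RandomGeometric

/-- Every pair of vertices at distance `δ ≥ 128 log n / r` is distinguished by many vertices. -/
def HasSeparators {n : ℕ} (r : ℝ) (x : Fin n → ℝ × ℝ) : Prop :=
  ∀ u v, u ≠ v → 128 * Real.log n / r ≤ torusDist (√n) (x u) (x v) →
    r * min (torusDist (√n) (x u) (x v)) r / 32 ≤
      Nat.card {w // torusDist (√n) (x w) (x u) ≤ r ∧ r < torusDist (√n) (x w) (x v)}

theorem measurableSet_fewSeparators {n : ℕ} (r : ℝ) (u v : Fin n) :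
    MeasurableSet {x : Fin n → ℝ × ℝ | u ≠ v ∧
      128 * Real.log n / r ≤ torusDist (√n) (x u) (x v) ∧
      (Nat.card {w // torusDist (√n) (x w) (x u) ≤ r ∧ r < torusDist (√n) (x w) (x v)} : ℝ) ≤
        r * min (torusDist (√n) (x u) (x v)) r / 32} := by
  have h1 : MeasurableSet {x : Fin n → ℝ × ℝ |
      128 * Real.log n / r ≤ torusDist (√n) (x u) (x v)} :=
    measurableSet_le measurable_const (measurable_torusDist_apply _ _ _)
  have h2 : ∀ w : Fin n, MeasurableSet {x : Fin n → ℝ × ℝ |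
      torusDist (√n) (x w) (x u) ≤ r ∧ r < torusDist (√n) (x w) (x v)} := fun w =>
    MeasurableSet.and (measurableSet_le (measurable_torusDist_apply _ _ _) measurable_const)
      (measurableSet_lt measurable_const (measurable_torusDist_apply _ _ _))
  have h3 : Measurable fun x : Fin n → ℝ × ℝ => r * min (torusDist (√n) (x u) (x v)) r / 32 :=
    (((measurable_torusDist_apply _ _ _).min measurable_const).const_mul r).div_const 32
  exact (MeasurableSet.const _).and (h1.and (measurableSet_le (measurable_card_subtype h2) h3))

/-- With `x u` and `x v` fixed, the other `n - 2 ≥ n/2` points are independent, and the mean number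
of separators is at least `r min(δ, r) / 8`. The lower tail at a quarter of this has probability at
most `exp(-r min(δ, r) / 32)`, where `r min(δ, r) ≥ 128 log n`. This beats the `n²` pairs. -/
theorem pointsLaw_fewSeparators_le {n : ℕ} {r : ℝ} (hr : Admissible n r) (hn : 4 ≤ n)
    (u v : Fin n) :
    pointsLaw n {x : Fin n → ℝ × ℝ | u ≠ v ∧
      128 * Real.log n / r ≤ torusDist (√n) (x u) (x v) ∧
      (Nat.card {w // torusDist (√n) (x w) (x u) ≤ r ∧ r < torusDist (√n) (x w) (x v)} : ℝ) ≤
        r * min (torusDist (√n) (x u) (x v)) r / 32} ≤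
      ENNReal.ofReal (Real.exp (-3 * Real.log n)) := by
  classical
  have : NeZero n := ⟨by omega⟩
  have hr0 := hr.pos (by omega)
  have hlog := one_le_log (n := n) (by omega)
  have hrlog := hr.log_le (by omega)
  have hn0 : (0 : ℝ) < n := by positivity
  rw [pointsLaw_eq]
  refine IIDPoints.measure_pi_le_of_section (unifLaw n) (fun i => i ≠ u ∧ i ≠ v)
    (measurableSet_fewSeparators r u v) fun y => ?_
  set pu := y ⟨u, by simp⟩ with hpu
  set pv := y ⟨v, by simp⟩ with hpv
  set D : Set (ℝ × ℝ) := {q | torusDist (√n) q pu ≤ r ∧ r < torusDist (√n) q pv} with hD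
  have hDm : MeasurableSet D := by
    have h : ∀ p : ℝ × ℝ, Measurable fun q => torusDist (√n) q p := fun p => by
      simp_rw [torusDist_comm (√n) _ p]; exact measurable_torusDist_left _ p
    exact MeasurableSet.and (measurableSet_le (h pu) measurable_const)
      (measurableSet_lt measurable_const (h pv))
  set δ := torusDist (√n) pu pv with hδ
  have hsub : {z : {i : Fin n // i ≠ u ∧ i ≠ v} → ℝ × ℝ |
      (fun i => if hi : i ≠ u ∧ i ≠ v then z ⟨i, hi⟩ else y ⟨i, hi⟩) ∈
      {x : Fin n → ℝ × ℝ | u ≠ v ∧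
      128 * Real.log n / r ≤ torusDist (√n) (x u) (x v) ∧
      (Nat.card {w // torusDist (√n) (x w) (x u) ≤ r ∧ r < torusDist (√n) (x w) (x v)} : ℝ) ≤
        r * min (torusDist (√n) (x u) (x v)) r / 32}} ⊆
      {z | (u ≠ v ∧ 128 * Real.log n / r ≤ δ) ∧
        (Nat.card {w // z w ∈ D} : ℝ) ≤ r * min δ r / 32} := by
    intro z hz
    rw [Set.mem_ofPred_eq] at hz
    generalize hX : (fun i => if hi : i ≠ u ∧ i ≠ v then z ⟨i, hi⟩ else y ⟨i, hi⟩) = X at hz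
    have hu : X u = pu := by rw [← hX]; exact dif_neg _
    have hv : X v = pv := by rw [← hX]; exact dif_neg _
    have hw : ∀ w : {i : Fin n // i ≠ u ∧ i ≠ v}, X w.1 = z w := fun w => by
      rw [← hX]; exact dif_pos w.2
    rw [Set.mem_ofPred_eq, hu, hv] at hz
    obtain ⟨huv, h2, h3⟩ := hz
    rw [Set.mem_ofPred_eq]
    have hmem : ∀ w : {w // z w ∈ D}, torusDist (√n) (X w.1.1) pu ≤ r ∧
        r < torusDist (√n) (X w.1.1) pv := fun w => by rw [hw]; exact w.2
    have hinj : Function.Injective fun w : {w // z w ∈ D} =>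
        (⟨w.1.1, hmem w⟩ : {w // torusDist (√n) (X w) pu ≤ r ∧ r < torusDist (√n) (X w) pv}) := by
      intro w w' h
      simp only [Subtype.mk.injEq] at h
      exact Subtype.ext (Subtype.ext h)
    exact ⟨⟨huv, h2⟩, le_trans (Nat.cast_le.2 (Nat.card_le_card_of_injective _ hinj)) h3⟩
  refine (measure_mono hsub).trans ?_
  by_cases hc : u ≠ v ∧ 128 * Real.log n / r ≤ δ
  swap
  · simp [hc]
  obtain ⟨huv, hfar⟩ := hc
  have hcard : (n : ℝ) / 2 ≤ Fintype.card {i : Fin n // i ≠ u ∧ i ≠ v} := by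
    have h1 : Fintype.card {i : Fin n // i ≠ u ∧ i ≠ v} = n - 2 := by
      rw [Fintype.card_subtype]
      have : Finset.univ.filter (fun i : Fin n => i ≠ u ∧ i ≠ v) = ({u, v} : Finset (Fin n))ᶜ := by
        ext; simp
      rw [this, Finset.card_compl, Finset.card_pair huv, Fintype.card_fin]
    rw [h1, Nat.cast_sub (by omega)]
    have : (4 : ℝ) ≤ n := by exact_mod_cast hn
    push_cast; linarith
  have hmin : 128 * Real.log n ≤ r * min δ r := by
    rw [mul_min_of_nonneg _ _ hr0.le]
    refine le_min ?_ (by nlinarith)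
    rw [div_le_iff₀ hr0] at hfar
    linarith
  have hp : r * min δ r / (4 * n) ≤ (unifLaw n).real D := unifLaw_ball_diff_ge n hr0 hr.2 pu pv
  have hsub' : {z : {i : Fin n // i ≠ u ∧ i ≠ v} → ℝ × ℝ | (u ≠ v ∧ 128 * Real.log n / r ≤ δ) ∧
        (Nat.card {w // z w ∈ D} : ℝ) ≤ r * min δ r / 32} ⊆
      {z | (Nat.card {w // z w ∈ D} : ℝ) ≤ r * min δ r / 32} := by
    intro z hz
    rw [Set.mem_ofPred_eq] at hz ⊢
    exact hz.2
  refine (measure_mono hsub').trans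
    ((IIDPoints.measure_card_le_le (unifLaw n) hDm (r * min δ r / 32) hp).trans ?_)
  refine ENNReal.ofReal_le_ofReal (Real.exp_le_exp.2 ?_)
  have h1 : n / 2 * (r * min δ r / (4 * n)) ≤
      (Fintype.card {i : Fin n // i ≠ u ∧ i ≠ v}) * (r * min δ r / (4 * n)) := by
    gcongr
    exact div_nonneg (by linarith) (by positivity)
  have h2 : n / 2 * (r * min δ r / (4 * n)) = r * min δ r / 8 := by field_simp; ring
  rw [h2] at h1
  linarith

theorem negligible_not_hasSeparators :
    Negligible Admissible fun _ r => {x | ¬ HasSeparators r x} := by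
  refine negligible_of_le tendsto_one_div_natCast ?_
  filter_upwards [eventually_ge_atTop 4] with n hn r hr
  have hn0 : (0 : ℝ) < n := by positivity
  have hsub : {x : Fin n → ℝ × ℝ | ¬ HasSeparators r x} ⊆
      ⋃ p : Fin n × Fin n, {x | p.1 ≠ p.2 ∧
        128 * Real.log n / r ≤ torusDist (√n) (x p.1) (x p.2) ∧
        (Nat.card {w // torusDist (√n) (x w) (x p.1) ≤ r ∧ r < torusDist (√n) (x w) (x p.2)} : ℝ)
          ≤ r * min (torusDist (√n) (x p.1) (x p.2)) r / 32} := by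
    intro x hx
    simp only [Set.mem_ofPred_eq, HasSeparators, not_forall] at hx
    obtain ⟨u, v, huv, h1, h2⟩ := hx
    exact Set.mem_iUnion.2 ⟨(u, v), huv, h1, (not_le.1 h2).le⟩
  have he : (n : ℝ) * n * Real.exp (-3 * Real.log n) = 1 / n := by
    rw [← exp_neg_two_log (by omega : 3 ≤ n),
      show (-3 : ℝ) * Real.log n = -Real.log n + -2 * Real.log n by ring, Real.exp_add,
      Real.exp_neg, Real.exp_log hn0]
    field_simp
  refine (measure_mono hsub).trans ?_
  rw [← he]
  exact pointsLaw_iUnion_le (Real.exp_pos _).le (by simp) fun p =>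
    pointsLaw_fewSeparators_le hr hn p.1 p.2

end RandomGeometric

/-! ### Sums over pairs of points, and random separating sets -/

namespace IIDPoints

open Finset

variable {Ω : Type*}

/-- Weight of the pairs formed by the point `v` and the earlier points in `D`, truncated at `1`,
and set to `0` when there are more than `M` such earlier points. -/
noncomputable def pairCost {n : ℕ} (D : Set Ω) (K : Ω → Ω → ℝ) (M : ℝ) (v : Fin n)
    (x : Fin n → Ω) : ℝ :=
  if (Nat.card {u : Fin n // u < v ∧ x u ∈ D} : ℝ) ≤ M then
    min 1 (∑ u with u < v, D.indicator 1 (x u) * K (x u) (x v)) else 0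

theorem pairCost_nonneg {n : ℕ} {D : Set Ω} {K : Ω → Ω → ℝ} (hK : ∀ a b, 0 ≤ K a b) (M : ℝ)
    (v : Fin n) (x : Fin n → Ω) : 0 ≤ pairCost D K M v x := by
  unfold pairCost
  split_ifs
  · refine le_min zero_le_one (sum_nonneg fun u _ => mul_nonneg ?_ (hK _ _))
    exact Set.indicator_nonneg (fun _ _ => zero_le_one) _
  · exact le_rfl

theorem pairCost_le_one {n : ℕ} {D : Set Ω} {K : Ω → Ω → ℝ} (M : ℝ)
    (v : Fin n) (x : Fin n → Ω) : pairCost D K M v x ≤ 1 := by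
  unfold pairCost
  split_ifs
  · exact min_le_left _ _
  · exact zero_le_one

variable [MeasurableSpace Ω]

theorem measurable_pairCost {n : ℕ} {D : Set Ω} (hD : MeasurableSet D) {K : Ω → Ω → ℝ}
    (hK : Measurable (Function.uncurry K)) (M : ℝ) (v : Fin n) :
    Measurable (pairCost D K M v) := by
  unfold pairCost
  refine Measurable.ite (measurableSet_le ?_ measurable_const) (measurable_const.min ?_)
    measurable_const
  · have h : ∀ u : Fin n, MeasurableSet {x : Fin n → Ω | x u ∈ D} := fun u =>
      measurable_pi_apply u hD
    exact RandomGeometric.measurable_card_subtype fun u => (MeasurableSet.const _).and (h u)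
  · refine Finset.measurable_fun_sum _ fun u _ => Measurable.mul ?_ ?_
    · exact (measurable_one.indicator hD).comp (measurable_pi_apply u)
    · exact Measurable.comp (g := Function.uncurry K) (f := fun x : Fin n → Ω => (x u, x v)) hK
        ((measurable_pi_apply u).prodMk (measurable_pi_apply v))

/-- The points are revealed in order. Given the past, at most `M` earlier points contribute to the
cost of `v`, each at most `κ` on average. Truncation at 1 permits `exp t ≤ 1 + 2t`, and the factors
`1 + 2 cost` have conditional mean at most `exp(2Mκ)`. Markov's inequality for their product gives
the bound. -/
theorem measure_sum_pairCost_ge_le (μ : Measure Ω) [IsProbabilityMeasure μ] {n : ℕ} {D : Set Ω}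
    (hD : MeasurableSet D) {K : Ω → Ω → ℝ} (hK : Measurable (Function.uncurry K))
    (hK0 : ∀ a b, 0 ≤ K a b) {M κ : ℝ} (hM : 0 ≤ M) (hκ : 0 ≤ κ)
    (hmeans : ∀ a, ∫⁻ b, ENNReal.ofReal (K a b) ∂μ ≤ ENNReal.ofReal κ) (t : ℝ) :
    Measure.pi (fun _ : Fin n => μ) {x | t ≤ ∑ v, pairCost D K M v x} ≤
      ENNReal.ofReal (Real.exp (2 * n * M * κ - t)) := by
  classical
  let f : Fin n → (Fin n → Ω) → ENNReal := fun v x => ENNReal.ofReal (1 + 2 * pairCost D K M v x)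
  have hf : ∀ v, Measurable (f v) := fun v =>
    ENNReal.measurable_ofReal.comp (((measurable_pairCost hD hK M v).const_mul 2).const_add 1)
  have hdep : ∀ v w, v < w → ∀ x y, f v (Function.update x w y) = f v x := by
    intro v w hvw x y
    have h1 : ∀ u ≤ v, Function.update x w y u = x u := fun u hu =>
      Function.update_of_ne (ne_of_lt (hu.trans_lt hvw)) _ _
    simp only [f, pairCost, h1 v le_rfl]
    have h2 : ∀ u, (u < v ∧ Function.update x w y u ∈ D) ↔ (u < v ∧ x u ∈ D) := fun u =>
      and_congr_right fun hu => by rw [h1 u hu.le]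
    have h3 : ∑ u with u < v, D.indicator 1 (Function.update x w y u) *
        K (Function.update x w y u) (x v) = ∑ u with u < v, D.indicator 1 (x u) * K (x u) (x v) :=
      sum_congr rfl fun u hu => by rw [h1 u (mem_filter.1 hu).2.le]
    simp_rw [h2]
    rw [h3]
  have hintf : ∀ v x, ∫⁻ y, f v (Function.update x v y) ∂μ ≤
      ENNReal.ofReal (Real.exp (2 * M * κ)) := by
    intro v x
    have h1 : ∀ y, ∀ u < v, Function.update x v y u = x u := fun y u hu =>
      Function.update_of_ne hu.ne _ _
    have h2 : ∀ y u, (u < v ∧ Function.update x v y u ∈ D) ↔ (u < v ∧ x u ∈ D) := fun y u =>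
      and_congr_right fun hu => by rw [h1 y u hu]
    have h3 : ∀ y, ∑ u with u < v, D.indicator 1 (Function.update x v y u) *
        K (Function.update x v y u) y = ∑ u with u < v ∧ x u ∈ D, K (x u) y := by
      intro y
      rw [filter_and, ← filter_and, ← filter_filter, sum_filter (p := fun u => x u ∈ D)]
      refine sum_congr rfl fun u hu => ?_
      rw [h1 y u (mem_filter.1 hu).2]
      by_cases h : x u ∈ D <;> simp [h]
    by_cases hc : (Nat.card {u : Fin n // u < v ∧ x u ∈ D} : ℝ) ≤ M
    · have hcard : (#(univ.filter fun u : Fin n => u < v ∧ x u ∈ D) : ℝ) ≤ M := by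
        rwa [Nat.subtype_card (univ.filter fun u : Fin n => u < v ∧ x u ∈ D)
          fun u => by simp] at hc
      calc ∫⁻ y, f v (Function.update x v y) ∂μ
          ≤ ∫⁻ y, (1 + ENNReal.ofReal 2 * ∑ u with u < v ∧ x u ∈ D,
              ENNReal.ofReal (K (x u) y)) ∂μ := by
            refine lintegral_mono fun y => ?_
            simp only [f, pairCost, Function.update_self]
            simp_rw [h2, h3]
            rw [if_pos hc, ← ENNReal.ofReal_sum_of_nonneg fun u _ => hK0 _ _,
              ← ENNReal.ofReal_mul (by norm_num), ← ENNReal.ofReal_one,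
              ← ENNReal.ofReal_add (by norm_num)
                (mul_nonneg (by norm_num) (sum_nonneg fun u _ => hK0 _ _))]
            refine ENNReal.ofReal_le_ofReal ?_
            linarith [min_le_right (1 : ℝ) (∑ u with u < v ∧ x u ∈ D, K (x u) y)]
        _ = 1 + ENNReal.ofReal 2 * ∑ u with u < v ∧ x u ∈ D,
              ∫⁻ y, ENNReal.ofReal (K (x u) y) ∂μ := by
            have hm : ∀ u, Measurable fun y => ENNReal.ofReal (K (x u) y) := fun u =>
              ENNReal.measurable_ofReal.comp (hK.comp measurable_prodMk_left)
            rw [lintegral_add_left measurable_const, lintegral_const, measure_univ, mul_one,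
              lintegral_const_mul' _ _ ENNReal.ofReal_ne_top,
              lintegral_finsetSum _ fun u _ => hm u]
        _ ≤ 1 + ENNReal.ofReal 2 * ∑ u with u < v ∧ x u ∈ D, ENNReal.ofReal κ := by
            gcongr with u _
            exact hmeans _
        _ = ENNReal.ofReal (1 + 2 * (#(univ.filter fun u : Fin n => u < v ∧ x u ∈ D) * κ)) := by
            rw [sum_const, nsmul_eq_mul, ← ENNReal.ofReal_natCast,
              ← ENNReal.ofReal_mul (Nat.cast_nonneg _), ← ENNReal.ofReal_mul (by norm_num),
              ← ENNReal.ofReal_one, ← ENNReal.ofReal_add (by norm_num) (by positivity)]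
        _ ≤ ENNReal.ofReal (Real.exp (2 * M * κ)) := by
            refine ENNReal.ofReal_le_ofReal ?_
            have := Real.add_one_le_exp (2 * M * κ)
            nlinarith
    · calc ∫⁻ y, f v (Function.update x v y) ∂μ = ∫⁻ _, 1 ∂μ := by
            refine lintegral_congr fun y => ?_
            simp only [f, pairCost, Function.update_self]
            simp_rw [h2]
            rw [if_neg hc]; simp
        _ ≤ _ := by
            rw [lintegral_const, measure_univ, mul_one, ← ENNReal.ofReal_one]
            exact ENNReal.ofReal_le_ofReal (Real.one_le_exp (by positivity))
  have hprod := lintegral_prod_le_pow μ hf hdep hintf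
  have hmeas : Measurable fun x => ∏ v, f v x := Finset.measurable_fun_prod _ fun v _ => hf v
  have hmarkov := meas_ge_le_lintegral_div (μ := Measure.pi fun _ : Fin n => μ) hmeas.aemeasurable
    (ε := ENNReal.ofReal (Real.exp t)) (by simp [Real.exp_pos]) ENNReal.ofReal_ne_top
  refine (measure_mono fun x hx => ?_).trans (hmarkov.trans ?_)
  · simp only [Set.mem_ofPred_eq, f]
    rw [← ENNReal.ofReal_prod_of_nonneg fun v _ => by linarith [pairCost_nonneg (D := D) hK0 M v x]]
    refine ENNReal.ofReal_le_ofReal ?_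
    calc Real.exp t ≤ Real.exp (∑ v, pairCost D K M v x) := Real.exp_le_exp.2 hx
      _ = ∏ v, Real.exp (pairCost D K M v x) := Real.exp_sum _ _
      _ ≤ _ := by
        refine prod_le_prod (fun v _ => (Real.exp_pos _).le) fun v _ => ?_
        have h0 := pairCost_nonneg hK0 M v x (D := D)
        have h1 := pairCost_le_one M v x (D := D) (K := K)
        have hb := Real.abs_exp_sub_one_sub_id_le (x := pairCost D K M v x)
          (by rwa [abs_of_nonneg h0])
        have := (abs_le.1 hb).2
        nlinarith
  · calc _ ≤ ENNReal.ofReal (Real.exp (2 * M * κ)) ^ n / ENNReal.ofReal (Real.exp t) := by gcongr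
      _ = _ := by
        rw [sub_eq_add_neg, Real.exp_add, show 2 * (n : ℝ) * M * κ = n * (2 * M * κ) by ring,
          Real.exp_nat_mul, ENNReal.ofReal_mul (by positivity), Real.exp_neg,
          ENNReal.ofReal_inv_of_pos (Real.exp_pos _), ENNReal.ofReal_pow (Real.exp_pos _).le,
          div_eq_mul_inv]

end IIDPoints

/-- Choosing `k` elements of `R` at random separates most pairs of `W`; the remaining pairs
are separated by adding one element of each. -/
theorem exists_separating_finset {V : Type*} [LinearOrder V] {R W : Finset V}
    (hR : R.Nonempty) (sep : V → V → V → Prop) {K : V → V → ℝ} {k : ℕ}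
    {b : ℝ}
    (h : ∀ u ∈ W, ∀ v ∈ W, u < v → (Nat.card {s // s ∈ R ∧ ¬ sep s u v} / R.card : ℝ) ^ k ≤ K u v)
    (hb : ∑ v ∈ W, min 1 (∑ u ∈ W with u < v, K u v) ≤ b) :
    ∃ S : Finset V, (S.card : ℝ) ≤ k + b ∧
      ∀ u ∈ W, ∀ v ∈ W, u < v → v ∈ S ∨ ∃ s ∈ S, sep s u v := by
  classical
  let F : Finset (Fin k → V) := Fintype.piFinset fun _ => R
  have hFc : (F.card : ℝ) = (R.card : ℝ) ^ k := by
    simp only [F, Fintype.card_piFinset_const]; push_cast; rfl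
  have hR0 : (0 : ℝ) < R.card := by exact_mod_cast hR.card_pos
  have hF0 : (0 : ℝ) < F.card := by rw [hFc]; positivity
  -- For a tuple `f` of sensors, the later elements of the pairs that `f` does not separate; each of
  -- them will receive a sensor of its own.
  let bad : (Fin k → V) → Finset V := fun f =>
    W.filter fun v => ∃ u ∈ W, u < v ∧ ∀ i, ¬ sep (f i) u v
  -- Over a uniformly random tuple in `R^k`, a union bound over `u` estimates the probability that
  -- `v` is bad; some tuple is then at least as good as the average.
  have hv : ∀ v ∈ W, ((F.filter fun f => v ∈ bad f).card : ℝ) ≤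
      F.card * min 1 (∑ u ∈ W with u < v, K u v) := by
    intro v hvW
    rw [mul_min_of_nonneg _ _ hF0.le]
    refine le_min ?_ ?_
    · rw [mul_one]; exact_mod_cast Finset.card_filter_le _ _
    · have hsub : F.filter (fun f => v ∈ bad f) ⊆ (W.filter fun u => u < v).biUnion fun u =>
          Fintype.piFinset fun _ : Fin k => R.filter fun s => ¬ sep s u v := by
        intro f hf
        simp only [Finset.mem_filter, bad, F, Fintype.mem_piFinset] at hf
        obtain ⟨hf1, -, u, hu, huv, hns⟩ := hf
        simp only [Finset.mem_biUnion, Finset.mem_filter, Fintype.mem_piFinset]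
        exact ⟨u, ⟨hu, huv⟩, fun i => ⟨hf1 i, hns i⟩⟩
      calc ((F.filter fun f => v ∈ bad f).card : ℝ)
          ≤ ∑ u ∈ W with u < v, ((Fintype.piFinset fun _ : Fin k =>
              R.filter fun s => ¬ sep s u v).card : ℝ) := by
            exact_mod_cast (Finset.card_le_card hsub).trans Finset.card_biUnion_le
        _ ≤ ∑ u ∈ W with u < v, F.card * K u v := by
            refine Finset.sum_le_sum fun u hu => ?_
            rw [Finset.mem_filter] at hu
            have h1 := h u hu.1 v hvW hu.2
            rw [Nat.subtype_card (R.filter fun s => ¬ sep s u v) (fun s => by simp), div_pow,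
              div_le_iff₀ (by positivity), ← hFc] at h1
            rw [Fintype.card_piFinset_const]
            push_cast
            linarith
        _ = _ := by rw [Finset.mul_sum]
  have hsum : ∑ f ∈ F, ((bad f).card : ℝ) ≤ ∑ f ∈ F, b := by
    calc ∑ f ∈ F, ((bad f).card : ℝ)
        = ∑ f ∈ F, ∑ v ∈ W, if v ∈ bad f then (1 : ℝ) else 0 := by
          refine Finset.sum_congr rfl fun f _ => ?_
          rw [Finset.sum_boole]
          congr 2
          ext v; simp [bad]
      _ = ∑ v ∈ W, ((F.filter fun f => v ∈ bad f).card : ℝ) := by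
          rw [Finset.sum_comm]
          exact Finset.sum_congr rfl fun v _ => Finset.sum_boole _ _
      _ ≤ ∑ v ∈ W, F.card * min 1 (∑ u ∈ W with u < v, K u v) := Finset.sum_le_sum hv
      _ ≤ F.card * b := by rw [← Finset.mul_sum]; gcongr
      _ = _ := by rw [Finset.sum_const, nsmul_eq_mul]
  have hFne : F.Nonempty := Finset.card_pos.1 (by exact_mod_cast hF0)
  obtain ⟨f, -, hf⟩ := Finset.exists_le_of_sum_le hFne hsum
  refine ⟨Finset.univ.image f ∪ bad f, ?_, fun u hu v hv huv => ?_⟩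
  · have h1 : (Finset.univ.image f ∪ bad f).card ≤ k + (bad f).card :=
      (Finset.card_union_le _ _).trans (by
        gcongr; exact Finset.card_image_le.trans (by simp))
    have h2 : ((Finset.univ.image f ∪ bad f).card : ℝ) ≤ k + (bad f).card := by exact_mod_cast h1
    linarith
  · by_cases hc : ∀ i, ¬ sep (f i) u v
    · exact Or.inl (Finset.mem_union_right _ (Finset.mem_filter.2 ⟨hv, u, hu, huv, hc⟩))
    · push Not at hc
      obtain ⟨i, hi⟩ := hc
      exact Or.inr
        ⟨f i, Finset.mem_union_left _ (Finset.mem_image_of_mem f (Finset.mem_univ i)), hi⟩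

/-! ### Upper bound by random sensors -/

namespace RandomGeometric

/-- The order of the number of sensors used for large radii. -/
noncomputable def sensorScale (n : ℕ) (r : ℝ) : ℝ := max (r ^ (4 / 3 : ℝ)) (Real.log n ^ 2)

/-- An upper bound for the probability that random sensors do not separate two points. -/
noncomputable def missKernel (n : ℕ) (r : ℝ) (a b : ℝ × ℝ) : ℝ :=
  3 * Real.exp (-(r / (128 * Real.log n)) * torusDist (√n) a b) +
    Real.exp (-(⌈sensorScale n r⌉₊ / (614656 * r)) * torusDist (√n) a b)

theorem missKernel_nonneg (n : ℕ) (r : ℝ) (a b : ℝ × ℝ) : 0 ≤ missKernel n r a b := by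
  unfold missKernel; positivity

theorem measurable_missKernel (n : ℕ) (r : ℝ) : Measurable (Function.uncurry (missKernel n r)) := by
  have h := measurable_torusDist (√n)
  exact ((Real.measurable_exp.comp (h.const_mul _)).const_mul 3).add
    (Real.measurable_exp.comp (h.const_mul _))

theorem sensorScale_bounds {n : ℕ} {r : ℝ} (h : Admissible n r) (hn : 3 ≤ n) :
    1 ≤ sensorScale n r ∧ Real.log n ≤ sensorScale n r ∧ Real.log n ^ 2 ≤ sensorScale n r ∧
      r ^ 4 ≤ sensorScale n r ^ 3 := by
  have hl := one_le_log hn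
  have hr0 := h.pos hn
  have h1 : Real.log n ^ 2 ≤ sensorScale n r := le_max_right _ _
  refine ⟨by nlinarith, by nlinarith, h1, ?_⟩
  have h2 : r ^ (4 / 3 : ℝ) ≤ sensorScale n r := le_max_left _ _
  calc r ^ 4 = (r ^ (4 / 3 : ℝ)) ^ 3 := by
        rw [← Real.rpow_natCast (r ^ (4 / 3 : ℝ)), ← Real.rpow_mul hr0.le, ← Real.rpow_natCast]
        norm_num
    _ ≤ _ := pow_le_pow_left₀ (by positivity) h2 3

/-- The two exponentials integrate to orders `(log n / r)² / n` and `(r/k)² / n`. Since `k³ ≥ r⁴`,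
the latter is at most `k / (r² n)` in order: this balance is the origin of the exponent `4/3`.
Summed over the `O(r²)` points of a ball, the two terms become `log² n` and `sensorScale`. -/
theorem lintegral_missKernel_le {n : ℕ} {r : ℝ} (h : Admissible n r) (hn : 3 ≤ n)
    (a : ℝ × ℝ) :
    ∫⁻ b, ENNReal.ofReal (missKernel n r a b) ∂(unifLaw n) ≤
      ENNReal.ofReal ((48 * 16384 * Real.log n ^ 2 / r ^ 2 +
        16 * 614656 ^ 2 * sensorScale n r / r ^ 2) / n) := by
  have : NeZero n := ⟨by omega⟩
  have hr0 := h.pos hn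
  have hl := one_le_log hn
  have hn0 : (0 : ℝ) < n := by positivity
  obtain ⟨hs1, hs2, hs3, hs4⟩ := sensorScale_bounds h hn
  have hk : sensorScale n r ≤ ⌈sensorScale n r⌉₊ := Nat.le_ceil _
  set k : ℝ := (⌈sensorScale n r⌉₊ : ℝ)
  have hk0 : 0 < k := by linarith
  have hm : ∀ c : ℝ, Measurable fun b => ENNReal.ofReal (Real.exp (-c * torusDist (√n) a b)) :=
    fun c => ENNReal.measurable_ofReal.comp
      (Real.measurable_exp.comp ((measurable_torusDist_left _ a).const_mul _))
  calc ∫⁻ b, ENNReal.ofReal (missKernel n r a b) ∂(unifLaw n)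
      = ENNReal.ofReal 3 * ∫⁻ b, ENNReal.ofReal
          (Real.exp (-(r / (128 * Real.log n)) * torusDist (√n) a b)) ∂(unifLaw n) +
        ∫⁻ b, ENNReal.ofReal (Real.exp (-(k / (614656 * r)) * torusDist (√n) a b))
          ∂(unifLaw n) := by
        rw [← lintegral_const_mul' _ _ ENNReal.ofReal_ne_top,
          ← lintegral_add_right _ (hm _)]
        refine lintegral_congr fun b => ?_
        rw [missKernel, ENNReal.ofReal_add (by positivity) (by positivity),
          ENNReal.ofReal_mul (by norm_num)]
    _ ≤ ENNReal.ofReal 3 * ENNReal.ofReal (16 / ((r / (128 * Real.log n)) ^ 2 * n)) +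
        ENNReal.ofReal (16 / ((k / (614656 * r)) ^ 2 * n)) := by
        gcongr
        · exact lintegral_exp_neg_torusDist_le n (by positivity) a
        · exact lintegral_exp_neg_torusDist_le n (by positivity) a
    _ ≤ _ := by
        rw [← ENNReal.ofReal_mul (by norm_num), ← ENNReal.ofReal_add (by positivity)
          (by positivity)]
        refine ENNReal.ofReal_le_ofReal ?_
        rw [add_div]
        refine add_le_add (le_of_eq (by field_simp; norm_num)) ?_
        have e : 16 / ((k / (614656 * r)) ^ 2 * n) =
            (16 * 614656 ^ 2 * (r ^ 4 / k ^ 2) / r ^ 2) / n := by field_simp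
        rw [e]
        have : r ^ 4 / k ^ 2 ≤ sensorScale n r := by
          rw [div_le_iff₀ (by positivity)]
          refine hs4.trans ?_
          rw [pow_succ']
          gcongr
        gcongr

/-- A numerical constant for the upper bound. -/
def sensorConst : ℝ := 4802 * (48 * 16384 + 16 * 614656 ^ 2)

/-- Around every grid point, most pairs of vertices are separated by random sensors. -/
def HasFewMisses {n : ℕ} (r : ℝ) (x : Fin n → ℝ × ℝ) : Prop :=
  ∀ c, ∑ v, IIDPoints.pairCost {y | torusDist (√n) (gridPoint n r c) y ≤ 5 * r}
    (missKernel n r) (2401 * r ^ 2) v x ≤ (sensorConst + 2) * sensorScale n r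

/-- The exponential bound for sums of `pairCost` applies with mean term at most `sensorConst *
sensorScale`, as `4802 = 2 · 2401`. The excess `2 * sensorScale ≥ 2 log n` gives probability
`n^(-2)` per grid point. -/
theorem negligible_not_hasFewMisses :
    Negligible Admissible fun _ r => {x | ¬ HasFewMisses r x} := by
  refine negligible_of_le tendsto_one_div_natCast ?_
  filter_upwards [eventually_ge_atTop 3] with n hn r hr
  have : NeZero n := ⟨by omega⟩
  obtain ⟨hM, hMn, -, -, -⟩ := grid_bounds hr hn
  have hr0 := hr.pos hn
  have hn0 : (0 : ℝ) < n := by positivity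
  obtain ⟨hs1, hs2, hs3, hs4⟩ := sensorScale_bounds hr hn
  have hsub : {x : Fin n → ℝ × ℝ | ¬ HasFewMisses r x} ⊆
      ⋃ c, {x | (sensorConst + 2) * sensorScale n r ≤
        ∑ v, IIDPoints.pairCost {y | torusDist (√n) (gridPoint n r c) y ≤ 5 * r}
          (missKernel n r) (2401 * r ^ 2) v x} := by
    intro x hx
    simp only [Set.mem_ofPred_eq, HasFewMisses, not_forall] at hx
    obtain ⟨c, hc⟩ := hx
    exact Set.mem_iUnion.2 ⟨c, (not_le.1 hc).le⟩
  refine (measure_mono hsub).trans ?_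
  rw [← exp_neg_two_log hn]
  refine pointsLaw_iUnion_le (Real.exp_pos _).le (by simpa [sq] using hMn) fun c => ?_
  refine (IIDPoints.measure_sum_pairCost_ge_le (unifLaw n)
    (measurableSet_le (measurable_torusDist_left _ _) measurable_const)
    (measurable_missKernel n r) (missKernel_nonneg n r) (by positivity) (by positivity)
    (lintegral_missKernel_le hr hn) _).trans ?_
  refine ENNReal.ofReal_le_ofReal (Real.exp_le_exp.2 ?_)
  have e : 2 * (n : ℝ) * (2401 * r ^ 2) * ((48 * 16384 * Real.log n ^ 2 / r ^ 2 +
      16 * 614656 ^ 2 * sensorScale n r / r ^ 2) / n) =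
      4802 * (48 * 16384 * Real.log n ^ 2 + 16 * 614656 ^ 2 * sensorScale n r) := by
    field_simp; norm_num
  rw [e, sensorConst]
  nlinarith

theorem localizationNumber_le_sensorScale {n : ℕ} {r : ℝ} {x : Fin n → ℝ × ℝ}
    (hr : Admissible n r) (hn : 3 ≤ n) (hd : IsDense r x) (hb : HasBoundedBalls r x)
    (hsep : HasSeparators r x) (hmiss : HasFewMisses r x) :
    (LocalizationGame.localizationNumber (torusGraph r x) : ℝ) ≤
      (sensorConst + 4) * sensorScale n r := by
  classical
  have hr0 := hr.pos hn
  have hlog := one_le_log hn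
  obtain ⟨hs1, hs2, hs3, hs4⟩ := sensorScale_bounds hr hn
  have hC : 441 ≤ sensorConst := by norm_num [sensorConst]
  have hk : LocalizationGame.localizationNumber (torusGraph r x) ≤
      ⌊(sensorConst + 4) * sensorScale n r⌋₊ := by
    refine localizationNumber_le_of_dense (by omega) hr0 hd ?_ fun v₀ => ?_
    · refine Nat.le_floor ?_; push_cast; nlinarith
    obtain ⟨c, hc⟩ := exists_gridPoint hr hn (x v₀)
    set p := gridPoint n r c
    -- Sensors are drawn from `R`. The vertices to be resolved lie in `W`, as `3r + r = 4r`, and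
    -- every vertex within `r` of `W` belongs to `R`, so no separator is lost.
    let R : Finset (Fin n) := Finset.univ.filter fun w => torusDist (√n) p (x w) ≤ 5 * r
    let W : Finset (Fin n) := Finset.univ.filter fun w => torusDist (√n) p (x w) ≤ 4 * r
    have hW : ∀ u, u ∈ W ↔ torusDist (√n) p (x u) ≤ 4 * r := fun u => by simp [W]
    have hRmem : ∀ u, u ∈ R ↔ torusDist (√n) p (x u) ≤ 5 * r := fun u => by simp [R]
    have hR : R.Nonempty := ⟨v₀, (hRmem _).2 (by linarith)⟩
    have hR0 : (0 : ℝ) < R.card := by exact_mod_cast hR.card_pos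
    have hRc : (R.card : ℝ) ≤ 2401 * r ^ 2 := by
      have := hb c
      rwa [Nat.subtype_card R hRmem] at this
    let sep : Fin n → Fin n → Fin n → Prop := fun s u v =>
      ¬ (torusDist (√n) (x s) (x u) ≤ r ↔ torusDist (√n) (x s) (x v) ≤ r)
    have hex : ∃ S : Finset (Fin n), (S.card : ℝ) ≤ (⌈sensorScale n r⌉₊ : ℕ) +
        (sensorConst + 2) * sensorScale n r ∧
        ∀ u ∈ W, ∀ v ∈ W, u < v → v ∈ S ∨ ∃ s ∈ S, sep s u v := by
      refine exists_separating_finset (W := W) hR sep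
        (K := fun u v => missKernel n r (x u) (x v)) ?_ ?_
      · intro u hu v hv huv
        rw [hW] at hu hv
        set δ := torusDist (√n) (x u) (x v) with hδ
        have hδ0 : 0 ≤ δ := torusDist_nonneg _ _ _
        have hδ8 : δ ≤ 8 * r := by
          have := torusDist_triangle (√n) (x u) p (x v)
          rw [torusDist_comm _ (x u) p] at this
          linarith
        have hcompl : (Nat.card {s // s ∈ R ∧ ¬ sep s u v} : ℝ) +
            (R.filter fun s => sep s u v).card = R.card := by
          rw [Nat.subtype_card (R.filter fun s => ¬ sep s u v) (fun s => by simp), add_comm]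
          exact_mod_cast Finset.card_filter_add_card_filter_not _
        by_cases hfar : 128 * Real.log n / r ≤ δ
        · have h1 := hsep u v huv.ne hfar
          rw [← hδ] at h1
          have h2 : (Nat.card {w // torusDist (√n) (x w) (x u) ≤ r ∧
              r < torusDist (√n) (x w) (x v)} : ℝ) ≤ (R.filter fun s => sep s u v).card := by
            rw [Nat.subtype_card (Finset.univ.filter fun w => torusDist (√n) (x w) (x u) ≤ r ∧
              r < torusDist (√n) (x w) (x v)) (fun s => by simp)]
            refine Nat.cast_le.2 (Finset.card_le_card fun w hw => ?_)
            simp only [Finset.mem_filter, Finset.mem_univ, true_and] at hw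
            rw [Finset.mem_filter, hRmem]
            refine ⟨?_, fun h => absurd (h.1 hw.1) (not_le.2 hw.2)⟩
            have := torusDist_triangle (√n) p (x u) (x w)
            rw [torusDist_comm _ (x u) (x w)] at this
            linarith [hw.1]
          have h3 : δ / 8 ≤ min δ r := le_min (by linarith) (by linarith)
          -- As `δ ≤ 8r`, at least `rδ/256` of the at most `2401 r²` candidates separate the pair, a
          -- proportion of at least `δ / (614656 r)`.
          have h4 : r * (δ / 8) / 32 ≤ (R.filter fun s => sep s u v).card := by
            refine le_trans ?_ (h1.trans h2)
            gcongr
          have h5 : (Nat.card {s // s ∈ R ∧ ¬ sep s u v} / R.card : ℝ) ≤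
              Real.exp (-(δ / (614656 * r))) := by
            have h6 : (Nat.card {s // s ∈ R ∧ ¬ sep s u v} / R.card : ℝ) ≤
                1 - δ / (614656 * r) := by
              rw [div_le_iff₀ hR0]
              have h7 : δ / (614656 * r) * R.card ≤ r * (δ / 8) / 32 := by
                calc δ / (614656 * r) * R.card ≤ δ / (614656 * r) * (2401 * r ^ 2) := by gcongr
                  _ = _ := by field_simp; ring
              nlinarith
            linarith [Real.add_one_le_exp (-(δ / (614656 * r)))]
          calc _ ≤ Real.exp (-(δ / (614656 * r))) ^ ⌈sensorScale n r⌉₊ :=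
                pow_le_pow_left₀ (by positivity) h5 _
            _ = Real.exp (-(⌈sensorScale n r⌉₊ / (614656 * r)) * δ) := by
                rw [← Real.exp_nat_mul]; congr 1; ring
            _ ≤ _ := by
                rw [missKernel, ← hδ]
                linarith [Real.exp_pos (-(r / (128 * Real.log n)) * δ)]
        -- For close pairs there is no control of the separators; the trivial bound 1 is below `3
        -- exp(-1)`, which explains the factor 3 in `missKernel`.
        · have h1 : (Nat.card {s // s ∈ R ∧ ¬ sep s u v} / R.card : ℝ) ≤ 1 := by
            rw [div_le_one hR0, ← hcompl]; simp
          refine (pow_le_one₀ (by positivity) h1).trans ?_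
          rw [missKernel, ← hδ]
          have h2 : Real.exp (-1) ≤ Real.exp (-(r / (128 * Real.log n)) * δ) := by
            refine Real.exp_le_exp.2 ?_
            have : r / (128 * Real.log n) * δ ≤ 1 := by
              rw [not_le, lt_div_iff₀ hr0] at hfar
              rw [div_mul_eq_mul_div, div_le_one (by positivity)]
              linarith
            linarith
          have := Real.exp_neg_one_gt_d9
          linarith [Real.exp_pos (-(⌈sensorScale n r⌉₊ / (614656 * r)) * δ)]
      · refine le_trans ?_ (hmiss c)
        calc _ ≤ ∑ v ∈ W, IIDPoints.pairCost {y | torusDist (√n) p y ≤ 5 * r}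
              (missKernel n r) (2401 * r ^ 2) v x := by
              refine Finset.sum_le_sum fun v _ => ?_
              -- The bound on the number of vertices in the ball meets the guard in `pairCost`;
              -- extending the inner sum beyond `W` adds nonnegative terms.
              rw [IIDPoints.pairCost, if_pos]
              · refine min_le_min le_rfl ?_
                rw [← Finset.sum_filter_add_sum_filter_not (Finset.univ.filter fun u => u < v)
                  (fun u => u ∈ W)]
                refine le_trans (le_of_eq ?_) (le_add_of_nonneg_right ?_)
                · rw [Finset.filter_filter]
                  refine Finset.sum_congr (by ext; simp [W, and_comm]) fun u hu => ?_
                  rw [Finset.mem_filter] at hu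
                  have : x u ∈ {y | torusDist (√n) p y ≤ 5 * r} := by
                    rw [Set.mem_ofPred_eq]; linarith [(hW u).1 hu.2]
                  rw [Set.indicator_of_mem this, Pi.one_apply, one_mul]
                · refine Finset.sum_nonneg fun u _ => mul_nonneg ?_ (missKernel_nonneg _ _ _ _)
                  exact Set.indicator_nonneg (fun _ _ => zero_le_one) _
              · refine le_trans ?_ hRc
                rw [← Nat.subtype_card R hRmem]
                exact Nat.cast_le.2 (Nat.card_le_card_of_injective
                  (fun u => (⟨u.1, u.2.2⟩ : {w // torusDist (√n) p (x w) ≤ 5 * r}))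
                  fun u u' h => by
                    simp only [Subtype.mk.injEq] at h
                    exact Subtype.ext h)
          _ ≤ _ := Finset.sum_le_sum_of_subset_of_nonneg (Finset.subset_univ _) fun v _ _ =>
              IIDPoints.pairCost_nonneg (missKernel_nonneg n r) _ _ _
    obtain ⟨S, hS, hSsep⟩ := hex
    refine ⟨S, ?_, fun u w hu hw hs => ?_⟩
    · refine Nat.le_floor (hS.trans ?_)
      have := Nat.ceil_lt_add_one (a := sensorScale n r) (by linarith)
      linarith
    · have huW : u ∈ W := (hW u).2 (by linarith [torusDist_triangle (√n) p (x v₀) (x u)])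
      have hwW : w ∈ W := (hW w).2 (by linarith [torusDist_triangle (√n) p (x v₀) (x w)])
      have key : ∀ u ∈ W, ∀ w ∈ W, u < w → (∀ s ∈ S, (torusGraph r x).edist s u =
          (torusGraph r x).edist s w) → False := by
        intro u hu w hw huw hs
        rcases hSsep u hu w hw huw with h | ⟨s, hsS, hsep⟩
        · have := hs w h
          rw [SimpleGraph.edist_self] at this
          exact huw.ne (SimpleGraph.edist_eq_zero_iff.1 this).symm
        · refine hsep ?_
          rw [← edist_le_one_iff hr0.le, ← edist_le_one_iff hr0.le, hs s hsS]
      rcases lt_trichotomy u w with h | h | h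
      · exact (key u huW w hwW h hs).elim
      · exact h
      · exact (key w hwW u huW h fun s hsS => (hs s hsS).symm).elim
  exact (Nat.cast_le.2 hk).trans (Nat.floor_le (by nlinarith))

end RandomGeometric

/-! ### A union of large discs cuts few cells of a small square -/

namespace RandomGeometric

/-- The cell with index `c` in the subdivision with mesh `d` of a square with lower left
corner `(a, a)`. -/
def cell (a d : ℝ) {m : ℕ} (c : Fin m × Fin m) : Set (ℝ × ℝ) :=
  Set.Ico (a + c.1 * d) (a + (c.1 + 1) * d) ×ˢ Set.Ico (a + c.2 * d) (a + (c.2 + 1) * d)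

/-- The cells that meet both `U` and its complement. -/
noncomputable def cutCells (a d : ℝ) (m : ℕ) (U : Set (ℝ × ℝ)) : Finset (Fin m × Fin m) := by
  classical
  exact Finset.univ.filter fun c => ∃ p ∈ cell a d c, ∃ q ∈ cell a d c, p ∈ U ∧ q ∉ U

theorem mem_cutCells {a d : ℝ} {m : ℕ} {U : Set (ℝ × ℝ)} {c : Fin m × Fin m} :
    c ∈ cutCells a d m U ↔ ∃ p ∈ cell a d c, ∃ q ∈ cell a d c, p ∈ U ∧ q ∉ U := by
  simp [cutCells]

/-- The union of the closed Euclidean discs of radius `r` with centres in `W`. -/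
def discUnion (r : ℝ) (W : Set (ℝ × ℝ)) : Set (ℝ × ℝ) :=
  {p | ∃ w ∈ W, (w.1 - p.1) ^ 2 + (w.2 - p.2) ^ 2 ≤ r ^ 2}

theorem cell_bounds {a d h : ℝ} {m : ℕ} (hd : 0 < d) (hm : m * d = 2 * h) {c : Fin m × Fin m}
    {p : ℝ × ℝ} (hp : p ∈ cell a d c) :
    (a ≤ p.1 ∧ p.1 < a + 2 * h) ∧ a ≤ p.2 ∧ p.2 < a + 2 * h := by
  have key : ∀ (i : Fin m) {t : ℝ}, t ∈ Set.Ico (a + i * d) (a + (i + 1) * d) →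
      a ≤ t ∧ t < a + 2 * h := by
    intro i t ht
    have h1 : ((i : ℕ) : ℝ) + 1 ≤ m := by exact_mod_cast i.2
    have h2 : (0 : ℝ) ≤ (i : ℕ) * d := by positivity
    constructor
    · linarith [ht.1]
    · have := mul_le_mul_of_nonneg_right h1 hd.le
      linarith [ht.2]
  exact ⟨key _ hp.1, key _ hp.2⟩

theorem lt_of_mem_Ico_cell {a d t t' : ℝ} {i i' : ℕ} (hd : 0 < d)
    (ht : t ∈ Set.Ico (a + i * d) (a + (i + 1) * d))
    (ht' : t' ∈ Set.Ico (a + i' * d) (a + (i' + 1) * d)) {k : ℕ} (h : i + k + 1 ≤ i') :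
    t + k * d < t' := by
  have h1 : (i : ℝ) + k + 1 ≤ i' := by exact_mod_cast h
  have := mul_le_mul_of_nonneg_right h1 hd.le
  linarith [ht.2, ht'.1]

theorem card_le_of_injOn_key {m N : ℕ} {S : Finset (Fin m × Fin m)} {κ : Type*} [DecidableEq κ]
    (f : Fin m × Fin m → κ) {K : Finset κ} (hK : K.card ≤ N) (hf : ∀ c ∈ S, f c ∈ K)
    (hinj : ∀ c ∈ S, ∀ c' ∈ S, f c = f c' → c = c') : S.card ≤ N :=
  (Finset.card_le_card_of_injOn f hf fun c hc c' hc' h => hinj c hc c' hc' h).trans hK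

/-- Discs with centres to one side of the square in both coordinates. -/
theorem card_cutCells_quadrant {a d h r : ℝ} {m : ℕ} (hd : 0 < d) (hm : m * d = 2 * h)
    {σ τ : ℤ} (hσ : σ = 1 ∨ σ = -1) (hτ : τ = 1 ∨ τ = -1) {W : Set (ℝ × ℝ)}
    (hW : ∀ w ∈ W, h ≤ σ * (a + h - w.1) ∧ h ≤ τ * (a + h - w.2)) :
    (cutCells a d m (discUnion r W)).card ≤ 2 * m := by
  -- Moving towards the side of the centres in both coordinates brings a point closer to every
  -- centre, so it cannot leave the union.
  have mono : ∀ p q : ℝ × ℝ, p ∈ discUnion r W → (a ≤ q.1 ∧ q.1 < a + 2 * h) →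
      (a ≤ q.2 ∧ q.2 < a + 2 * h) → σ * q.1 ≤ σ * p.1 → τ * q.2 ≤ τ * p.2 →
      q ∈ discUnion r W := by
    rintro p q ⟨w, hw, hwp⟩ hq1 hq2 h1 h2
    obtain ⟨hw1, hw2⟩ := hW w hw
    refine ⟨w, hw, le_trans (add_le_add ?_ ?_) hwp⟩
    · rcases hσ with rfl | rfl <;> push_cast at * <;> nlinarith
    · rcases hτ with rfl | rfl <;> push_cast at * <;> nlinarith
  -- By monotonicity each diagonal of cells in this direction contains at most one cut cell: the
  -- nearer of two would lie entirely in the union. There are at most `2m` diagonals.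
  refine card_le_of_injOn_key (fun c => τ * (c.1 : ℤ) - σ * c.2)
    (K := Finset.Ioo (if σ = τ then -(m : ℤ) else if τ = 1 then -1 else -2 * m)
      (if σ = τ then (m : ℤ) else if τ = 1 then 2 * m else 1)) ?_ ?_ ?_
  · rw [Int.card_Ioo]
    rcases hσ with rfl | rfl <;> rcases hτ with rfl | rfl <;> simp <;> omega
  · intro c _
    have := c.1.2; have := c.2.2
    rw [Finset.mem_Ioo]
    rcases hσ with rfl | rfl <;> rcases hτ with rfl | rfl <;> simp <;> omega
  · have key : ∀ c ∈ cutCells a d m (discUnion r W), ∀ c' ∈ cutCells a d m (discUnion r W),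
        τ * (c.1 : ℤ) - σ * c.2 = τ * (c'.1 : ℤ) - σ * c'.2 → ¬ σ * (c.1 : ℤ) < σ * c'.1 := by
      intro c hc c' hc' hk hlt
      obtain ⟨-, -, q, hq, -, hqU⟩ := mem_cutCells.1 hc
      obtain ⟨p, hp, -, -, hpU, -⟩ := mem_cutCells.1 hc'
      obtain ⟨hq1, hq2⟩ := cell_bounds hd hm hq
      refine hqU (mono p q hpU hq1 hq2 ?_ ?_)
      · rcases hσ with rfl | rfl
        · have := lt_of_mem_Ico_cell hd hq.1 hp.1 (k := 0) (by omega)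
          push_cast at *; linarith
        · have := lt_of_mem_Ico_cell hd hp.1 hq.1 (k := 0) (by omega)
          push_cast at *; linarith
      · have hlt2 : τ * (c.2 : ℤ) < τ * c'.2 := by
          rcases hσ with rfl | rfl <;> rcases hτ with rfl | rfl <;> omega
        rcases hτ with rfl | rfl
        · have := lt_of_mem_Ico_cell hd hq.2 hp.2 (k := 0) (by omega)
          push_cast at *; linarith
        · have := lt_of_mem_Ico_cell hd hp.2 hq.2 (k := 0) (by omega)
          push_cast at *; linarith
    intro c hc c' hc' hk
    have h1 := key c hc c' hc' hk
    have h2 := key c' hc' c hc hk.symm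
    refine Prod.ext (Fin.ext ?_) (Fin.ext ?_) <;>
      rcases hσ with rfl | rfl <;> rcases hτ with rfl | rfl <;> omega

/-- Discs with centres far to one side of the square in the first coordinate and in the range of
the square in the second. -/
theorem card_cutCells_axis {a d h r : ℝ} {m : ℕ} (hd : 0 < d) (hm : m * d = 2 * h)
    {σ : ℤ} (hσ : σ = 1 ∨ σ = -1) {W : Set (ℝ × ℝ)}
    (hW : ∀ w ∈ W, 3 * h ≤ σ * (a + h - w.1) ∧ |w.2 - (a + h)| ≤ h) :
    (cutCells a d m (discUnion r W)).card ≤ 2 * m := by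
  -- Moving by `Δ` towards the centres lowers the first squared difference by at least `4hΔ`, since
  -- they stay at least `2h` away in that coordinate. A transversal shift of at most `Δ` raises the
  -- second by at most `4hΔ`. Membership thus persists in a cone.
  have mono : ∀ p q : ℝ × ℝ, p ∈ discUnion r W → (a ≤ q.1 ∧ q.1 < a + 2 * h) →
      (a ≤ q.2 ∧ q.2 < a + 2 * h) → (a ≤ p.1 ∧ p.1 < a + 2 * h) →
      (a ≤ p.2 ∧ p.2 < a + 2 * h) → |p.2 - q.2| ≤ σ * (p.1 - q.1) →
      q ∈ discUnion r W := by
    rintro p q ⟨w, hw, hwp⟩ hq1 hq2 hp1 hp2 h1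
    obtain ⟨hw1, hw2⟩ := hW w hw
    rw [abs_le] at h1 hw2
    refine ⟨w, hw, le_trans ?_ hwp⟩
    have e1 : (w.2 - q.2) ^ 2 - (w.2 - p.2) ^ 2 ≤ 4 * h * (σ * (p.1 - q.1)) := by
      have : (w.2 - q.2) ^ 2 - (w.2 - p.2) ^ 2 = (p.2 - q.2) * ((w.2 - q.2) + (w.2 - p.2)) := by
        ring
      rw [this]
      have hA : |p.2 - q.2| ≤ σ * (p.1 - q.1) := abs_le.2 h1
      have hB : |(w.2 - q.2) + (w.2 - p.2)| ≤ 4 * h := abs_le.2 ⟨by linarith, by linarith⟩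
      calc _ ≤ |p.2 - q.2| * |(w.2 - q.2) + (w.2 - p.2)| := by
            rw [← abs_mul]; exact le_abs_self _
        _ ≤ (σ * (p.1 - q.1)) * (4 * h) :=
            mul_le_mul hA hB (abs_nonneg _) ((abs_nonneg _).trans hA)
        _ = _ := by ring
    have hA : 0 ≤ σ * (p.1 - q.1) := by linarith
    have e2 : 4 * h * (σ * (p.1 - q.1)) ≤ (w.1 - p.1) ^ 2 - (w.1 - q.1) ^ 2 := by
      rcases hσ with rfl | rfl <;> push_cast at * <;> nlinarith
    linarith
  -- Distinct cells of one row with equal parity are separated by at least `d` along the row, while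
  -- their points differ by at most `d` across it, so the cone condition holds. Each row has at most
  -- one cut cell per parity.
  refine card_le_of_injOn_key (fun c => (c.2, (c.1 : ℕ) % 2))
    (K := Finset.univ ×ˢ Finset.range 2) (by simp [mul_comm]) ?_ ?_
  · intro c _
    simpa using Nat.mod_lt _ two_pos
  · have key : ∀ c ∈ cutCells a d m (discUnion r W), ∀ c' ∈ cutCells a d m (discUnion r W),
        c.2 = c'.2 → (c.1 : ℕ) % 2 = c'.1 % 2 → ¬ σ * (c.1 : ℤ) < σ * c'.1 := by
      intro c hc c' hc' h2 hk hlt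
      obtain ⟨-, -, q, hq, -, hqU⟩ := mem_cutCells.1 hc
      obtain ⟨p, hp, -, -, hpU, -⟩ := mem_cutCells.1 hc'
      obtain ⟨hq1, hq2⟩ := cell_bounds hd hm hq
      obtain ⟨hp1, hp2⟩ := cell_bounds hd hm hp
      have hqc := hq.2
      have hpc := hp.2
      rw [← h2] at hpc
      have hdiff : |p.2 - q.2| ≤ d :=
        abs_le.2 ⟨by linarith [hqc.2, hpc.1], by linarith [hqc.1, hpc.2]⟩
      refine hqU (mono p q hpU hq1 hq2 hp1 hp2 (hdiff.trans ?_))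
      rcases hσ with rfl | rfl
      · have := lt_of_mem_Ico_cell hd hq.1 hp.1 (k := 1) (by omega)
        push_cast at *; linarith
      · have := lt_of_mem_Ico_cell hd hp.1 hq.1 (k := 1) (by omega)
        push_cast at *; linarith
    intro c hc c' hc' hk
    simp only [Prod.mk.injEq] at hk
    have h1 := key c hc c' hc' hk.1 hk.2
    have h2 := key c' hc' c hc hk.1.symm hk.2.symm
    refine Prod.ext (Fin.ext ?_) hk.1
    rcases hσ with rfl | rfl <;> omega

theorem card_cutCells_swap {a d r : ℝ} {m : ℕ} (W : Set (ℝ × ℝ)) :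
    (cutCells a d m (discUnion r W)).card ≤
      (cutCells a d m (discUnion r (Prod.swap ⁻¹' W))).card := by
  refine Finset.card_le_card_of_injOn Prod.swap ?_ Prod.swap_injective.injOn
  intro c hc
  obtain ⟨p, hp, q, hq, ⟨w, hw, hwp⟩, hqU⟩ := mem_cutCells.1 hc
  refine mem_cutCells.2 ⟨p.swap, ⟨hp.2, hp.1⟩, q.swap, ⟨hq.2, hq.1⟩, ⟨w.swap, by simpa using hw,
    by simpa [add_comm] using hwp⟩, ?_⟩
  rintro ⟨w', hw', hwq⟩
  exact hqU ⟨w'.swap, hw', by simpa [add_comm] using hwq⟩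

/-- A union of discs of radius `10 h` cuts few cells of the subdivision of a square of
side `2 h`. -/
theorem card_cutCells_le {a d h : ℝ} {m : ℕ} (hd : 0 < d) (hh : 0 < h) (hm : m * d = 2 * h)
    (W : Set (ℝ × ℝ)) : (cutCells a d m (discUnion (10 * h) W)).card ≤ 16 * m := by
  classical
  -- A centre within `3h` in both coordinates has the whole square in its disc, since `4√2 h < 10h`,
  -- and nothing is cut. Otherwise the centres fall into four quadrant and four axis classes, each
  -- cutting at most `2m` cells.
  by_cases hnear : ∃ w ∈ W, |w.1 - (a + h)| ≤ 3 * h ∧ |w.2 - (a + h)| ≤ 3 * h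
  · obtain ⟨w, hw, h1, h2⟩ := hnear
    rw [abs_le] at h1 h2
    have : cutCells a d m (discUnion (10 * h) W) = ∅ := by
      rw [Finset.eq_empty_iff_forall_notMem]
      intro c hc
      obtain ⟨-, -, q, hq, -, hqU⟩ := mem_cutCells.1 hc
      obtain ⟨hq1, hq2⟩ := cell_bounds hd hm hq
      refine hqU ⟨w, hw, ?_⟩
      have e1 : (w.1 - q.1) ^ 2 ≤ (4 * h) ^ 2 := sq_le_sq' (by linarith) (by linarith)
      have e2 : (w.2 - q.2) ^ 2 ≤ (4 * h) ^ 2 := sq_le_sq' (by linarith) (by linarith)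
      nlinarith
    simp [this]
  · push Not at hnear
    let s : Bool → ℤ := fun b => if b then 1 else -1
    have hs : ∀ b, s b = 1 ∨ s b = -1 := by decide
    let Wq : Bool × Bool → Set (ℝ × ℝ) := fun b =>
      {w ∈ W | h ≤ s b.1 * (a + h - w.1) ∧ h ≤ s b.2 * (a + h - w.2)}
    let Wx : Bool → Set (ℝ × ℝ) := fun b =>
      {w ∈ W | 3 * h ≤ s b * (a + h - w.1) ∧ |w.2 - (a + h)| ≤ h}
    let Wy : Bool → Set (ℝ × ℝ) := fun b =>
      {w ∈ W | 3 * h ≤ s b * (a + h - w.2) ∧ |w.1 - (a + h)| ≤ h}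
    have hcov : ∀ w ∈ W, (∃ b, w ∈ Wq b) ∨ (∃ b, w ∈ Wx b) ∨ ∃ b, w ∈ Wy b := by
      intro w hw
      have sgn : ∀ (k t : ℝ), k ≤ |t| → ∃ b, k ≤ s b * -t := by
        intro k t ht
        rcases le_abs'.1 ht with h | h
        · exact ⟨true, by simp [s]; linarith⟩
        · exact ⟨false, by simp [s]; linarith⟩
      rcases le_or_gt h |w.1 - (a + h)| with h1 | h1
      · rcases le_or_gt h |w.2 - (a + h)| with h2 | h2
        · obtain ⟨b, hb⟩ := sgn _ _ h1
          obtain ⟨b', hb'⟩ := sgn _ _ h2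
          exact Or.inl ⟨(b, b'), hw, by simpa using hb, by simpa using hb'⟩
        · by_cases h3 : |w.1 - (a + h)| ≤ 3 * h
          · exact absurd (hnear w hw h3) (by linarith)
          · obtain ⟨b, hb⟩ := sgn _ _ (not_le.1 h3).le
            exact Or.inr (Or.inl ⟨b, hw, by simpa using hb, h2.le⟩)
      · obtain ⟨b, hb⟩ := sgn _ _ (hnear w hw (by linarith)).le
        exact Or.inr (Or.inr ⟨b, hw, by simpa using hb, h1.le⟩)
    have hsub : cutCells a d m (discUnion (10 * h) W) ⊆
        (Finset.univ.biUnion fun b => cutCells a d m (discUnion (10 * h) (Wq b))) ∪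
        ((Finset.univ.biUnion fun b => cutCells a d m (discUnion (10 * h) (Wx b))) ∪
        Finset.univ.biUnion fun b => cutCells a d m (discUnion (10 * h) (Wy b))) := by
      intro c hc
      obtain ⟨p, hp, q, hq, ⟨w, hw, hwp⟩, hqU⟩ := mem_cutCells.1 hc
      -- The disc about `w` catches `p`, and `q` is outside every disc, so the cell is already cut
      -- by any subfamily containing `w`.
      have aux : ∀ W' ⊆ W, w ∈ W' → c ∈ cutCells a d m (discUnion (10 * h) W') :=
        fun W' hW' hw' => mem_cutCells.2 ⟨p, hp, q, hq, ⟨w, hw', hwp⟩,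
          fun ⟨v, hv, hvq⟩ => hqU ⟨v, hW' hv, hvq⟩⟩
      simp only [Finset.mem_union, Finset.mem_biUnion, Finset.mem_univ, true_and]
      rcases hcov w hw with ⟨b, hb⟩ | ⟨b, hb⟩ | ⟨b, hb⟩
      · exact Or.inl ⟨b, aux _ (fun _ h => h.1) hb⟩
      · exact Or.inr (Or.inl ⟨b, aux _ (fun _ h => h.1) hb⟩)
      · exact Or.inr (Or.inr ⟨b, aux _ (fun _ h => h.1) hb⟩)
    have hq : ∀ b, (cutCells a d m (discUnion (10 * h) (Wq b))).card ≤ 2 * m := fun b =>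
      card_cutCells_quadrant hd hm (hs b.1) (hs b.2) fun w hw => hw.2
    have hx : ∀ b, (cutCells a d m (discUnion (10 * h) (Wx b))).card ≤ 2 * m := fun b =>
      card_cutCells_axis hd hm (hs b) fun w hw => hw.2
    have hy : ∀ b, (cutCells a d m (discUnion (10 * h) (Wy b))).card ≤ 2 * m := fun b =>
      (card_cutCells_swap _).trans (card_cutCells_axis hd hm (hs b) fun w hw => hw.2)
    refine (Finset.card_le_card hsub).trans ((Finset.card_union_le _ _).trans ?_)
    have e1 := Finset.card_biUnion_le_card_mul Finset.univ _ _ fun b _ => hq b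
    have e2 := Finset.card_biUnion_le_card_mul Finset.univ _ _ fun b _ => hx b
    have e3 := Finset.card_biUnion_le_card_mul Finset.univ _ _ fun b _ => hy b
    have e4 := Finset.card_union_le
      (Finset.univ.biUnion fun b => cutCells a d m (discUnion (10 * h) (Wx b)))
      (Finset.univ.biUnion fun b => cutCells a d m (discUnion (10 * h) (Wy b)))
    simp only [Finset.card_univ, Fintype.card_prod, Fintype.card_bool] at e1 e2 e3
    omega

end RandomGeometric

/-! ### Distances to a clique from outside -/

namespace SimpleGraph

variable {V : Type*} (G : SimpleGraph V)

/-- The graph obtained by deleting all edges that meet `Q`. -/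
def avoiding (Q : Set V) : SimpleGraph V where
  Adj u v := G.Adj u v ∧ u ∉ Q ∧ v ∉ Q
  symm := ⟨fun _ _ h => ⟨h.1.symm, h.2.2, h.2.1⟩⟩
  loopless := ⟨fun _ h => h.1.ne rfl⟩

variable {G}

theorem avoiding_le (Q : Set V) : G.avoiding Q ≤ G := fun _ _ h => h.1

/-- The vertices of `Q` are isolated once their edges are deleted, so a ball around an outside
vertex never enters `Q`. -/
theorem notMem_of_avoiding_edist_le {Q : Set V} {s w : V} (hs : s ∉ Q) {j : ℕ}
    (h : (G.avoiding Q).edist s w ≤ j) : w ∉ Q := by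
  obtain ⟨i, hi, -⟩ := ENat.le_natCast_iff.1 h
  rcases i with _ | i
  · have hsw : s = w := SimpleGraph.edist_eq_zero_iff.1 hi
    rwa [← hsw]
  · obtain ⟨v, -, hv⟩ := exists_adj_of_edist_eq_succ hi
    exact hv.2.2

theorem edist_lt_card [Fintype V] {s q : V} {k : ℕ} (h : G.edist s q = k) :
    k < Fintype.card V := by
  classical
  obtain ⟨p, hp⟩ := exists_walk_of_edist_eq_coe h
  have h1 : G.edist s q ≤ p.bypass.length := edist_le p.bypass
  rw [h] at h1
  exact lt_of_le_of_lt (by exact_mod_cast h1) p.bypass_isPath.length_lt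

/-- Seen from outside a clique `Q`, the vertices of `Q` are at two distances at most, and the
closer ones are those with a neighbour in a ball of the graph that avoids `Q`. -/
theorem exists_level_of_clique [Fintype V] {Q : Set V}
    (hQ : ∀ u ∈ Q, ∀ v ∈ Q, u ≠ v → G.Adj u v) {s : V} (hs : s ∉ Q) :
    ∃ j < Fintype.card V, ∀ u ∈ Q, ∀ v ∈ Q, G.edist s u ≠ G.edist s v →
      ¬ ((∃ w, (G.avoiding Q).edist s w ≤ j ∧ G.Adj w u) ↔
        ∃ w, (G.avoiding Q).edist s w ≤ j ∧ G.Adj w v) := by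
  have hstep : ∀ u ∈ Q, ∀ v ∈ Q, G.edist s v ≤ G.edist s u + 1 := fun u hu v hv => by
    refine (SimpleGraph.edist_triangle (v := u)).trans ?_
    gcongr
    by_cases huv : u = v
    · subst huv; simp
    · exact edist_le_one_iff_adj_or_eq.2 (Or.inl (hQ u hu v hv huv))
  by_cases hne : ∃ u ∈ Q, ∃ v ∈ Q, G.edist s u < G.edist s v
  · obtain ⟨u₀, hu₀, v₀, hv₀, hlt⟩ := hne
    obtain ⟨k, hk⟩ := ENat.ne_top_iff_exists.1 hlt.ne_top
    rcases k with _ | j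
    · exact absurd (SimpleGraph.edist_eq_zero_iff.1 hk.symm ▸ hu₀) hs
    have hjk : (j : ℕ∞) + 1 < G.edist s v₀ := by rw [← hk] at hlt; exact_mod_cast hlt
    -- Here `j + 1` is the distance to `u₀`. A vertex of `Q` closer still would put `v₀` within `j +
    -- 1`, because `Q` is a clique.
    have hfar : ∀ u ∈ Q, (j : ℕ∞) + 1 ≤ G.edist s u := by
      intro u hu
      by_contra! hc
      have := hstep u hu v₀ hv₀
      have h2 : G.edist s u + 1 ≤ j + 1 := by
        gcongr
        exact (ENat.lt_add_one_iff (ENat.natCast_ne_top j)).1 hc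
      exact absurd (hjk.trans_le (this.trans h2)) (lt_irrefl _)
    -- All of `Q` is at distance at least `j + 1`, so shortest walks of length at most `j` survive
    -- the deletion.
    have havoid : ∀ i ≤ j, ∀ w, G.edist s w = i → (G.avoiding Q).edist s w ≤ i := by
      intro i
      induction i with
      | zero =>
        intro _ w hw
        have hsw : s = w := SimpleGraph.edist_eq_zero_iff.1 hw
        rw [hsw]; simp
      | succ i ih =>
        intro hi w hw
        obtain ⟨w', hw', hadj⟩ := exists_adj_of_edist_eq_succ hw
        have hnot : ∀ v, ∀ l ≤ j, G.edist s v = (l : ℕ) → v ∉ Q := by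
          intro v l hl hv hvQ
          have := hfar v hvQ
          rw [hv] at this
          have : j + 1 ≤ l := by exact_mod_cast this
          omega
        refine (SimpleGraph.edist_triangle (v := w')).trans ?_
        push_cast
        gcongr
        · exact ih (by omega) w' hw'
        · exact edist_le_one_iff_adj_or_eq.2
            (Or.inl ⟨hadj, hnot w' i (by omega) hw', hnot w (i + 1) hi hw⟩)
    have hchar : ∀ u ∈ Q, (∃ w, (G.avoiding Q).edist s w ≤ j ∧ G.Adj w u) ↔
        G.edist s u = (j + 1 : ℕ) := by
      intro u hu
      constructor
      · rintro ⟨w, hw, hadj⟩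
        refine le_antisymm ?_ (by exact_mod_cast hfar u hu)
        refine (SimpleGraph.edist_triangle (v := w)).trans ?_
        push_cast
        gcongr
        · exact (edist_anti (avoiding_le Q)).trans hw
        · exact edist_le_one_iff_adj_or_eq.2 (Or.inl hadj)
      · intro h
        obtain ⟨w, hw, hadj⟩ := exists_adj_of_edist_eq_succ h
        exact ⟨w, havoid j le_rfl w hw, hadj⟩
    refine ⟨j, (Nat.lt_succ_self j).trans (edist_lt_card hk.symm), fun u hu v hv huv hiff => ?_⟩
    rw [hchar u hu, hchar v hv] at hiff
    have htwo : ∀ u ∈ Q, G.edist s u ≠ (j + 1 : ℕ) → G.edist s u = (j + 1 : ℕ) + 1 := by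
      intro u hu h
      refine le_antisymm (hk ▸ hstep u₀ hu₀ u hu) ?_
      have : ((j + 1 : ℕ) : ℕ∞) < G.edist s u :=
        lt_of_le_of_ne (by exact_mod_cast hfar u hu) (Ne.symm h)
      exact Order.add_one_le_of_lt this
    by_cases h : G.edist s u = (j + 1 : ℕ)
    · exact huv (h.trans (hiff.1 h).symm)
    · exact huv ((htwo u hu h).trans (htwo v hv (fun h' => h (hiff.2 h'))).symm)
  · push Not at hne
    -- All of `Q` is equidistant from `s`, so the level is arbitrary.
    exact ⟨0, Fintype.card_pos_iff.2 ⟨s⟩, fun u hu v hv huv =>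
      absurd (le_antisymm (hne v hv u hu) (hne u hu v hv)) huv⟩

end SimpleGraph

/-! ### Pairs of points confined to few cells -/

namespace IIDPoints

variable {Ω ι : Type*} [MeasurableSpace Ω] [Fintype ι] (μ : Measure Ω)
  [IsProbabilityMeasure μ]

/-- The pairs in `T` are pairs of distinct elements, and pairwise disjoint. -/
def PairsDisjoint {ι : Type*} (T : Finset (ι × ι)) : Prop :=
  (∀ p ∈ T, p.1 ≠ p.2) ∧ ∀ p ∈ T, ∀ q ∈ T, (p.1 = q.1 ∨ p.1 = q.2 ∨ p.2 = q.1 ∨ p.2 = q.2) → p = q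

/-- If, the other points being given, each pair of points in `T` is confined to one of `N` sets
of measure at most `a`, then this has probability at most `(N * a ^ 2) ^ #T`. -/
theorem measure_le_of_pairs_confined {γ : Type*} {D : γ → Set Ω} {a : ENNReal}
    (hDa : ∀ c, μ (D c) ≤ a) {T : Finset (ι × ι)} (hT : PairsDisjoint T)
    {E : Set (ι → Ω)} (hE : MeasurableSet E) {N : ℕ}
    (h : ∀ x₀ ∈ E, ∃ C : Finset γ, C.card ≤ N ∧ ∀ x ∈ E,
      (∀ i, (∀ p ∈ T, i ≠ p.1 ∧ i ≠ p.2) → x i = x₀ i) →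
      ∀ p ∈ T, ∃ c ∈ C, x p.1 ∈ D c ∧ x p.2 ∈ D c) :
    Measure.pi (fun _ : ι => μ) E ≤ (N * a ^ 2) ^ T.card := by
  classical
  let I : Finset ι := T.image Prod.fst ∪ T.image Prod.snd
  have hIc : I.card = 2 * T.card := by
    rw [Finset.card_union_of_disjoint, Finset.card_image_of_injOn, Finset.card_image_of_injOn,
      two_mul]
    · exact fun p hp q hq h => hT.2 p hp q hq (Or.inr (Or.inr (Or.inr h)))
    · exact fun p hp q hq h => hT.2 p hp q hq (Or.inl h)
    · rw [Finset.disjoint_left]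
      intro i h1 h2
      obtain ⟨p, hp, rfl⟩ := Finset.mem_image.1 h1
      obtain ⟨q, hq, hpq⟩ := Finset.mem_image.1 h2
      obtain rfl := hT.2 p hp q hq (Or.inr (Or.inl hpq.symm))
      exact hT.1 p hp hpq.symm
  let J : ι → Prop := fun i => ∃ p ∈ T, i = p.1 ∨ i = p.2
  have hJc : Fintype.card {i // J i} = 2 * T.card := by
    rw [← hIc]
    refine Fintype.card_of_subtype I fun i => ?_
    simp only [I, J, Finset.mem_union, Finset.mem_image]
    grind
  have hpair : ∀ i : {i // J i}, ∃ p : T, i.1 = p.1.1 ∨ i.1 = p.1.2 :=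
    fun ⟨i, p, hp, h⟩ => ⟨⟨p, hp⟩, h⟩
  choose P hP using hpair
  refine measure_pi_le_of_section μ (J) hE fun y => ?_
  let glue : ({i // J i} → Ω) → ι → Ω := fun z i => if hi : J i then z ⟨i, hi⟩ else y ⟨i, hi⟩
  change Measure.pi (fun _ : {i // J i} => μ) {z | glue z ∈ E} ≤ _
  -- With the coordinates outside the pairs fixed, one point of the section supplies a family `C`
  -- valid for the whole section.
  rcases Set.eq_empty_or_nonempty {z | glue z ∈ E} with he | ⟨z₀, hz₀⟩
  · rw [he]; simp
  obtain ⟨C, hC, hCE⟩ := h _ hz₀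
  -- Assigning a cell to each pair gives at most `N ^ #T` boxes, each of measure at most `a ^ (2
  -- #T)`.
  have hsub : {z | glue z ∈ E} ⊆ ⋃ α ∈ Fintype.piFinset fun _ : T => C,
      Set.pi Set.univ fun i => D (α (P i)) := by
    intro z hz
    have hz' := hCE _ hz fun i hi => by
      have : ¬ J i := fun hmem => by
        rcases hP ⟨i, hmem⟩ with h | h
        · exact (hi _ (P ⟨i, hmem⟩).2).1 h
        · exact (hi _ (P ⟨i, hmem⟩).2).2 h
      simp only [glue, dif_neg this]
    choose α hα1 hα2 using hz'
    simp only [Set.mem_iUnion]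
    refine ⟨fun p => α p.1 p.2, Fintype.mem_piFinset.2 fun p => hα1 _ _, fun i _ => ?_⟩
    have h2 := hα2 _ (P i).2
    have hgi : glue z i = z i := by simp only [glue, dif_pos i.2]
    rcases hP i with h | h
    · rw [← hgi, h]; exact h2.1
    · rw [← hgi, h]; exact h2.2
  calc _ ≤ ∑ α ∈ Fintype.piFinset fun _ : T => C, Measure.pi (fun _ : {i // J i} => μ)
          (Set.pi Set.univ fun i => D (α (P i))) :=
        (measure_mono hsub).trans (measure_biUnion_finset_le _ _)
    _ ≤ ∑ α ∈ Fintype.piFinset fun _ : T => C, a ^ (2 * T.card) := by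
        refine Finset.sum_le_sum fun α _ => ?_
        rw [Measure.pi_pi]
        refine (Finset.prod_le_prod' fun i _ => hDa _).trans ?_
        rw [Finset.prod_const, Finset.card_univ, hJc]
    _ = C.card ^ T.card * a ^ (2 * T.card) := by
        rw [Finset.sum_const, Fintype.card_piFinset, Finset.prod_const, Finset.card_univ,
          Fintype.card_coe, nsmul_eq_mul]
        push_cast; rfl
    _ ≤ _ := by
        rw [mul_pow, ← pow_mul]
        gcongr

/-- A set which depends on finitely many measurable properties is measurable. -/
theorem measurableSet_of_pattern {X Y : Type*} [MeasurableSpace X] [MeasurableSpace Y] [Finite Y]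
    [MeasurableSingletonClass Y] {f : X → Y} (hf : Measurable f) {E : Set X}
    (h : ∀ x x', f x = f x' → x ∈ E → x' ∈ E) : MeasurableSet E := by
  have : E = f ⁻¹' (f '' E) := by
    refine subset_antisymm (Set.subset_preimage_image f E) ?_
    rintro x ⟨x', hx', hxx⟩
    exact h x' x hxx hx'
  rw [this]
  exact hf (Set.toFinite _).measurableSet

end IIDPoints

/-! ### Few pairs in the central square are split by one sensor -/

namespace RandomGeometric

/-- The coordinates of the lower left corner of the central square. -/
noncomputable def centreCorner (n : ℕ) (r : ℝ) : ℝ := √n / 2 - r / 10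

/-- A square of side `r / 5` in the middle of the fundamental domain. -/
def centreSquare (n : ℕ) (r : ℝ) : Set (ℝ × ℝ) :=
  Set.Ico (centreCorner n r) (centreCorner n r + r / 5) ×ˢ
    Set.Ico (centreCorner n r) (centreCorner n r + r / 5)

/-- The cells of the subdivision of the central square into `m ^ 2` squares. -/
def centreCell (n : ℕ) (r : ℝ) {m : ℕ} (c : Fin m × Fin m) : Set (ℝ × ℝ) :=
  cell (centreCorner n r) (r / (5 * m)) c

theorem centreCell_subset {n : ℕ} {r : ℝ} (hr : 0 < r) {m : ℕ} (c : Fin m × Fin m) :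
    centreCell n r c ⊆ centreSquare n r := by
  have hm : (0 : ℝ) < m := by exact_mod_cast c.1.pos
  intro p hp
  obtain ⟨h1, h2⟩ := cell_bounds (h := r / 10) (by positivity) (by field_simp; norm_num) hp
  rw [show 2 * (r / 10) = r / 5 by ring] at h1 h2
  exact ⟨h1, h2⟩

theorem eq_of_mem_centreCell {n : ℕ} {r : ℝ} (hr : 0 < r) {m : ℕ} {p : ℝ × ℝ}
    {c c' : Fin m × Fin m} (hc : p ∈ centreCell n r c) (hc' : p ∈ centreCell n r c') : c = c' := by
  have hm : (0 : ℝ) < m := by exact_mod_cast c.1.pos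
  have hd : 0 < r / (5 * m) := by positivity
  have key : ∀ (i i' : Fin m) (t : ℝ), t ∈ Set.Ico (centreCorner n r + i * (r / (5 * m)))
      (centreCorner n r + (i + 1) * (r / (5 * m))) →
      t ∈ Set.Ico (centreCorner n r + i' * (r / (5 * m)))
      (centreCorner n r + (i' + 1) * (r / (5 * m))) → i = i' := by
    intro i i' t ht ht'
    rcases lt_trichotomy i i' with h | h | h
    · have := lt_of_mem_Ico_cell hd ht ht' (k := 0) (by simpa using h)
      simp at this
    · exact h
    · have := lt_of_mem_Ico_cell hd ht' ht (k := 0) (by simpa using h)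
      simp at this
  exact Prod.ext (key _ _ _ hc.1 hc'.1) (key _ _ _ hc.2 hc'.2)

theorem measurableSet_centreSquare (n : ℕ) (r : ℝ) : MeasurableSet (centreSquare n r) :=
  measurableSet_Ico.prod measurableSet_Ico

theorem measurableSet_centreCell (n : ℕ) (r : ℝ) {m : ℕ} (c : Fin m × Fin m) :
    MeasurableSet (centreCell n r c) :=
  measurableSet_Ico.prod measurableSet_Ico

theorem centreSquare_subset {n : ℕ} {r : ℝ} (hr : Admissible n r) (hn : 3 ≤ n) :
    centreSquare n r ⊆ Set.Icc (0 : ℝ) (√n) ×ˢ Set.Icc (0 : ℝ) (√n) := by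
  have hr0 := hr.pos hn
  have hr2 := hr.2
  rintro p ⟨h1, h2⟩
  rw [Set.mem_Ico, centreCorner] at h1 h2
  exact ⟨⟨by linarith, by linarith⟩, by linarith, by linarith⟩

theorem unifLaw_centreCell {n : ℕ} {r : ℝ} (hr : Admissible n r) (hn : 3 ≤ n) {m : ℕ}
    (c : Fin m × Fin m) : (unifLaw n).real (centreCell n r c) = (r / (5 * m)) ^ 2 / n := by
  have hr0 := hr.pos hn
  rw [unifLaw_real_of_subset ((centreCell_subset hr0 c).trans (centreSquare_subset hr hn)),
    centreCell, cell, measureReal_def, Measure.volume_eq_prod, Measure.prod_prod, Real.volume_Ico,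
    Real.volume_Ico, ENNReal.toReal_mul]
  have e : ∀ i : ℝ, centreCorner n r + (i + 1) * (r / (5 * m)) -
      (centreCorner n r + i * (r / (5 * m))) = r / (5 * m) := fun i => by ring
  rw [e, e, ENNReal.toReal_ofReal (by positivity), sq]

/-- Coordinate differences from the central square are at most `√n/2 + r/10`, and with `r < √n/4` no
wrap-around is shorter than `r`. Discs may be treated as Euclidean. -/
theorem torusDist_le_iff_of_mem_centreSquare {n : ℕ} {r : ℝ} (hr : Admissible n r) (hn : 3 ≤ n)
    {w q : ℝ × ℝ} (hw : w ∈ Set.Icc (0 : ℝ) (√n) ×ˢ Set.Icc (0 : ℝ) (√n))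
    (hq : q ∈ centreSquare n r) :
    torusDist (√n) w q ≤ r ↔ (w.1 - q.1) ^ 2 + (w.2 - q.2) ^ 2 ≤ r ^ 2 := by
  have hr0 := hr.pos hn
  have hr2 := hr.2
  obtain ⟨h1, h2⟩ := hq
  obtain ⟨h3, h4⟩ := hw
  rw [Set.mem_Ico, centreCorner] at h1 h2
  rw [Set.mem_Icc] at h3 h4
  refine ⟨fun h => sq_le_of_torusDist_le ?_ ?_ h, fun h => torusDist_le_of_sq h hr0.le⟩
  · have : |w.1 - q.1| ≤ √n / 2 + r / 10 := abs_le.2 ⟨by linarith, by linarith⟩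
    linarith
  · have : |w.2 - q.2| ≤ √n / 2 + r / 10 := abs_le.2 ⟨by linarith, by linarith⟩
    linarith

theorem torusDist_le_of_mem_centreSquare {n : ℕ} {r : ℝ} (hr : Admissible n r) (hn : 3 ≤ n)
    {p q : ℝ × ℝ} (hp : p ∈ centreSquare n r) (hq : q ∈ centreSquare n r) :
    torusDist (√n) p q ≤ r := by
  rw [torusDist_le_iff_of_mem_centreSquare hr hn (centreSquare_subset hr hn hp) hq]
  have hr0 := hr.pos hn
  obtain ⟨h1, h2⟩ := hq
  obtain ⟨h3, h4⟩ := hp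
  rw [Set.mem_Ico] at h1 h2 h3 h4
  have e1 : (p.1 - q.1) ^ 2 ≤ (r / 5) ^ 2 := sq_le_sq' (by linarith) (by linarith)
  have e2 : (p.2 - q.2) ^ 2 ≤ (r / 5) ^ 2 := sq_le_sq' (by linarith) (by linarith)
  nlinarith

variable {n : ℕ}

/-- The graph without the edges that meet the central square. -/
def outerGraph (r : ℝ) (x : Fin n → ℝ × ℝ) : SimpleGraph (Fin n) :=
  (torusGraph r x).avoiding (x ⁻¹' centreSquare n r)

/-- The vertex `u` has a neighbour in the `j`-ball of `s` in the graph outside the central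
square. -/
def IsReached (r : ℝ) (x : Fin n → ℝ × ℝ) (s : Fin n) (j : ℕ) (u : Fin n) : Prop :=
  ∃ w, (outerGraph r x).edist s w ≤ j ∧ torusDist (√n) (x w) (x u) ≤ r

/-- All pairs in `T` lie in a common cell and are distinguished by `IsReached`. -/
def cutEvent (r : ℝ) (m : ℕ) (s : Fin n) (j : ℕ) (T : Finset (Fin n × Fin n)) :
    Set (Fin n → ℝ × ℝ) :=
  {x | (∀ i, x i ∈ Set.Icc (0 : ℝ) (√n) ×ˢ Set.Icc (0 : ℝ) (√n)) ∧ x s ∉ centreSquare n r ∧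
    ∀ p ∈ T, ∃ c : Fin m × Fin m, x p.1 ∈ centreCell n r c ∧ x p.2 ∈ centreCell n r c ∧
      ¬ (IsReached r x s j p.1 ↔ IsReached r x s j p.2)}

/-- The event is a function of finitely many measurable conditions on positions, which spares any
measurability of graph distances. -/
theorem measurableSet_cutEvent (r : ℝ) (m : ℕ) (s : Fin n) (j : ℕ) (T : Finset (Fin n × Fin n)) :
    MeasurableSet (cutEvent r m s j T) := by
  let f : (Fin n → ℝ × ℝ) → (Fin n → Fin n → Prop) × (Fin n → Fin m × Fin m → Prop) ×
      (Fin n → Prop) × (Fin n → Prop) := fun x =>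
    (fun i j => torusDist (√n) (x i) (x j) ≤ r, fun i c => x i ∈ centreCell n r c,
      fun i => x i ∈ centreSquare n r,
      fun i => x i ∈ Set.Icc (0 : ℝ) (√n) ×ˢ Set.Icc (0 : ℝ) (√n))
  have hmem : ∀ (i : Fin n) {D : Set (ℝ × ℝ)}, MeasurableSet D →
      Measurable fun x : Fin n → ℝ × ℝ => x i ∈ D := fun i D hD => by
    have : MeasurableSet {x : Fin n → ℝ × ℝ | x i ∈ D} := measurable_pi_apply i hD
    exact measurableSet_setOfPred.1 this
  have hf : Measurable f := by
    refine Measurable.prodMk ?_ (Measurable.prodMk ?_ (Measurable.prodMk ?_ ?_))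
    · refine measurable_pi_lambda _ fun i => measurable_pi_lambda _ fun j => ?_
      exact measurableSet_setOfPred.1
        (measurableSet_le (measurable_torusDist_apply (√n) i j) measurable_const)
    · exact measurable_pi_lambda _ fun i => measurable_pi_lambda _ fun c =>
        hmem i (measurableSet_centreCell n r c)
    · exact measurable_pi_lambda _ fun i => hmem i (measurableSet_centreSquare n r)
    · exact measurable_pi_lambda _ fun i => hmem i (measurableSet_Icc.prod measurableSet_Icc)
  refine IIDPoints.measurableSet_of_pattern hf fun x x' hxx hx => ?_
  simp only [f, Prod.mk.injEq] at hxx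
  obtain ⟨h1, h2, h3, h4⟩ := hxx
  have h1' : ∀ i j, torusDist (√n) (x' i) (x' j) ≤ r ↔ torusDist (√n) (x i) (x j) ≤ r :=
    fun i j => iff_of_eq (congrFun (congrFun h1 i) j).symm
  have h2' : ∀ i (c : Fin m × Fin m), x' i ∈ centreCell n r c ↔ x i ∈ centreCell n r c :=
    fun i c => iff_of_eq (congrFun (congrFun h2 i) c).symm
  have h3' : ∀ i, x' i ∈ centreSquare n r ↔ x i ∈ centreSquare n r :=
    fun i => iff_of_eq (congrFun h3 i).symm
  have h4' := fun i => iff_of_eq (congrFun h4 i).symm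
  have hG : outerGraph r x' = outerGraph r x := by
    ext u v
    simp only [outerGraph, SimpleGraph.avoiding, torusGraph, Set.mem_preimage, h1', h3']
  have hR : ∀ i, IsReached r x' s j i ↔ IsReached r x s j i := fun i => by
    simp only [IsReached, hG, h1']
  obtain ⟨hx1, hx2, hx3⟩ := hx
  refine ⟨fun i => (h4' i).2 (hx1 i), fun h => hx2 ((h3' s).1 h), fun p hp => ?_⟩
  obtain ⟨c, hc1, hc2, hc3⟩ := hx3 p hp
  exact ⟨c, (h2' _ _).2 hc1, (h2' _ _).2 hc2, by rwa [hR, hR]⟩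

/-- The ball about `s` in the outer graph uses only points outside the square, and none of these
belongs to a pair of `T`. Given the points not in `T`, the region reached is therefore a fixed union
of discs; it cuts at most `16m` cells, and every pair of `T` must fall into one of them. -/
theorem pointsLaw_cutEvent_le {r : ℝ} (hr : Admissible n r) (hn : 3 ≤ n) (m : ℕ) (s : Fin n)
    (j : ℕ) {T : Finset (Fin n × Fin n)} (hT : IIDPoints.PairsDisjoint T) :
    pointsLaw n (cutEvent r m s j T) ≤
      ENNReal.ofReal ((16 * m * ((r / (5 * m)) ^ 2 / n) ^ 2) ^ T.card) := by
  have hr0 := hr.pos hn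
  have : NeZero n := ⟨by omega⟩
  rw [ENNReal.ofReal_pow (by positivity), ENNReal.ofReal_mul (by positivity),
    ENNReal.ofReal_pow (by positivity), pointsLaw_eq]
  have hcast : ENNReal.ofReal (16 * m) = ((16 * m : ℕ) : ENNReal) := by
    rw [← ENNReal.ofReal_natCast]; push_cast; rfl
  rw [hcast]
  refine IIDPoints.measure_le_of_pairs_confined (unifLaw n)
    (D := fun c : Fin m × Fin m => centreCell n r c) (fun c => ?_) hT
    (measurableSet_cutEvent r m s j T) fun x₀ hx₀ => ?_
  · rw [← unifLaw_centreCell hr hn c, ofReal_measureReal (measure_ne_top _ _)]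
  obtain ⟨-, hs₀, hT₀⟩ := hx₀
  refine ⟨cutCells (centreCorner n r) (r / (5 * m)) m
    (discUnion r (x₀ '' {w | (outerGraph r x₀).edist s w ≤ j})), ?_, ?_⟩
  · rcases Nat.eq_zero_or_pos m with rfl | hm
    · exact (Finset.card_le_univ _).trans (by simp)
    have hm' : (0 : ℝ) < m := by exact_mod_cast hm
    have := card_cutCells_le (a := centreCorner n r) (d := r / (5 * m)) (h := r / 10) (m := m)
      (by positivity) (by positivity) (by field_simp; norm_num)
      (x₀ '' {w | (outerGraph r x₀).edist s w ≤ j})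
    rwa [show 10 * (r / 10) = r by ring] at this
  · rintro x ⟨hsq, hsx, hTx⟩ hagree p hp
    -- Members of the pairs lie in the square in both configurations, so a point outside it in
    -- either one is among the fixed points.
    have hout : ∀ i, x i ∉ centreSquare n r → x i = x₀ i := by
      refine fun i hi => hagree i fun p hp => ⟨?_, ?_⟩ <;> rintro rfl <;>
        obtain ⟨c, hc1, hc2, -⟩ := hTx p hp
      · exact hi (centreCell_subset hr0 c hc1)
      · exact hi (centreCell_subset hr0 c hc2)
    have hout₀ : ∀ i, x₀ i ∉ centreSquare n r → x i = x₀ i := by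
      refine fun i hi => hagree i fun p hp => ⟨?_, ?_⟩ <;> rintro rfl <;>
        obtain ⟨c, hc1, hc2, -⟩ := hT₀ p hp
      · exact hi (centreCell_subset hr0 c hc1)
      · exact hi (centreCell_subset hr0 c hc2)
    have hG : outerGraph r x = outerGraph r x₀ := by
      ext u v
      simp only [outerGraph, SimpleGraph.avoiding, torusGraph, Set.mem_preimage]
      constructor
      · rintro ⟨h1, hu, hv⟩
        rw [hout u hu, hout v hv] at h1
        exact ⟨h1, hout u hu ▸ hu, hout v hv ▸ hv⟩
      · rintro ⟨h1, hu, hv⟩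
        rw [← hout₀ u hu, ← hout₀ v hv] at h1
        exact ⟨h1, hout₀ u hu ▸ hu, hout₀ v hv ▸ hv⟩
    have hR : ∀ u, x u ∈ centreSquare n r → (IsReached r x s j u ↔ x u ∈ discUnion r
        (x₀ '' {w | (outerGraph r x₀).edist s w ≤ j})) := by
      intro u hu
      have hw : ∀ w, (outerGraph r x₀).edist s w ≤ j → x w = x₀ w := fun w hw => by
        rw [← hG] at hw
        exact hout w (SimpleGraph.notMem_of_avoiding_edist_le
          (Q := x ⁻¹' centreSquare n r) hsx hw)
      constructor
      · rintro ⟨w, hsw, hwu⟩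
        rw [hG] at hsw
        refine ⟨x₀ w, ⟨w, hsw, rfl⟩, ?_⟩
        rw [← hw w hsw]
        exact (torusDist_le_iff_of_mem_centreSquare hr hn (hsq w) hu).1 hwu
      · rintro ⟨_, ⟨w, hsw, rfl⟩, hwu⟩
        refine ⟨w, by rw [hG]; exact hsw, ?_⟩
        rw [← hw w hsw] at hwu
        exact (torusDist_le_iff_of_mem_centreSquare hr hn (hsq w) hu).2 hwu
    obtain ⟨c, hc1, hc2, hc3⟩ := hTx p hp
    rw [hR _ (centreCell_subset hr0 c hc1), hR _ (centreCell_subset hr0 c hc2)] at hc3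
    refine ⟨c, ?_, hc1, hc2⟩
    rw [mem_cutCells]
    by_cases h1 : x p.1 ∈ discUnion r (x₀ '' {w | (outerGraph r x₀).edist s w ≤ j})
    · exact ⟨x p.1, hc1, x p.2, hc2, h1, fun h2 => hc3 (iff_of_true h1 h2)⟩
    · exact ⟨x p.2, hc2, x p.1, hc1, by_contra fun h2 => hc3 (iff_of_false h1 h2), h1⟩

/-- No ball of the graph outside the central square distinguishes `t` disjoint pairs of vertices
lying in common cells. -/
def HasFewCuts (r : ℝ) (m t : ℕ) (x : Fin n → ℝ × ℝ) : Prop :=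
  ∀ s, x s ∉ centreSquare n r → ∀ j < n, ∀ T : Finset (Fin n × Fin n), T.card = t →
    IIDPoints.PairsDisjoint T →
    ¬ ∀ p ∈ T, ∃ c : Fin m × Fin m, x p.1 ∈ centreCell n r c ∧ x p.2 ∈ centreCell n r c ∧
      ¬ (IsReached r x s j p.1 ↔ IsReached r x s j p.2)

/-- A union bound over `n²` choices of sensor and level and at most `(n²)^t / t!` sets of pairs. The
powers `(n²)^t` cancel against the cell probabilities `d²/n`, squared for each pair. -/
theorem pointsLaw_not_hasFewCuts_le {r : ℝ} (hr : Admissible n r) (hn : 3 ≤ n) (m t : ℕ) :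
    pointsLaw n {x | ¬ HasFewCuts r m t x} ≤
      ENNReal.ofReal (n ^ 2 * ((16 * m * (r / (5 * m)) ^ 4) ^ t / t.factorial)) := by
  classical
  have : NeZero n := ⟨by omega⟩
  have hn0 : (n : ℝ) ≠ 0 := by exact_mod_cast NeZero.ne n
  let F : Finset (Finset (Fin n × Fin n)) :=
    (Finset.univ.powersetCard t).filter fun T => IIDPoints.PairsDisjoint T
  have hF : (F.card : ℝ) ≤ ((n : ℝ) ^ 2) ^ t / t.factorial := by
    refine (Nat.cast_le.2 (Finset.card_filter_le _ _)).trans ?_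
    rw [Finset.card_powersetCard, Finset.card_univ, Fintype.card_prod, Fintype.card_fin]
    refine (Nat.choose_le_pow_div t (n * n)).trans (le_of_eq ?_)
    push_cast; rw [sq]
  have hsub : {x | ¬ HasFewCuts r m t x} ≤ᵐ[pointsLaw n]
      ⋃ i : (Fin n × Fin n) × F, cutEvent r m i.1.1 i.1.2 i.2.1 := by
    filter_upwards [ae_mem_square n] with x hx hbad
    change ¬ HasFewCuts r m t x at hbad
    unfold HasFewCuts at hbad
    push Not at hbad
    obtain ⟨s, hs, j, hj, T, hTc, hT, h⟩ := hbad
    refine Set.mem_iUnion.2 ⟨((s, ⟨j, hj⟩), ⟨T, Finset.mem_filter.2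
      ⟨Finset.mem_powersetCard.2 ⟨Finset.subset_univ _, hTc⟩, hT⟩⟩), hx, hs, fun p hp => ?_⟩
    obtain ⟨c, h1, h2, h3⟩ := h p hp
    exact ⟨c, h1, h2, by tauto⟩
  calc _ ≤ pointsLaw n (⋃ i : (Fin n × Fin n) × F, cutEvent r m i.1.1 i.1.2 i.2.1) :=
        measure_mono_ae hsub
    _ ≤ ∑ i : (Fin n × Fin n) × F, pointsLaw n (cutEvent r m i.1.1 i.1.2 i.2.1) :=
        measure_iUnion_fintype_le _ _
    _ ≤ ∑ _i : (Fin n × Fin n) × F,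
          ENNReal.ofReal ((16 * m * ((r / (5 * m)) ^ 2 / n) ^ 2) ^ t) := by
        refine Finset.sum_le_sum fun i _ => ?_
        have hi := Finset.mem_filter.1 i.2.2
        have := pointsLaw_cutEvent_le hr hn m i.1.1 i.1.2 hi.2
        rwa [(Finset.mem_powersetCard.1 hi.1).2] at this
    _ = ENNReal.ofReal (n ^ 2 * F.card * (16 * m * ((r / (5 * m)) ^ 2 / n) ^ 2) ^ t) := by
        rw [Finset.sum_const, nsmul_eq_mul, Finset.card_univ, Fintype.card_prod,
          Fintype.card_prod, Fintype.card_fin, Fintype.card_coe,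
          ENNReal.ofReal_mul (by positivity), ← ENNReal.ofReal_natCast]
        push_cast; rw [sq (n : ℝ)]
    _ ≤ _ := by
        refine ENNReal.ofReal_le_ofReal ?_
        calc _ ≤ n ^ 2 * (((n : ℝ) ^ 2) ^ t / t.factorial) *
              (16 * m * ((r / (5 * m)) ^ 2 / n) ^ 2) ^ t := by gcongr
          _ = n ^ 2 * ((n ^ 2 * (16 * m * ((r / (5 * m)) ^ 2 / n) ^ 2)) ^ t / t.factorial) := by
              rw [mul_pow ((n : ℝ) ^ 2)]; ring
          _ = _ := by
              congr 3
              field_simp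

end RandomGeometric

theorem Real.exp_neg_two_mul_le_one_sub {a : ℝ} (h0 : 0 ≤ a) (h1 : a ≤ 1 / 2) :
    Real.exp (-(2 * a)) ≤ 1 - a := by
  have h2 : (1 - a)⁻¹ ≤ Real.exp (2 * a) := by
    refine le_trans ?_ (Real.add_one_le_exp (2 * a))
    rw [inv_le_iff_one_le_mul₀ (by linarith)]
    nlinarith
  rw [Real.exp_neg]
  exact (inv_le_comm₀ (by linarith) (Real.exp_pos _)).1 h2

/-! ### Lower bound from cells with exactly two vertices -/

namespace RandomGeometric

/-- The number of cells of the central square that contain exactly two points. -/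
noncomputable def pairCells {n : ℕ} (r : ℝ) (m : ℕ) (x : Fin n → ℝ × ℝ) : ℕ :=
  Nat.card {c : Fin m × Fin m // c ∈ Finset.univ ∧
    x ∈ IIDPoints.isolatedCluster (Fin n) (centreCell n r c) (centreCell n r c) 2}

/-- Each sensor splits at most `t` of the pairs. Outside the square this is `HasFewCuts` at the
level given by `exists_level_of_clique`; a sensor inside is at distance 1 from all other vertices
there, so it can split only the pair of its own cell. With more than `kt` pairs one remains unsplit.
-/
theorem not_copsWin_of_lt_pairCells {n : ℕ} {r : ℝ} (hr : Admissible n r) (hn : 3 ≤ n) {m t k : ℕ}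
    (ht : 1 ≤ t) {x : Fin n → ℝ × ℝ} (hx : HasFewCuts r m t x) (hk : k * t < pairCells r m x) :
    ¬ LocalizationGame.CopsWin (torusGraph r x) k := by
  classical
  have hr0 := hr.pos hn
  set G := torusGraph r x with hGdef
  set Q : Set (Fin n) := x ⁻¹' centreSquare n r with hQ
  have hclique : ∀ u ∈ Q, ∀ v ∈ Q, u ≠ v → G.Adj u v := fun u hu v hv huv =>
    ⟨huv, torusDist_le_of_mem_centreSquare hr hn hu hv⟩
  let Z : Finset (Fin m × Fin m) := Finset.univ.filter fun c =>
    x ∈ IIDPoints.isolatedCluster (Fin n) (centreCell n r c) (centreCell n r c) 2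
  have hZ : pairCells r m x = Z.card := Nat.subtype_card Z fun c => by simp [Z]
  have hpair : ∀ c : Fin m × Fin m, ∃ p : Fin n × Fin n, c ∈ Z →
      p.1 ≠ p.2 ∧ x p.1 ∈ centreCell n r c ∧ x p.2 ∈ centreCell n r c := by
    intro c
    by_cases hc : c ∈ Z
    · have h2 : Nat.card {i // x i ∈ centreCell n r c} = 2 := (Finset.mem_filter.1 hc).2.1
      obtain ⟨⟨u, hu⟩, ⟨v, hv⟩, huv⟩ :=
        (Finite.one_lt_card_iff_nontrivial.1 (by omega :
          1 < Nat.card {i // x i ∈ centreCell n r c})).exists_pair_ne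
      exact ⟨(u, v), fun _ => ⟨fun h => huv (Subtype.ext h), hu, hv⟩⟩
    · have : NeZero n := ⟨by omega⟩
      exact ⟨(0, 0), fun h => absurd h hc⟩
  choose P hP using hpair
  have hPQ : ∀ c ∈ Z, (P c).1 ∈ Q ∧ (P c).2 ∈ Q := fun c hc =>
    ⟨centreCell_subset hr0 c (hP c hc).2.1, centreCell_subset hr0 c (hP c hc).2.2⟩
  let sep : Fin n → Finset (Fin m × Fin m) := fun s =>
    Z.filter fun c => G.edist s (P c).1 ≠ G.edist s (P c).2
  have hsep : ∀ s, (sep s).card ≤ t := by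
    intro s
    by_cases hs : s ∈ Q
    · refine (Finset.card_le_one.2 ?_).trans ht
      have hmem : ∀ c ∈ sep s, x s ∈ centreCell n r c := by
        intro c hc
        obtain ⟨hcZ, hne⟩ := Finset.mem_filter.1 hc
        by_contra hcell
        refine hne ?_
        have key : ∀ u ∈ Q, x u ∈ centreCell n r c → G.edist s u = 1 := fun u hu huc => by
          refine SimpleGraph.edist_eq_one_iff_adj.2 (hclique s hs u hu ?_)
          rintro rfl; exact hcell huc
        rw [key _ (hPQ c hcZ).1 (hP c hcZ).2.1, key _ (hPQ c hcZ).2 (hP c hcZ).2.2]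
      exact fun c hc c' hc' => eq_of_mem_centreCell hr0 (hmem c hc) (hmem c' hc')
    · by_contra! hlt
      obtain ⟨A, hA, hAt⟩ := Finset.exists_subset_card_eq hlt.le
      have hAZ : ∀ c ∈ A, c ∈ Z := fun c hc => (Finset.mem_filter.1 (hA hc)).1
      have hinj : ∀ c ∈ A, ∀ c' ∈ A, ((P c).1 = (P c').1 ∨ (P c).1 = (P c').2 ∨
          (P c).2 = (P c').1 ∨ (P c).2 = (P c').2) → c = c' := by
        intro c hc c' hc' h
        have h1 := (hP c (hAZ c hc)).2
        have h2 := (hP c' (hAZ c' hc')).2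
        rcases h with h | h | h | h <;> rw [h] at h1
        · exact eq_of_mem_centreCell hr0 h1.1 h2.1
        · exact eq_of_mem_centreCell hr0 h1.1 h2.2
        · exact eq_of_mem_centreCell hr0 h1.2 h2.1
        · exact eq_of_mem_centreCell hr0 h1.2 h2.2
      obtain ⟨j, hj, hlev⟩ := SimpleGraph.exists_level_of_clique hclique hs
      rw [Fintype.card_fin] at hj
      have hreach : ∀ u ∈ Q, (IsReached r x s j u ↔
          ∃ w, (G.avoiding Q).edist s w ≤ j ∧ G.Adj w u) := by
        intro u hu
        constructor
        · rintro ⟨w, hw, hwu⟩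
          refine ⟨w, hw, ?_, hwu⟩
          rintro rfl
          exact SimpleGraph.notMem_of_avoiding_edist_le hs hw hu
        · rintro ⟨w, hw, hwu⟩
          exact ⟨w, hw, hwu.2⟩
      refine hx s hs j hj (A.image P) ?_ ⟨?_, ?_⟩ ?_
      · rw [Finset.card_image_of_injOn, hAt]
        exact fun c hc c' hc' h => hinj c hc c' hc' (Or.inl (by rw [h]))
      · intro p hp
        obtain ⟨c, hc, rfl⟩ := Finset.mem_image.1 hp
        exact (hP c (hAZ c hc)).1
      · intro p hp q hq h
        obtain ⟨c, hc, rfl⟩ := Finset.mem_image.1 hp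
        obtain ⟨c', hc', rfl⟩ := Finset.mem_image.1 hq
        rw [hinj c hc c' hc' h]
      · intro p hp
        obtain ⟨c, hc, rfl⟩ := Finset.mem_image.1 hp
        refine ⟨c, (hP c (hAZ c hc)).2.1, (hP c (hAZ c hc)).2.2, ?_⟩
        obtain ⟨h1, h2⟩ := hPQ c (hAZ c hc)
        rw [hreach _ h1, hreach _ h2]
        exact hlev _ h1 _ h2 (Finset.mem_filter.1 (hA hc)).2
  refine LocalizationGame.not_copsWin_of_clique (K := Q) hclique fun S hS => ?_
  have hcard : (S.biUnion sep).card < Z.card := by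
    refine lt_of_le_of_lt (Finset.card_biUnion_le_card_mul S sep t fun s _ => hsep s) ?_
    rwa [hS, ← hZ]
  obtain ⟨c, hcZ, hcS⟩ := Finset.exists_mem_notMem_of_card_lt_card hcard
  refine ⟨(P c).1, (hPQ c hcZ).1, (P c).2, (hPQ c hcZ).2, (hP c hcZ).1, fun s hs => ?_⟩
  by_contra hne
  exact hcS (Finset.mem_biUnion.2 ⟨s, hs, Finset.mem_filter.2 ⟨hcZ, hne⟩⟩)

/-- The order of the side of the cells into which the central square is divided. -/
noncomputable def cellScale (n : ℕ) (r : ℝ) : ℝ := min 1 ((Real.log n / r) ^ (1 / 3 : ℝ))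

/-- The number of cells along a side of the central square. -/
noncomputable def cellCount (n : ℕ) (r : ℝ) : ℕ := ⌈r / (5 * cellScale n r)⌉₊

/-- The scale `θ` is limited by `rθ³ ≤ log n`, which keeps the expected number of split pairs per
sensor `O(log n)`. The bound `r²θ² ≥ log n` makes the number of pair cells tend to infinity. -/
theorem cellScale_bounds {n : ℕ} {r : ℝ} (hr : Admissible n r) (hn : 3 ≤ n) :
    0 < cellScale n r ∧ cellScale n r ≤ 1 ∧ r * cellScale n r ^ 3 ≤ Real.log n ∧
      Real.log n ≤ r ^ 2 * cellScale n r ^ 2 := by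
  have hr0 := hr.pos hn
  have hlog := one_le_log hn
  have hcube : ((Real.log n / r) ^ (1 / 3 : ℝ)) ^ 3 = Real.log n / r := by
    rw [← Real.rpow_natCast, ← Real.rpow_mul (by positivity)]; norm_num
  have h0 : 0 < cellScale n r := lt_min one_pos (by positivity)
  have h1 : cellScale n r ≤ 1 := min_le_left _ _
  refine ⟨h0, h1, ?_, ?_⟩
  · have : cellScale n r ^ 3 ≤ Real.log n / r := by
      rw [← hcube]
      exact pow_le_pow_left₀ h0.le (min_le_right _ _) 3
    calc r * cellScale n r ^ 3 ≤ r * (Real.log n / r) := by gcongr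
      _ = _ := by field_simp
  · rcases min_choice 1 ((Real.log n / r) ^ (1 / 3 : ℝ)) with h | h
    · have h2 := hr.log_le hn
      rw [cellScale, h]; nlinarith
    · have h2 : Real.log n / r ≤ cellScale n r := by
        rw [← hcube, ← h]
        calc cellScale n r ^ 3 ≤ cellScale n r ^ 1 := pow_le_pow_of_le_one h0.le h1 (by norm_num)
          _ = _ := pow_one _
      rw [div_le_iff₀ hr0] at h2
      nlinarith

theorem cellCount_bounds {n : ℕ} {r : ℝ} (hr : Admissible n r) (hn : 3 ≤ n) :
    0 < cellCount n r ∧ r / (5 * cellCount n r) ≤ cellScale n r ∧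
      cellScale n r / 2 ≤ r / (5 * cellCount n r) := by
  have hr0 := hr.pos hn
  have h70 := hr.seventy_le hn
  obtain ⟨h0, h1, -, -⟩ := cellScale_bounds hr hn
  have hpos : 0 < r / (5 * cellScale n r) := by positivity
  have hm : 0 < cellCount n r := Nat.ceil_pos.2 hpos
  have hm' : (0 : ℝ) < cellCount n r := by exact_mod_cast hm
  have hle : r / (5 * cellScale n r) ≤ cellCount n r := Nat.le_ceil _
  have hge : (cellCount n r : ℝ) < r / (5 * cellScale n r) + 1 := Nat.ceil_lt_add_one hpos.le
  have hone : 1 ≤ r / (5 * cellScale n r) := by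
    rw [le_div_iff₀ (by positivity)]; linarith
  refine ⟨hm, ?_, ?_⟩
  · rw [div_le_iff₀ (by positivity)] at hle ⊢
    linarith
  · have h2 : (cellCount n r : ℝ) ≤ 2 * r / (5 * cellScale n r) := by
      rw [mul_div_assoc]; linarith
    rw [le_div_iff₀ (by positivity)] at h2 ⊢
    linarith

/-- Here `X = 16 m d⁴ = 3.2 r d³ ≤ 3.2 log n`. From `X^t / t! ≤ exp(eX - t)`, `eX < 9 log n` and `t
≥ 16 log n`, the bound `n^(-3)` follows, against `n²` sensors and levels. -/
theorem negligible_not_hasFewCuts : Negligible (fun n r => Admissible n r) fun n r =>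
    {x | ¬ HasFewCuts r (cellCount n r) ⌈16 * Real.log n⌉₊ x} := by
  refine negligible_of_le tendsto_one_div_natCast ?_
  filter_upwards [eventually_ge_atTop 3] with n hn r hr
  have hr0 := hr.pos hn
  have hlog := one_le_log hn
  have hn0 : (0 : ℝ) < n := by exact_mod_cast (by omega : 0 < n)
  obtain ⟨h0, h1, h2, -⟩ := cellScale_bounds hr hn
  obtain ⟨hm, hd, -⟩ := cellCount_bounds hr hn
  refine (pointsLaw_not_hasFewCuts_le hr hn _ _).trans (ENNReal.ofReal_le_ofReal ?_)
  set m := cellCount n r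
  set d := r / (5 * m) with hdef
  set t := ⌈16 * Real.log n⌉₊
  have hm' : (0 : ℝ) < m := by exact_mod_cast hm
  have hd0 : 0 < d := by positivity
  have hX : 16 * m * d ^ 4 ≤ 3.2 * Real.log n := by
    have e : 16 * m * d ^ 4 = 3.2 * (r * d ^ 3) := by
      rw [hdef]; field_simp; norm_num
    rw [e]
    have : r * d ^ 3 ≤ r * cellScale n r ^ 3 := by gcongr
    linarith
  have ht : 16 * Real.log n ≤ t := Nat.le_ceil _
  have hpow : (16 * m * d ^ 4) ^ t / t.factorial ≤ Real.exp (-(3 * Real.log n)) := by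
    have hE := Real.pow_div_factorial_le_exp (Real.exp 1 * (16 * m * d ^ 4)) (by positivity) t
    rw [mul_pow, mul_div_assoc, ← Real.exp_nat_mul, mul_one] at hE
    have h3 : (16 * m * d ^ 4) ^ t / t.factorial ≤
        Real.exp (Real.exp 1 * (16 * m * d ^ 4)) * Real.exp (-(t : ℝ)) := by
      rw [Real.exp_neg, ← div_eq_mul_inv, le_div_iff₀ (Real.exp_pos _)]
      linarith
    refine h3.trans ?_
    rw [← Real.exp_add]
    refine Real.exp_le_exp.2 ?_
    have he : Real.exp 1 * (16 * m * d ^ 4) ≤ 2.72 * (3.2 * Real.log n) :=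
      mul_le_mul (by linarith [Real.exp_one_lt_d9]) hX (by positivity) (by norm_num)
    linarith
  have hexp : Real.exp (-(3 * Real.log n)) = 1 / (n : ℝ) ^ 3 := by
    rw [Real.exp_neg, ← Real.exp_log (pow_pos hn0 3), Real.log_pow, one_div]
    norm_num
  calc (n : ℝ) ^ 2 * ((16 * (m : ℝ) * d ^ 4) ^ t / (t.factorial : ℝ))
      ≤ n ^ 2 * (1 / (n : ℝ) ^ 3) := by rw [← hexp]; gcongr
    _ = 1 / (n : ℝ) := by field_simp

/-- Second moment method with clusters of size 2 whose zone is the cell itself. A cell has expected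
content `d² ≤ 1`, so it holds exactly two points with probability at least `d⁴/32`; over `m²` cells
this gives a mean of at least `r²θ²/3200`. -/
theorem negligible_pairCells_le : Negligible (fun n r => Admissible n r) fun n r =>
    {x | (pairCells r (cellCount n r) x : ℝ) ≤ r ^ 2 * cellScale n r ^ 2 / 6400} := by
  have hlim : Tendsto (fun n : ℕ => 4 * (3200 / Real.log n + (Real.exp (8 * (1 / n)) - 1))) atTop
      (𝓝 0) := by
    have e1 : Tendsto (fun n : ℕ => 3200 / Real.log n) atTop (𝓝 0) :=
      (Real.tendsto_log_atTop.comp tendsto_natCast_atTop_atTop).const_div_atTop _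
    have e2 : Tendsto (fun n : ℕ => Real.exp (8 * (1 / (n : ℝ)))) atTop (𝓝 (Real.exp (8 * 0))) :=
      (Real.continuous_exp.tendsto _).comp (tendsto_one_div_natCast.const_mul 8)
    have := (e1.add (e2.sub_const 1)).const_mul 4
    simpa using this
  refine negligible_of_le hlim ?_
  filter_upwards [eventually_ge_atTop 4] with n hn r hr
  have : NeZero n := ⟨by omega⟩
  have hn3 : 3 ≤ n := by omega
  have hr0 := hr.pos hn3
  have hlog := one_le_log hn3
  have hn0 : (4 : ℝ) ≤ n := by exact_mod_cast hn
  obtain ⟨h0, h1, -, h4⟩ := cellScale_bounds hr hn3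
  obtain ⟨hm, hd, hd2⟩ := cellCount_bounds hr hn3
  set m := cellCount n r
  set d := r / (5 * m) with hdef
  set θ := cellScale n r
  have hm' : (0 : ℝ) < m := by exact_mod_cast hm
  have hd0 : 0 < d := by positivity
  set a := d ^ 2 / n with ha
  have ha0 : 0 < a := by positivity
  have han : a ≤ 1 / n := by
    rw [ha]; gcongr; exact pow_le_one₀ hd0.le (hd.trans h1)
  have ha4 : a ≤ 1 / 4 := han.trans (by gcongr)
  have hA : (Finset.univ : Finset (Fin m × Fin m)).Nonempty :=
    ⟨(⟨0, hm⟩, ⟨0, hm⟩), Finset.mem_univ _⟩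
  have hsm := IIDPoints.measureReal_card_isolatedCluster_le (ι := Fin n) (unifLaw n)
    (Finset.univ : Finset (Fin m × Fin m)) hA (fun c => centreCell n r c)
    (fun c => centreCell n r c) (fun c => measurableSet_centreCell n r c)
    (fun c => measurableSet_centreCell n r c) (fun c => subset_rfl)
    (fun c _ c' _ hcc => Set.disjoint_left.2 fun p hp hp' =>
      hcc (eq_of_mem_centreCell hr0 hp hp')) (a := a) (z := a) ha0 (by linarith)
    (fun c _ => unifLaw_centreCell hr hn3 c) (fun c _ => unifLaw_centreCell hr hn3 c) (m := 2)
    (by rw [Fintype.card_fin]; omega) rfl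
  rw [Fintype.card_fin, Finset.card_univ, Fintype.card_prod, Fintype.card_fin] at hsm
  set q : ℝ := (n.choose 2 : ℝ) * (a ^ 2 * (1 - a) ^ (n - 2)) with hq
  have hexp := Real.exp_neg_two_mul_le_one_sub ha0.le (by linarith)
  have hna : n * a ≤ 1 := by
    calc n * a ≤ n * (1 / n) := by gcongr
      _ = 1 := by field_simp
  have hpow : 1 / 8 ≤ (1 - a) ^ (n - 2) := by
    calc (1 / 8 : ℝ) ≤ Real.exp (-2) := by
          have h := Real.exp_neg_one_gt_d9
          rw [show (-2 : ℝ) = -1 + -1 by norm_num, Real.exp_add]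
          nlinarith
      _ ≤ Real.exp (-(2 * a)) ^ n := by
          rw [← Real.exp_nat_mul]; exact Real.exp_le_exp.2 (by linarith)
      _ ≤ (1 - a) ^ n := by gcongr
      _ ≤ (1 - a) ^ (n - 2) := pow_le_pow_of_le_one (by linarith) (by linarith) (by omega)
  have hchoose : (n : ℝ) ^ 2 / 4 ≤ n.choose 2 := by
    rw [Nat.cast_choose_two]; nlinarith
  have hqd : d ^ 4 / 32 ≤ q := by
    calc d ^ 4 / 32 = (n : ℝ) ^ 2 / 4 * (a ^ 2 * (1 / 8)) := by rw [ha]; field_simp; norm_num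
      _ ≤ q := by rw [hq]; gcongr
  have hEZ : r ^ 2 * θ ^ 2 / 3200 ≤ ((m * m : ℕ) : ℝ) * q := by
    calc r ^ 2 * θ ^ 2 / 3200 = (r / 5) ^ 2 * ((θ / 2) ^ 2 / 32) := by ring
      _ ≤ (r / 5) ^ 2 * (d ^ 2 / 32) := by gcongr
      _ = ((m * m : ℕ) : ℝ) * (d ^ 4 / 32) := by
          push_cast; rw [hdef]; field_simp
      _ ≤ _ := by gcongr
  have hpos : 0 < r ^ 2 * θ ^ 2 := by positivity
  have hsub : {x : Fin n → ℝ × ℝ | (pairCells r m x : ℝ) ≤ r ^ 2 * θ ^ 2 / 6400} ⊆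
      {x | (Nat.card {c : Fin m × Fin m // c ∈ Finset.univ ∧ x ∈ IIDPoints.isolatedCluster (Fin n)
        (centreCell n r c) (centreCell n r c) 2} : ℝ) ≤ ((m * m : ℕ) : ℝ) * q / 2} := by
    intro x hx
    rw [Set.mem_ofPred_eq, pairCells] at hx
    rw [Set.mem_ofPred_eq]
    linarith
  rw [← ofReal_measureReal (measure_ne_top _ _)]
  refine ENNReal.ofReal_le_ofReal ((measureReal_mono hsub (measure_ne_top _ _)).trans
    (hsm.trans ?_))
  have hinv : ((1 - a) ^ (2 * 2))⁻¹ ≤ Real.exp (8 * (1 / n)) := by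
    rw [inv_le_comm₀ (pow_pos (by linarith) _) (Real.exp_pos _), ← Real.exp_neg]
    calc Real.exp (-(8 * (1 / n))) ≤ Real.exp (-(2 * a)) ^ (2 * 2) := by
          rw [← Real.exp_nat_mul]
          refine Real.exp_le_exp.2 ?_
          push_cast; linarith
      _ ≤ _ := by gcongr
  have hEZ' : 1 / (((m * m : ℕ) : ℝ) * q) ≤ 3200 / Real.log n := by
    calc 1 / (((m * m : ℕ) : ℝ) * q) ≤ 1 / (r ^ 2 * θ ^ 2 / 3200) := by gcongr
      _ ≤ 1 / (Real.log n / 3200) := by gcongr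
      _ = _ := by field_simp
  linarith

/-- The lower bound for the localization number from pairs of close vertices. -/
theorem le_localizationNumber_of_pairCells {n : ℕ} {r : ℝ} (hr : Admissible n r) (hn : 3 ≤ n)
    {x : Fin n → ℝ × ℝ} (hx : HasFewCuts r (cellCount n r) ⌈16 * Real.log n⌉₊ x)
    (hZ : r ^ 2 * cellScale n r ^ 2 / 6400 < pairCells r (cellCount n r) x) :
    r ^ 2 * cellScale n r ^ 2 / (108800 * Real.log n) ≤
      LocalizationGame.localizationNumber (torusGraph r x) := by
  have : NeZero n := ⟨by omega⟩
  have hlog := one_le_log hn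
  refine LocalizationGame.le_localizationNumber fun k hk hkb => ?_
  have hceil := Nat.ceil_lt_add_one (a := 16 * Real.log n) (by positivity)
  refine not_copsWin_of_lt_pairCells hr hn (Nat.ceil_pos.2 (by positivity)) hx ?_
  rw [lt_div_iff₀ (by positivity)] at hkb
  have h1 : (k : ℝ) * (⌈16 * Real.log n⌉₊ : ℕ) ≤ k * (17 * Real.log n) := by
    gcongr; linarith
  have : (k : ℝ) * (⌈16 * Real.log n⌉₊ : ℕ) < pairCells r (cellCount n r) x := by
    refine lt_of_le_of_lt h1 (lt_of_le_of_lt ?_ hZ)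
    linarith
  exact_mod_cast this

end RandomGeometric

/-! ### Lower bound from clusters of twins -/

namespace RandomGeometric

theorem volume_disc {R : ℝ} (hR : 0 ≤ R) :
    volume {p : ℝ × ℝ | p.1 ^ 2 + p.2 ^ 2 < R ^ 2} = ENNReal.ofReal (Real.pi * R ^ 2) := by
  have hmeas : MeasurableSet {p : ℝ × ℝ | p.1 ^ 2 + p.2 ^ 2 < R ^ 2} :=
    measurableSet_lt (by fun_prop) measurable_const
  rw [← Complex.volume_preserving_equiv_real_prod.measure_preimage hmeas.nullMeasurableSet]
  have : Complex.measurableEquivRealProd ⁻¹' {p : ℝ × ℝ | p.1 ^ 2 + p.2 ^ 2 < R ^ 2} =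
      Metric.ball (0 : ℂ) R := by
    ext w
    rw [Set.mem_preimage, Set.mem_ofPred_eq, Complex.measurableEquivRealProd_apply,
      mem_ball_zero_iff, ← sq_lt_sq₀ (norm_nonneg w) hR, Complex.sq_norm, Complex.normSq_apply,
      sq, sq]
  rw [this, Complex.volume_ball, mul_comm, ENNReal.ofReal_mul Real.pi_pos.le,
    ENNReal.ofReal_pow hR]
  congr 1
  rw [← NNReal.coe_real_pi, ENNReal.ofReal_coe_nnreal]

/-- A small square with a corner at the origin. -/
def twinCell (d : ℝ) : Set (ℝ × ℝ) := Set.Ico 0 d ×ˢ Set.Ico 0 d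

/-- The points close to the circle of radius `r` about the origin. -/
def twinAnnulus (r d : ℝ) : Set (ℝ × ℝ) :=
  {p | p.1 ^ 2 + p.2 ^ 2 < (r + 2 * d) ^ 2} \ {p | p.1 ^ 2 + p.2 ^ 2 < (r - 2 * d) ^ 2}

theorem measurableSet_twinCell (d : ℝ) : MeasurableSet (twinCell d) :=
  measurableSet_Ico.prod measurableSet_Ico

theorem measurableSet_twinAnnulus (r d : ℝ) : MeasurableSet (twinAnnulus r d) :=
  (measurableSet_lt (by fun_prop) measurable_const).diff
    (measurableSet_lt (by fun_prop) measurable_const)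

theorem volume_twinCell {d : ℝ} (hd : 0 ≤ d) : volume.real (twinCell d) = d ^ 2 := by
  rw [twinCell, measureReal_def, Measure.volume_eq_prod, Measure.prod_prod, Real.volume_Ico,
    ENNReal.toReal_mul, sub_zero, ENNReal.toReal_ofReal hd, sq]

theorem volume_twinAnnulus {r d : ℝ} (hd : 0 ≤ d) (hdr : 2 * d ≤ r) :
    volume.real (twinAnnulus r d) = 8 * Real.pi * (r * d) := by
  have hpi := Real.pi_pos
  rw [measureReal_def, twinAnnulus, measure_sdiff, volume_disc (by linarith),
    volume_disc (by linarith), ← ENNReal.ofReal_sub _ (by positivity), ENNReal.toReal_ofReal]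
  · ring
  · have : Real.pi * (r + 2 * d) ^ 2 - Real.pi * (r - 2 * d) ^ 2 = 8 * Real.pi * (r * d) := by ring
    rw [this]
    have : 0 ≤ r := by linarith
    positivity
  · intro p hp
    rw [Set.mem_ofPred_eq] at hp ⊢
    nlinarith
  · exact (measurableSet_lt (by fun_prop) measurable_const).nullMeasurableSet
  · rw [volume_disc (by linarith)]; exact ENNReal.ofReal_ne_top

/-- If a small square contains several points and the annulus of radius `r` about it contains no
further ones, then these points are twins. -/
theorem torusGraph_adj_iff_of_isolated {n : ℕ} {r d : ℝ} {x : Fin n → ℝ × ℝ} {c : ℝ × ℝ}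
    (hd : 0 < d) (hdr : 4 * d ≤ r)
    (hsq : ∀ i, x i ∈ Set.Icc (0 : ℝ) (√n) ×ˢ Set.Icc (0 : ℝ) (√n))
    (hc1 : |c.1 - √n / 2| + (r + 2 * d) < √n / 2) (hc2 : |c.2 - √n / 2| + (r + 2 * d) < √n / 2)
    (hiso : ∀ i, x i - c ∈ twinAnnulus r d → x i - c ∈ twinCell d) {u v w : Fin n}
    (hu : x u - c ∈ twinCell d) (hv : x v - c ∈ twinCell d) (hwu : w ≠ u) (hwv : w ≠ v) :
    (torusGraph r x).Adj w u ↔ (torusGraph r x).Adj w v := by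
  have hcell : ∀ i, x i - c ∈ twinCell d → torusDist (√n) c (x i) ≤ 3 / 2 * d := by
    rintro i ⟨⟨h1, h2⟩, h3, h4⟩
    simp only [Prod.fst_sub, Prod.snd_sub] at h1 h2 h3 h4
    refine torusDist_le_of_sq ?_ (by linarith)
    nlinarith
  -- Every point of the cell is within `√2 d < 3d/2` of `c`. A neighbour `w` outside the cell is
  -- within `r + 3d/2` of `c` and not in the annulus, hence within `r - 2d`. Adjacency thus depends
  -- on `c` alone.
  have key : ∀ i, w ≠ i → x i - c ∈ twinCell d →
      ((torusGraph r x).Adj w i ↔ torusDist (√n) (x w) c < r - 3 / 2 * d) := by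
    intro i hwi hi
    constructor
    · rintro ⟨-, hadj⟩
      have h1 : torusDist (√n) (x w) c ≤ r + 3 / 2 * d := by
        have := torusDist_triangle (√n) (x w) (x i) c
        rw [torusDist_comm _ (x i) c] at this
        linarith [hcell i hi]
      by_cases hw : x w - c ∈ twinCell d
      · have := hcell w hw
        rw [torusDist_comm] at this
        linarith
      · have hnot := fun h => hw (hiso w h)
        have habs : ∀ a b : ℝ, 0 ≤ a → a ≤ √n → |b - √n / 2| + (r + 2 * d) < √n / 2 →
            |a - b| + (r + 3 / 2 * d) < √n := by
          intro a b h0 h1 hb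
          have : |a - b| ≤ √n / 2 + |b - √n / 2| := by
            have e := abs_sub_le a (√n / 2) b
            rw [abs_sub_comm (√n / 2) b] at e
            have : |a - √n / 2| ≤ √n / 2 := abs_le.2 ⟨by linarith, by linarith⟩
            linarith
          linarith
        have h2 := sq_le_of_torusDist_le (habs _ _ (hsq w).1.1 (hsq w).1.2 hc1)
          (habs _ _ (hsq w).2.1 (hsq w).2.2 hc2) h1
        have h3 : ((x w).1 - c.1) ^ 2 + ((x w).2 - c.2) ^ 2 < (r - 2 * d) ^ 2 := by
          by_contra h3
          refine hnot ⟨?_, h3⟩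
          rw [Set.mem_ofPred_eq]
          simp only [Prod.fst_sub, Prod.snd_sub]
          nlinarith
        have := torusDist_le_of_sq (L := √n) h3.le (by linarith)
        linarith
    · intro h
      refine ⟨hwi, ?_⟩
      linarith [torusDist_triangle (√n) (x w) c (x i), hcell i hi]
  rw [key u hwu hu, key v hwv hv]

/-- A cluster of twins cannot be resolved by sensors unless almost all of them carry one. -/
theorem not_copsWin_of_twins {V : Type*} {G : SimpleGraph V} {K : Set V}
    (hK : ∀ u ∈ K, ∀ v ∈ K, u ≠ v → G.Adj u v)
    (h : ∀ u ∈ K, ∀ v ∈ K, ∀ w, w ≠ u → w ≠ v → (G.Adj w u ↔ G.Adj w v)) {k : ℕ}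
    (hk : k + 1 < K.ncard) : ¬ LocalizationGame.CopsWin G k := by
  classical
  refine LocalizationGame.not_copsWin_of_clique hK fun S hS => ?_
  have h1 : 1 < (K \ S).ncard := by
    have := Set.le_ncard_sdiff (S : Set V) K
    rw [Set.ncard_coe_finset, hS] at this
    omega
  obtain ⟨u, v, hu, hv, huv⟩ := (Set.one_lt_ncard_iff (Set.finite_of_ncard_pos (by omega))).1 h1
  refine ⟨u, hu.1, v, hv.1, huv, fun s hs => ?_⟩
  refine SimpleGraph.edist_eq_of_twins ?_ ?_ (h u hu.1 v hv.1)
  · rintro rfl; exact hu.2 hs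
  · rintro rfl; exact hv.2 hs

/-- The side of the squares in which twins are sought. -/
noncomputable def twinSide (n : ℕ) (r : ℝ) : ℝ := Real.log n / (540 * r)

/-- The number of twins sought. -/
noncomputable def twinCount (n : ℕ) (r : ℝ) : ℕ :=
  ⌊Real.log n / (583200 * Real.log (r ^ 2 / Real.log n))⌋₊

/-- The positions at which twins are sought. -/
noncomputable def twinCentre (n : ℕ) (r : ℝ) (c : ℕ × ℕ) : ℝ × ℝ :=
  (√n / 2 + 3 * r * c.1, √n / 2 + 3 * r * c.2)

/-- The indices of the positions at which twins are sought. -/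
noncomputable def twinIndices (n : ℕ) (r : ℝ) : Finset (ℕ × ℕ) :=
  Finset.range ⌊√n / (24 * r)⌋₊ ×ˢ Finset.range ⌊√n / (24 * r)⌋₊

/-- There is an isolated cluster at one of the positions considered. -/
def HasTwins {n : ℕ} (r : ℝ) (x : Fin n → ℝ × ℝ) : Prop :=
  ∃ c ∈ twinIndices n r, Nat.card {i // x i - twinCentre n r c ∈ twinCell (twinSide n r)} =
    twinCount n r ∧ ∀ i, x i - twinCentre n r c ∈ twinAnnulus r (twinSide n r) →
      x i - twinCentre n r c ∈ twinCell (twinSide n r)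

theorem twinSide_bounds {n : ℕ} {r : ℝ} (hr : Admissible n r) (hn : 3 ≤ n) :
    0 < twinSide n r ∧ 1000 * twinSide n r ≤ r ∧ r * twinSide n r = Real.log n / 540 ∧
      twinSide n r ^ 2 ≤ Real.log n / 540 := by
  have hr0 := hr.pos hn
  have hlog := one_le_log hn
  have h4900 := hr.log_le hn
  have h1 : r * twinSide n r = Real.log n / 540 := by rw [twinSide]; field_simp
  have h0 : 0 < twinSide n r := by rw [twinSide]; positivity
  have h2 : 1000 * twinSide n r ≤ r := by
    rw [twinSide, ← mul_div_assoc, div_le_iff₀ (by positivity)]; nlinarith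
  exact ⟨h0, h2, h1, by nlinarith⟩

theorem twinCentre_bounds {n : ℕ} {r : ℝ} (hr : 0 < r) {c : ℕ × ℕ} (hc : c ∈ twinIndices n r) :
    (|(twinCentre n r c).1 - √n / 2| + 3 * r ≤ √n / 8) ∧
      |(twinCentre n r c).2 - √n / 2| + 3 * r ≤ √n / 8 := by
  have key : ∀ i : ℕ, i < ⌊√n / (24 * r)⌋₊ → |√n / 2 + 3 * r * i - √n / 2| + 3 * r ≤ √n / 8 := by
    intro i hi
    have h1 : (i : ℝ) + 1 ≤ √n / (24 * r) := by
      have : i + 1 ≤ ⌊√n / (24 * r)⌋₊ := hi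
      have := (Nat.le_floor_iff (by positivity)).1 this
      exact_mod_cast this
    rw [le_div_iff₀ (by positivity)] at h1
    rw [add_sub_cancel_left, abs_of_nonneg (by positivity)]
    linarith
  have hc' := Finset.mem_product.1 hc
  exact ⟨key _ (Finset.mem_range.1 hc'.1), key _ (Finset.mem_range.1 hc'.2)⟩

theorem abs_le_of_mem_twinZone {r d : ℝ} (hd : 0 < d) (hdr : 1000 * d ≤ r) {p : ℝ × ℝ}
    (hp : p ∈ twinCell d ∪ twinAnnulus r d) : |p.1| < 3 / 2 * r ∧ |p.2| < 3 / 2 * r := by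
  rcases hp with ⟨h1, h2⟩ | ⟨h1, -⟩
  · exact ⟨abs_lt.2 ⟨by linarith [h1.1], by linarith [h1.2]⟩,
      abs_lt.2 ⟨by linarith [h2.1], by linarith [h2.2]⟩⟩
  · rw [Set.mem_ofPred_eq] at h1
    exact ⟨(abs_lt_of_sq_lt_sq (by nlinarith [sq_nonneg p.2] : p.1 ^ 2 < (r + 2 * d) ^ 2)
      (by linarith)).trans (by linarith),
      (abs_lt_of_sq_lt_sq (by nlinarith [sq_nonneg p.1] : p.2 ^ 2 < (r + 2 * d) ^ 2)
      (by linarith)).trans (by linarith)⟩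

/-- The lower bound for the localization number from clusters of twins. -/
theorem le_localizationNumber_of_hasTwins {n : ℕ} {r : ℝ} (hr : Admissible n r) (hn : 3 ≤ n)
    (hlarge : 3499200 * Real.log (r ^ 2 / Real.log n) ≤ Real.log n)
    {x : Fin n → ℝ × ℝ}
    (hsq : ∀ i, x i ∈ Set.Icc (0 : ℝ) (√n) ×ˢ Set.Icc (0 : ℝ) (√n)) (hx : HasTwins r x) :
    1 / 1166400 * (Real.log n / Real.log (r ^ 2 / Real.log n)) ≤
      LocalizationGame.localizationNumber (torusGraph r x) := by
  have : NeZero n := ⟨by omega⟩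
  have hr0 := hr.pos hn
  have hlog := one_le_log hn
  have hρ : 4900 ≤ r ^ 2 / Real.log n := by
    rw [le_div_iff₀ (by positivity)]; exact hr.log_le hn
  have hlogρ : 0 < Real.log (r ^ 2 / Real.log n) := Real.log_pos (by linarith)
  obtain ⟨hd0, hdr, -, -⟩ := twinSide_bounds hr hn
  obtain ⟨c, hc, hcard, hiso⟩ := hx
  obtain ⟨hc1, hc2⟩ := twinCentre_bounds hr0 hc
  set d := twinSide n r
  set K : Set (Fin n) := {i | x i - twinCentre n r c ∈ twinCell d}
  refine LocalizationGame.le_localizationNumber fun k hk hkb => ?_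
  have htw : ∀ u ∈ K, ∀ v ∈ K, ∀ w, w ≠ u → w ≠ v →
      ((torusGraph r x).Adj w u ↔ (torusGraph r x).Adj w v) := by
    intro u hu v hv w hwu hwv
    exact torusGraph_adj_iff_of_isolated hd0 (by linarith) hsq (by linarith [Real.sqrt_nonneg n])
      (by linarith [Real.sqrt_nonneg n]) hiso hu hv hwu hwv
  refine not_copsWin_of_twins (G := torusGraph r x) (K := K) (fun u hu v hv huv => ⟨huv, ?_⟩) htw ?_
  · refine torusDist_le_of_sq ?_ hr0.le
    obtain ⟨⟨h1, h2⟩, h3, h4⟩ := hu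
    obtain ⟨⟨h5, h6⟩, h7, h8⟩ := hv
    simp only [Prod.fst_sub, Prod.snd_sub] at h1 h2 h3 h4 h5 h6 h7 h8
    have e1 : ((x u).1 - (x v).1) ^ 2 ≤ d ^ 2 := sq_le_sq' (by linarith) (by linarith)
    have e2 : ((x u).2 - (x v).2) ^ 2 ≤ d ^ 2 := sq_le_sq' (by linarith) (by linarith)
    nlinarith
  · have hK : K.ncard = twinCount n r := by rw [← hcard]; rfl
    rw [hK]
    set Y := Real.log n / Real.log (r ^ 2 / Real.log n) with hY
    -- As `3499200 = 3 · 1166400`, the gap between `Y/583200` and `Y/1166400` is at least 3, which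
    -- absorbs the floor and the one twin that may go without a sensor.
    have hY6 : 3499200 ≤ Y := by rw [hY, le_div_iff₀ hlogρ]; exact hlarge
    have h1 : Real.log n / (583200 * Real.log (r ^ 2 / Real.log n)) = Y / 583200 := by
      rw [hY]; field_simp
    refine Nat.lt_of_succ_le (Nat.le_floor ?_)
    rw [h1]
    push_cast
    linarith

/-- The order of the error terms in the second moment argument for twins. -/
noncomputable def twinError (n : ℕ) : ℝ := Real.log n ^ 2 * Real.exp (-(4 / 5 * Real.log n))

theorem tendsto_twinError : Tendsto twinError atTop (𝓝 0) := by
  have h1 : Tendsto (fun n : ℕ => 4 / 5 * Real.log n) atTop atTop :=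
    (Real.tendsto_log_atTop.comp tendsto_natCast_atTop_atTop).const_mul_atTop (by norm_num)
  have h2 := ((Real.tendsto_pow_mul_exp_neg_atTop_nhds_zero 2).comp h1).const_mul (25 / 16)
  rw [mul_zero] at h2
  refine h2.congr fun n => ?_
  simp only [Function.comp, twinError]
  ring

theorem pow_div_le_choose_mul_pow {n m : ℕ} (hm : 2 * m ≤ n) (hm0 : 0 < m) {s : ℝ} (hs : 0 ≤ s) :
    (s / (2 * m)) ^ m ≤ n.choose m * (s / n) ^ m := by
  have hn : (0 : ℝ) < n := by exact_mod_cast (by omega : 0 < n)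
  have hm' : (0 : ℝ) < m := by exact_mod_cast hm0
  have h1 : (n / 2 : ℝ) ^ m / (m : ℝ) ^ m ≤ n.choose m := by
    refine le_trans ?_ (Nat.pow_le_choose m n)
    have h2 : (n / 2 : ℝ) ≤ ((n + 1 - m : ℕ) : ℝ) := by
      rw [Nat.cast_sub (by omega)]
      have : (2 : ℝ) * m ≤ n := by exact_mod_cast hm
      push_cast; linarith
    gcongr
    exact_mod_cast Nat.factorial_le_pow m
  calc (s / (2 * m)) ^ m = (n / 2 : ℝ) ^ m / (m : ℝ) ^ m * (s / n) ^ m := by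
        rw [← div_pow, ← mul_pow]; congr 1; field_simp
    _ ≤ _ := by gcongr

/-- Since `583200 = 2 · 540²`, the bound `m ≤ log n / 583200` gives `d²/(2m) ≥ (r²/log n)⁻¹`. The
`m`-th power of the right side is at least `n^(-1/583200)` exactly when `m log(r²/log n) ≤ log n /
583200`, whence the denominator in `twinCount`. -/
theorem twinCount_bounds {n : ℕ} {r : ℝ} (hr : Admissible n r) (hn : 3 ≤ n)
    (hlarge : 3499200 * Real.log (r ^ 2 / Real.log n) ≤ Real.log n) :
    0 < twinCount n r ∧ (twinCount n r : ℝ) ≤ Real.log n / 583200 ∧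
      Real.exp (-(Real.log n / 583200)) ≤
        (twinSide n r ^ 2 / (2 * twinCount n r)) ^ twinCount n r := by
  have hr0 := hr.pos hn
  have hlog := one_le_log hn
  have hρ : 4900 ≤ r ^ 2 / Real.log n := by
    rw [le_div_iff₀ (by positivity)]; exact hr.log_le hn
  have hlogρ : 1 ≤ Real.log (r ^ 2 / Real.log n) := by
    rw [Real.le_log_iff_exp_le (by linarith)]
    linarith [Real.exp_one_lt_d9]
  have hm0 : 0 < twinCount n r := by
    refine Nat.floor_pos.2 ?_
    rw [le_div_iff₀ (by positivity)]; linarith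
  set m := twinCount n r
  have hm' : (0 : ℝ) < m := by exact_mod_cast hm0
  have hm1 : m * Real.log (r ^ 2 / Real.log n) ≤ Real.log n / 583200 := by
    have : (m : ℝ) ≤ Real.log n / (583200 * Real.log (r ^ 2 / Real.log n)) :=
      Nat.floor_le (by positivity)
    rw [le_div_iff₀ (by positivity)] at this ⊢
    linarith
  have hm2 : (m : ℝ) ≤ Real.log n / 583200 := le_trans (by nlinarith) hm1
  refine ⟨hm0, hm2, ?_⟩
  have hbase : (r ^ 2 / Real.log n)⁻¹ ≤ twinSide n r ^ 2 / (2 * m) := by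
    rw [le_div_iff₀ (by positivity), twinSide, div_pow, inv_div, mul_pow, div_mul_eq_mul_div,
      div_le_div_iff₀ (by positivity) (by positivity)]
    calc Real.log n * (2 * m) * (540 ^ 2 * r ^ 2)
        ≤ Real.log n * (2 * (Real.log n / 583200)) * (540 ^ 2 * r ^ 2) := by gcongr
      _ = Real.log n ^ 2 * r ^ 2 := by ring
  calc Real.exp (-(Real.log n / 583200))
      ≤ Real.exp (-(m * Real.log (r ^ 2 / Real.log n))) := Real.exp_le_exp.2 (by linarith)
    _ = ((r ^ 2 / Real.log n)⁻¹) ^ m := by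
        rw [inv_pow, Real.exp_neg, Real.exp_nat_mul, Real.exp_log (by linarith)]
    _ ≤ _ := by
        have : 0 ≤ (r ^ 2 / Real.log n)⁻¹ := by positivity
        gcongr

/-- The annulus is free of points with probability at least `n^(-1/10)`, and the cluster costs only
a small further power of `n`, so a position succeeds with probability at least `n^(-1/5)`. As `r <
log n`, there are at least `n / (2304 log² n)` disjoint positions, and the expected number of
successes tends to infinity. The correlation factor `(1 - z)^(-2m) ≤ exp(4mz)` tends to 1. -/
theorem negligible_not_hasTwins : Negligible
    (fun n r => Admissible n r ∧ 3499200 * Real.log (r ^ 2 / Real.log n) ≤ Real.log n ∧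
      r < Real.log n) fun _ r => {x | ¬ HasTwins r x} := by
  have hlim : Tendsto (fun n => 4 * (2304 * twinError n + (Real.exp (twinError n) - 1))) atTop
      (𝓝 0) := by
    have e2 : Tendsto (fun n => Real.exp (twinError n)) atTop (𝓝 (Real.exp 0)) :=
      (Real.continuous_exp.tendsto _).comp tendsto_twinError
    have := ((tendsto_twinError.const_mul 2304).add (e2.sub_const 1)).const_mul 4
    simpa using this
  refine negligible_of_le hlim ?_
  have hbig : ∀ᶠ n : ℕ in atTop, 24 * Real.log n ≤ √n := by
    have h := (isLittleO_log_rpow_atTop (r := 1 / 2) (by norm_num)).bound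
      (show (0 : ℝ) < 1 / 24 by norm_num)
    filter_upwards [tendsto_natCast_atTop_atTop.eventually h, eventually_ge_atTop 3] with n h hn
    have := one_le_log hn
    rw [Real.norm_of_nonneg (by linarith), Real.norm_of_nonneg (by positivity),
      ← Real.sqrt_eq_rpow] at h
    linarith
  filter_upwards [eventually_ge_atTop 3, hbig] with n hn hnbig r hr
  obtain ⟨hr, hlarge, hrlog⟩ := hr
  have : NeZero n := ⟨by omega⟩
  have hr0 := hr.pos hn
  have hlog := one_le_log hn
  have hn0 : (0 : ℝ) < n := by exact_mod_cast (by omega : 0 < n)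
  have hsqrt : √(n : ℝ) ^ 2 = n := Real.sq_sqrt hn0.le
  have hlogn : Real.log n ≤ n := by linarith [Real.log_le_sub_one_of_pos hn0]
  obtain ⟨hd0, hdr, hrd, hdd⟩ := twinSide_bounds hr hn
  obtain ⟨hm0, hm1, hm2⟩ := twinCount_bounds hr hn hlarge
  set d := twinSide n r with hddef
  set m := twinCount n r with hmdef
  let D : ℕ × ℕ → Set (ℝ × ℝ) := fun c => (fun p => p + -twinCentre n r c) ⁻¹' twinCell d
  let B : ℕ × ℕ → Set (ℝ × ℝ) := fun c =>
    (fun p => p + -twinCentre n r c) ⁻¹' (twinCell d ∪ twinAnnulus r d)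
  have hzone := (measurableSet_twinCell d).union (measurableSet_twinAnnulus r d)
  have hadd : ∀ c, Measurable fun p : ℝ × ℝ => p + -twinCentre n r c :=
    fun c => measurable_id.add_const _
  have hDB : ∀ c, D c ⊆ B c := fun c => Set.preimage_mono Set.subset_union_left
  have hBabs : ∀ c, ∀ p ∈ B c, |p.1 - (twinCentre n r c).1| < 3 / 2 * r ∧
      |p.2 - (twinCentre n r c).2| < 3 / 2 * r := fun c p hp => by
    have := abs_le_of_mem_twinZone hd0 hdr hp
    simpa [sub_eq_add_neg] using this
  have hBsub : ∀ c ∈ twinIndices n r, B c ⊆ Set.Icc (0 : ℝ) (√n) ×ˢ Set.Icc (0 : ℝ) (√n) := by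
    intro c hc p hp
    obtain ⟨h1, h2⟩ := twinCentre_bounds hr0 hc
    obtain ⟨h3, h4⟩ := hBabs c p hp
    have key : ∀ a b : ℝ, |a - b| < 3 / 2 * r → |b - √n / 2| + 3 * r ≤ √n / 8 →
        a ∈ Set.Icc 0 √n := by
      intro a b h h'
      have e := (abs_sub_le a b (√n / 2)).trans (by linarith : _ ≤ √n / 2)
      rw [abs_le] at e
      exact ⟨by linarith, by linarith⟩
    exact ⟨key _ _ h3 h1, key _ _ h4 h2⟩
  have hdisj : ∀ c ∈ twinIndices n r, ∀ c' ∈ twinIndices n r, c ≠ c' →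
      Disjoint (B c) (B c') := by
    intro c _ c' _ hcc
    refine Set.disjoint_left.2 fun p hp hp' => hcc ?_
    obtain ⟨h1, h2⟩ := hBabs c p hp
    obtain ⟨h3, h4⟩ := hBabs c' p hp'
    have key : ∀ (i j : ℕ) (t : ℝ), |t - (√n / 2 + 3 * r * i)| < 3 / 2 * r →
        |t - (√n / 2 + 3 * r * j)| < 3 / 2 * r → i = j := by
      intro i j t hi hj
      rw [abs_lt] at hi hj
      have a1 : (i : ℝ) < j + 1 := by
        by_contra! hlt
        nlinarith
      have a2 : (j : ℝ) < i + 1 := by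
        by_contra! hlt
        nlinarith
      have a1' : i < j + 1 := by exact_mod_cast a1
      have a2' : j < i + 1 := by exact_mod_cast a2
      omega
    exact Prod.ext (key _ _ _ h1 h3) (key _ _ _ h2 h4)
  set a := d ^ 2 / n with ha
  set z := volume.real (twinCell d ∪ twinAnnulus r d) / n with hz
  have ha0 : 0 < a := by positivity
  have hvol : ∀ (c : ℕ × ℕ) (E : Set (ℝ × ℝ)),
      volume.real ((fun p => p + -twinCentre n r c) ⁻¹' E) = volume.real E := fun c E => by
    rw [measureReal_def, measure_preimage_add_right, measureReal_def]
  have hDa : ∀ c ∈ twinIndices n r, (unifLaw n).real (D c) = a := fun c hc => by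
    rw [unifLaw_real_of_subset ((hDB c).trans (hBsub c hc)), hvol, volume_twinCell hd0.le]
  have hBz : ∀ c ∈ twinIndices n r, (unifLaw n).real (B c) = z := fun c hc => by
    rw [unifLaw_real_of_subset (hBsub c hc), hvol]
  have hz0 : 0 ≤ z := by positivity
  -- The zone has area at most `d² + 8π r d ≤ (1 + 8 · 3.15) log n / 540`; the constant 540 is
  -- chosen to make this below `log n / 20`.
  have hzn : n * z ≤ Real.log n / 20 := by
    have h1 := measureReal_union_le (μ := volume) (twinCell d) (twinAnnulus r d)
    rw [volume_twinCell hd0.le, volume_twinAnnulus hd0.le (by linarith), hrd] at h1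
    have h2 : n * z = volume.real (twinCell d ∪ twinAnnulus r d) := by rw [hz]; field_simp
    rw [h2]
    have h3 : 8 * Real.pi * (Real.log n / 540) ≤ 8 * 3.15 * (Real.log n / 540) := by
      gcongr; exact Real.pi_lt_d2.le
    linarith
  have hz2 : z ≤ 1 / 20 := by
    by_contra! h
    nlinarith
  have h2m : 2 * m ≤ n := by
    have : (2 * m : ℝ) ≤ n := by linarith
    exact_mod_cast this
  set κ := ⌊√n / (24 * r)⌋₊ with hκ
  have hκ1 : 1 ≤ √n / (24 * r) := by rw [le_div_iff₀ (by positivity)]; linarith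
  have hκ0 : 0 < κ := Nat.floor_pos.2 hκ1
  have hκ2 : √n / (48 * r) ≤ κ := by
    have h1 := Nat.lt_floor_add_one (√n / (24 * r))
    have h2 : (1 : ℝ) ≤ κ := by exact_mod_cast hκ0
    have h3 : √n / (48 * r) = √n / (24 * r) / 2 := by field_simp; norm_num
    rw [h3]
    linarith
  have hA : (twinIndices n r).Nonempty :=
    ⟨(0, 0), Finset.mem_product.2 ⟨Finset.mem_range.2 hκ0, Finset.mem_range.2 hκ0⟩⟩
  have hAc : ((twinIndices n r).card : ℝ) = κ ^ 2 := by
    rw [twinIndices, Finset.card_product, Finset.card_range, sq]; push_cast; rfl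
  have hsm := IIDPoints.measureReal_card_isolatedCluster_le (ι := Fin n) (unifLaw n)
    (twinIndices n r) hA D B (fun c => hadd c (measurableSet_twinCell d)) (fun c => hadd c hzone)
    hDB hdisj ha0 (by linarith) hDa hBz (m := m) (by rw [Fintype.card_fin]; exact h2m) rfl
  rw [Fintype.card_fin, hAc] at hsm
  set q : ℝ := (n.choose m : ℝ) * (a ^ m * (1 - z) ^ (n - m)) with hq
  have hexp := Real.exp_neg_two_mul_le_one_sub hz0 (by linarith)
  have hpow : Real.exp (-(Real.log n / 10)) ≤ (1 - z) ^ (n - m) := by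
    calc Real.exp (-(Real.log n / 10)) ≤ Real.exp (-(2 * z)) ^ n := by
          rw [← Real.exp_nat_mul]; exact Real.exp_le_exp.2 (by linarith)
      _ ≤ (1 - z) ^ n := by gcongr
      _ ≤ _ := pow_le_pow_of_le_one (by linarith) (by linarith) (by omega)
  have hqlow : Real.exp (-(Real.log n / 5)) ≤ q := by
    calc Real.exp (-(Real.log n / 5))
        ≤ Real.exp (-(Real.log n / 583200)) * Real.exp (-(Real.log n / 10)) := by
          rw [← Real.exp_add]; exact Real.exp_le_exp.2 (by linarith)
      _ ≤ (n.choose m * (d ^ 2 / n) ^ m) * (1 - z) ^ (n - m) := by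
          gcongr
          exact hm2.trans (pow_div_le_choose_mul_pow h2m hm0 (by positivity))
      _ = q := by rw [hq, ha]; ring
  have hlogexp : Real.exp (Real.log n) = n := Real.exp_log hn0
  have hEZ : 1 / (2304 * twinError n) ≤ (κ : ℝ) ^ 2 * q := by
    calc 1 / (2304 * twinError n)
        = (n / (2304 * Real.log n ^ 2)) * Real.exp (-(Real.log n / 5)) := by
          rw [twinError, ← hlogexp, Real.log_exp, show -(4 / 5 * Real.log n) =
            -Real.log n + Real.log n / 5 by ring, Real.exp_add, Real.exp_neg, Real.exp_neg]
          field_simp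
      _ ≤ (n / (2304 * r ^ 2)) * Real.exp (-(Real.log n / 5)) := by gcongr
      _ = (√n / (48 * r)) ^ 2 * Real.exp (-(Real.log n / 5)) := by
          rw [div_pow, hsqrt, mul_pow]; norm_num
      _ ≤ _ := by gcongr
  have herr : 0 < twinError n := by rw [twinError]; positivity
  have hEZ' : 1 / ((κ : ℝ) ^ 2 * q) ≤ 2304 * twinError n := by
    rw [one_div_le (lt_of_lt_of_le (by positivity) hEZ) (by positivity)]
    exact hEZ
  have hinv : ((1 - z) ^ (2 * m))⁻¹ ≤ Real.exp (twinError n) := by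
    rw [inv_le_comm₀ (pow_pos (by linarith) _) (Real.exp_pos _), ← Real.exp_neg]
    calc Real.exp (-twinError n) ≤ Real.exp (-(2 * z)) ^ (2 * m) := by
          rw [← Real.exp_nat_mul]
          refine Real.exp_le_exp.2 ?_
          have h1 : z ≤ Real.log n * Real.exp (-Real.log n) := by
            rw [Real.exp_neg, hlogexp, ← div_eq_mul_inv, le_div_iff₀ hn0]
            linarith
          have h2 : Real.exp (-Real.log n) ≤ Real.exp (-(4 / 5 * Real.log n)) :=
            Real.exp_le_exp.2 (by linarith)
          have h3 : (4 * m) * z ≤ Real.log n * (Real.log n * Real.exp (-Real.log n)) :=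
            mul_le_mul (by linarith) h1 hz0 (by linarith)
          have h4 : Real.log n * (Real.log n * Real.exp (-Real.log n)) ≤ twinError n := by
            rw [twinError, sq, mul_assoc]
            gcongr
          push_cast
          linarith
      _ ≤ _ := by gcongr
  have hsub : {x : Fin n → ℝ × ℝ | ¬ HasTwins r x} ⊆
      {x | (Nat.card {c // c ∈ twinIndices n r ∧
        x ∈ IIDPoints.isolatedCluster (Fin n) (D c) (B c) m} : ℝ) ≤ (κ : ℝ) ^ 2 * q / 2} := by
    intro x hx
    rw [Set.mem_ofPred_eq] at hx ⊢
    have hempty : IsEmpty {c // c ∈ twinIndices n r ∧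
        x ∈ IIDPoints.isolatedCluster (Fin n) (D c) (B c) m} := by
      refine ⟨fun ⟨c, hc, h1, h2⟩ => hx ⟨c, hc, ?_, fun i hi => ?_⟩⟩
      · simpa only [D, Set.mem_preimage, ← sub_eq_add_neg] using h1
      · have : x i ∈ B c := by
          change x i + -twinCentre n r c ∈ twinCell d ∪ twinAnnulus r d
          rw [← sub_eq_add_neg]; exact Or.inr hi
        have := h2 i this
        simpa only [D, Set.mem_preimage, ← sub_eq_add_neg] using this
    rw [Nat.card_of_isEmpty]
    have : 0 < q := (Real.exp_pos _).trans_le hqlow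
    push_cast
    positivity
  rw [← ofReal_measureReal (measure_ne_top _ _)]
  refine ENNReal.ofReal_le_ofReal ((measureReal_mono hsub (measure_ne_top _ _)).trans
    (hsm.trans ?_))
  linarith

end RandomGeometric

/-! ### The four regimes -/

namespace RandomGeometric

theorem Negligible.restrict {A P : ℕ → ℝ → Prop} {B : ∀ n : ℕ, ℝ → Set (Fin n → ℝ × ℝ)}
    (h : Negligible (fun n r => A n r ∧ P n r) B) :
    Negligible A fun n r => {x | P n r ∧ x ∈ B n r} := by
  intro ε hε
  filter_upwards [h ε hε] with n h1 r hr
  by_cases hP : P n r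
  · exact (measure_mono fun x hx => hx.2).trans (h1 r ⟨hr, hP⟩)
  · simp [hP]

/-- No measurability of the good event is needed: subadditivity alone bounds its measure below by
one minus that of the bad event. -/
theorem Negligible.tendsto_one {A : ℕ → ℝ → Prop} {B : ∀ n : ℕ, ℝ → Set (Fin n → ℝ × ℝ)}
    (h : Negligible A B) {r : ℕ → ℝ} (hr : ∀ᶠ n in atTop, A n (r n))
    {S : ∀ n : ℕ, Set (Fin n → ℝ × ℝ)}
    (hS : ∀ᶠ n in atTop, ∀ᵐ x ∂(pointsLaw n), x ∉ B n (r n) → x ∈ S n) :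
    Tendsto (fun n => pointsLaw n (S n)) atTop (𝓝 1) := by
  have hB : Tendsto (fun n => pointsLaw n (B n (r n))) atTop (𝓝 0) := by
    rw [ENNReal.tendsto_nhds_zero]
    intro ε hε
    filter_upwards [h ε hε, hr] with n h1 h2 using h1 _ h2
  have hlow : Tendsto (fun n => 1 - pointsLaw n (B n (r n))) atTop (𝓝 1) := by
    simpa using ENNReal.Tendsto.sub tendsto_const_nhds hB (Or.inl ENNReal.one_ne_top)
  refine tendsto_of_tendsto_of_tendsto_of_le_of_le' hlow tendsto_const_nhds ?_ ?_
  · filter_upwards [hS, eventually_ge_atTop 1] with n hn h1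
    have : NeZero n := ⟨by omega⟩
    rw [tsub_le_iff_right, ← measure_univ (μ := pointsLaw n)]
    refine (measure_mono_ae ?_).trans (measure_union_le _ _)
    filter_upwards [hn] with x hx _
    by_cases hxB : x ∈ B n (r n)
    · exact Or.inr hxB
    · exact Or.inl (hx hxB)
  · filter_upwards [eventually_ge_atTop 1] with n h1
    have : NeZero n := ⟨by omega⟩
    exact prob_le_one

theorem sensorScale_eq_rpow {n : ℕ} {r : ℝ} (hn : 3 ≤ n) (h : Real.log n ^ (3 / 2 : ℝ) ≤ r) :
    sensorScale n r = r ^ (4 / 3 : ℝ) := by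
  have hlog := one_le_log hn
  refine max_eq_left ?_
  calc Real.log n ^ 2 = (Real.log n ^ (3 / 2 : ℝ)) ^ (4 / 3 : ℝ) := by
        rw [← Real.rpow_mul (by positivity), ← Real.rpow_natCast]; norm_num
    _ ≤ _ := by gcongr

theorem sensorScale_eq_log_sq {n : ℕ} {r : ℝ} (hn : 3 ≤ n) (hr : 0 ≤ r)
    (h : r ≤ Real.log n ^ (3 / 2 : ℝ)) : sensorScale n r = Real.log n ^ 2 := by
  have hlog := one_le_log hn
  refine max_eq_right ?_
  calc r ^ (4 / 3 : ℝ) ≤ (Real.log n ^ (3 / 2 : ℝ)) ^ (4 / 3 : ℝ) := by gcongr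
    _ = _ := by rw [← Real.rpow_mul (by positivity), ← Real.rpow_natCast]; norm_num

theorem sq_mul_cellScale_sq_div {n : ℕ} {r : ℝ} (hn : 3 ≤ n) (h : Real.log n ≤ r) :
    r ^ 2 * cellScale n r ^ 2 / Real.log n = r ^ (4 / 3 : ℝ) / Real.log n ^ (1 / 3 : ℝ) := by
  have hlog := one_le_log hn
  have hr0 : 0 < r := by linarith
  have hl0 : 0 < Real.log n := by linarith
  have h1 : cellScale n r = (Real.log n / r) ^ (1 / 3 : ℝ) :=
    min_eq_right (Real.rpow_le_one (by positivity) ((div_le_one hr0).2 h) (by norm_num))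
  have h2 : cellScale n r ^ 2 = Real.log n ^ (2 / 3 : ℝ) / r ^ (2 / 3 : ℝ) := by
    rw [h1, ← Real.rpow_natCast, ← Real.rpow_mul (by positivity), ← Real.div_rpow hl0.le hr0.le]
    norm_num
  have h3 : r ^ 2 = r ^ (4 / 3 : ℝ) * r ^ (2 / 3 : ℝ) := by
    rw [← Real.rpow_add hr0, ← Real.rpow_natCast]; norm_num
  have h4 : Real.log n = Real.log n ^ (2 / 3 : ℝ) * Real.log n ^ (1 / 3 : ℝ) := by
    rw [← Real.rpow_add hl0]; norm_num
  have h5 : 0 < Real.log n ^ (2 / 3 : ℝ) := by positivity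
  have h6 : 0 < Real.log n ^ (1 / 3 : ℝ) := by positivity
  have h7 : 0 < r ^ (2 / 3 : ℝ) := by positivity
  rw [h2, h3]
  nth_rw 2 [h4]
  field_simp

theorem cellScale_eq_one {n : ℕ} {r : ℝ} (hr : 0 < r) (h : r ≤ Real.log n) :
    cellScale n r = 1 :=
  min_eq_left (Real.one_le_rpow ((one_le_div hr).2 h) (by norm_num))

/-- The iterated logarithms in the threshold enter only here: the fourth regime lies within `r < log
n`, which is all that the twin argument asks of them. -/
theorem eventually_lt_log : ∀ᶠ n : ℕ in atTop, ∀ r : ℝ,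
    r < Real.log n / (Real.log (Real.log n) ^ (1 / 2 : ℝ) * Real.log (Real.log (Real.log n))) →
    r < Real.log n := by
  have h0 : Tendsto (fun n : ℕ => Real.log n) atTop atTop :=
    Real.tendsto_log_atTop.comp tendsto_natCast_atTop_atTop
  have h1 := Real.tendsto_log_atTop.comp h0
  have h2 := Real.tendsto_log_atTop.comp h1
  filter_upwards [h0.eventually_ge_atTop 1, h1.eventually_ge_atTop 1, h2.eventually_ge_atTop 1]
    with n e0 e1 e2 r hr
  simp only [Function.comp] at e1 e2
  refine hr.trans_le (div_le_self (by linarith) ?_)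
  have := Real.one_le_rpow e1 (show (0 : ℝ) ≤ 1 / 2 by norm_num)
  nlinarith

theorem eventually_log_le_log : ∀ᶠ n : ℕ in atTop, ∀ r : ℝ, Admissible n r → r < Real.log n →
    3499200 * Real.log (r ^ 2 / Real.log n) ≤ Real.log n := by
  have h0 : Tendsto (fun n : ℕ => Real.log n) atTop atTop :=
    Real.tendsto_log_atTop.comp tendsto_natCast_atTop_atTop
  have h1 := h0.eventually (Real.isLittleO_log_id_atTop.bound
    (show (0 : ℝ) < 1 / 3499200 by norm_num))
  filter_upwards [h1, eventually_ge_atTop 3] with n h1 hn r hr hlt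
  have hlog := one_le_log hn
  have hr0 := hr.pos hn
  rw [id, Real.norm_of_nonneg (Real.log_nonneg hlog), Real.norm_of_nonneg (by linarith)] at h1
  have h2 : Real.log (r ^ 2 / Real.log n) ≤ Real.log (Real.log n) := by
    refine Real.log_le_log (by positivity) ?_
    rw [div_le_iff₀ (by linarith)]
    nlinarith
  linarith

end RandomGeometric

open RandomGeometric

theorem theorem1 :
    ∃ c C : ℝ, 0 < c ∧ 0 < C ∧
      ∀ r : ℕ → ℝ,
        (∀ᶠ n : ℕ in atTop, 70 * √(Real.log n) ≤ r n ∧ r n < √n / 4) →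
        Tendsto
          (fun n : ℕ => RandomGeometric.pointsLaw n
            {x | ∀ ζ : ℝ,
              ζ = LocalizationGame.localizationNumber (RandomGeometric.torusGraph (r n) x) →
              (Real.log n ^ (3 / 2 : ℝ) ≤ r n →
                c * (r n ^ (4 / 3 : ℝ) / Real.log n ^ (1 / 3 : ℝ)) ≤ ζ ∧
                  ζ ≤ C * r n ^ (4 / 3 : ℝ)) ∧
              (Real.log n ≤ r n ∧ r n < Real.log n ^ (3 / 2 : ℝ) →
                c * (r n ^ (4 / 3 : ℝ) / Real.log n ^ (1 / 3 : ℝ)) ≤ ζ ∧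
                  ζ ≤ C * Real.log n ^ 2) ∧
              (Real.log n / (Real.log (Real.log n) ^ (1 / 2 : ℝ) *
                    Real.log (Real.log (Real.log n))) ≤ r n ∧ r n < Real.log n →
                c * (r n ^ 2 / Real.log n) ≤ ζ ∧ ζ ≤ C * r n ^ 2) ∧
              (r n < Real.log n / (Real.log (Real.log n) ^ (1 / 2 : ℝ) *
                    Real.log (Real.log (Real.log n))) →
                c * (Real.log n / Real.log (r n ^ 2 / Real.log n)) ≤ ζ ∧
                  ζ ≤ C * r n ^ 2)})
          atTop (𝓝 1) := by
  have hC0 : 0 ≤ sensorConst := by norm_num [sensorConst]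
  refine ⟨1 / 1166400, sensorConst + 2402, by norm_num, by linarith, fun r hr => ?_⟩
  have hbad := ((((negligible_not_isDense.union negligible_not_hasBoundedBalls).union
    negligible_not_hasSeparators).union negligible_not_hasFewMisses).union
    (negligible_not_hasFewCuts.union negligible_pairCells_le)).union
    negligible_not_hasTwins.restrict
  refine hbad.tendsto_one hr ?_
  filter_upwards [hr, eventually_lt_log, eventually_log_le_log, eventually_ge_atTop 3]
    with n (hrn : Admissible n (r n)) hlt hlog3 hn
  have : NeZero n := ⟨by omega⟩
  filter_upwards [ae_mem_square n] with x hsq hx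
  simp only [Set.mem_union, Set.mem_ofPred_eq, not_or, not_not, not_and, not_le] at hx
  obtain ⟨⟨⟨⟨⟨hdense, hballs⟩, hsep⟩, hmiss⟩, hcuts, hpairs⟩, htwins⟩ := hx
  have hr0 := hrn.pos hn
  have hlog := one_le_log hn
  have hup1 := localizationNumber_le_sq hrn hn hdense hballs
  have hup2 := localizationNumber_le_sensorScale hrn hn hdense hballs hsep hmiss
  have hlow := le_localizationNumber_of_pairCells hrn hn hcuts hpairs
  -- The constant from the twins is the smaller one, since `1166400 ≥ 108800`, and serves all four
  -- regimes.
  have hlow' : 1 / 1166400 * (r n ^ 2 * cellScale n (r n) ^ 2 / Real.log n) ≤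
      LocalizationGame.localizationNumber (torusGraph (r n) x) := by
    refine le_trans ?_ hlow
    rw [div_mul_div_comm, one_mul]
    gcongr
    norm_num
  have hlift : ∀ {a b : ℝ}, 0 ≤ b → a ≤ (sensorConst + 4) * b → a ≤ (sensorConst + 2402) * b :=
    fun hb h => by nlinarith
  have hsq0 : 0 ≤ r n ^ 2 := sq_nonneg _
  rintro ζ rfl
  refine ⟨fun h => ⟨?_, ?_⟩, fun h => ⟨?_, ?_⟩, fun h => ⟨?_, ?_⟩, fun h => ⟨?_, ?_⟩⟩
  · have hle : Real.log n ≤ r n := by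
      refine le_trans ?_ h
      calc Real.log n = Real.log n ^ (1 : ℝ) := (Real.rpow_one _).symm
        _ ≤ _ := Real.rpow_le_rpow_of_exponent_le hlog (by norm_num)
    rwa [← sq_mul_cellScale_sq_div hn hle]
  · rw [sensorScale_eq_rpow hn h] at hup2
    exact hlift (by positivity) hup2
  · rwa [← sq_mul_cellScale_sq_div hn h.1]
  · rw [sensorScale_eq_log_sq hn hr0.le h.2.le] at hup2
    exact hlift (by positivity) hup2
  · rwa [cellScale_eq_one hr0 h.2.le, one_pow, mul_one] at hlow'
  · nlinarith
  · have hrl := hlt _ h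
    have hlarge := hlog3 _ hrn hrl
    exact le_localizationNumber_of_hasTwins hrn hn hlarge hsq (htwins ⟨hlarge, hrl⟩)
  · nlinarith
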